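/- Let $\hbar$ be an indeterminate, $q=e^{\hbar}$, $\kappa_q=q-q^{-1}$, $[2]_q=q+q^{-1}$. All algebras are $\hbar$-adically complete unital associative $\mathbb C[[\hbar]]$-algebras given by topological generators and relations (quotients of the completed free algebra by the closure of the ideal of relations). For elements $a,b$ of weights $\alpha,\beta$ in a root lattice with form $(\cdot|\cdot)$ and parity $[\cdot]$ put $[\![a,b]\!]=ab-(-1)^{[\alpha][\beta]}q^{\nu}ba$, where $\nu=-(\alpha|\beta)$ if $\alpha,\beta$ are both in the positive cone, $\nu=(\alpha|\beta)$ if both are in the negative cone, and $\nu=0$ if they are in opposite cones. **The algebras.** $\mathrm U_q(\mathfrak{gl}_{2|1})$ has generators $K_1,K_2,K_3$ (weight $0$), $E_1,E_2$ (weights $\alpha_1,\alpha_2$), $F_1,F_2$ (weights $-\alpha_1,-\alpha_2$); $\alpha_1$ is even, $\alpha_2$ odd, $(\alpha_1|\alpha_1)=2$, $(\alpha_1|\alpha_2)=-1$, $(\alpha_2|\alpha_2)=0$. The relations are $[\![K_i,K_j]\!]=0$, $[\![K_i,E_j]\!]=(\delta_{i,j}-\delta_{i,j+1})E_j$, $[\![K_i,F_j]\!]=-(\delta_{i,j}-\delta_{i,j+1})F_j$,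 $[\![E_i,F_j]\!]=\delta_{ij}\kappa_q^{-1}(q^{H_i}-q^{-H_i})$ with $H_1=K_1-K_2$, $H_2=K_2+K_3$, $[\![E_2,E_2]\!]=[\![F_2,F_2]\!]=0$, $[\![E_1,[\![E_1,E_2]\!]]\!]=[\![F_1,[\![F_1,F_2]\!]]\!]=0$. Put $E_{12}=E_1$, $E_{23}=E_2$, $E_{13}=E_1E_2-qE_2E_1$, $F_{12}=F_1$, $F_{23}=F_2$, $F_{13}=F_2F_1-q^{-1}F_1F_2$. $\mathrm U_q(\mathcal L(\mathfrak{sl}_{2|1}))$ has generators $h_i,e_i,f_i$, $i=0,1,2$, of weights $0,\alpha_i,-\alpha_i$; $\alpha_0,\alpha_2$ are odd, $\alpha_1$ is even, $(\alpha_i|\alpha_j)=a_{ij}$ with $a_{00}=a_{22}=0$, $a_{11}=2$, $a_{01}=a_{12}=-1$, $a_{02}=1$, $a_{ij}=a_{ji}$. The relations are $h_0+h_1+h_2=0$, $[\![h_i,h_j]\!]=0$, $[\![h_i,e_j]\!]=a_{ij}e_j$, $[\![h_i,f_j]\!]=-a_{ij}f_j$, $[\![e_i,f_j]\!]=\delta_{ij}\kappa_q^{-1}(q^{h_i}-q^{-h_i})$,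 and, for $x=e$ and for $x=f$, $[\![x_0,x_0]\!]=[\![x_2,x_2]\!]=0$, $[\![x_1,[\![x_1,x_0]\!]]\!]=[\![x_1,[\![x_1,x_2]\!]]\!]=0$, $[\![x_0,[\![x_2,[\![x_0,[\![x_2,x_1]\!]]\!]]\!]]\!]=[\![x_2,[\![x_0,[\![x_2,[\![x_0,x_1]\!]]\!]]\!]]\!]$. **Root vectors.** Let $\delta=\alpha_0+\alpha_1+\alpha_2$, $\alpha_{12}=\alpha_1$, $\alpha_{23}=\alpha_2$, $\alpha_{13}=\alpha_1+\alpha_2$, and $e_{\alpha_{12}}=e_1$, $e_{\alpha_{23}}=e_2$, $e_{\alpha_{13}}=[\![e_1,e_2]\!]$, $e_{\delta-\alpha_{13}}=e_0$, $e_{\delta-\alpha_{12}}=[\![e_2,e_0]\!]$, $e_{\delta-\alpha_{23}}=[\![e_1,e_0]\!]$. For $n\ge1$ put $$e'_{n\delta,\alpha_1}=[\![e_{\alpha_{12}+(n-1)\delta},e_{\delta-\alpha_{12}}]\!],\qquad e'_{n\delta,\alpha_2}=-[\![e_{\alpha_{23}+(n-1)\delta},e_{\delta-\alpha_{23}}]\!],$$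 $$e_{\alpha_{12}+n\delta}=[2]_q^{-1}[\![e_{\alpha_{12}+(n-1)\delta},e'_{\delta,\alpha_1}]\!],\quad e_{\alpha_{13}+n\delta}=[\![e_{\alpha_{13}+(n-1)\delta},e'_{\delta,\alpha_2}]\!],\quad e_{\alpha_{23}+n\delta}=-[\![e_{\alpha_{23}+(n-1)\delta},e'_{\delta,\alpha_1}]\!],$$ $$e_{(\delta-\alpha_{12})+n\delta}=[2]_q^{-1}[\![e'_{\delta,\alpha_1},e_{(\delta-\alpha_{12})+(n-1)\delta}]\!],\quad e_{(\delta-\alpha_{13})+n\delta}=[\![e'_{\delta,\alpha_2},e_{(\delta-\alpha_{13})+(n-1)\delta}]\!],$$ $$e_{(\delta-\alpha_{23})+n\delta}=-[\![e'_{\delta,\alpha_1},e_{(\delta-\alpha_{23})+(n-1)\delta}]\!].$$ **The operator $O(\zeta)$.** Let $s_0,s_1,s_2\in\mathbb Z$, $s=s_0+s_1+s_2\neq0$, $s_{12}=s_1$, $s_{13}=s_1+s_2$, $s_{23}=s_2$. Put $$O_{11}=1-q^{2K_1}\zeta^s,\quad O_{22}=1-q^{2K_2}\zeta^s,\quad O_{33}=1-q^{-2K_3}\zeta^s,$$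 $$O_{12}=-\kappa_q\zeta^{s-s_{12}}q^{-1}F_{12}q^{K_1+K_2},\quad O_{13}=-\kappa_q\zeta^{s-s_{13}}q^{-1}F_{13}q^{K_1-K_3},\quad O_{23}=-\kappa_q\zeta^{s-s_{23}}q^{-1}F_{23}q^{K_2-K_3},$$ $$O_{21}=-\kappa_q\zeta^{s_{12}}E_{12},\quad O_{31}=\kappa_q\zeta^{s_{13}}E_{13},\quad O_{32}=\kappa_q\zeta^{s_{23}}E_{23},$$ and the quasi-determinants $$O'_{22}=O_{22}-O_{21}O_{11}^{-1}O_{12},\quad O'_{23}=O_{23}-O_{21}O_{11}^{-1}O_{13},\quad O'_{32}=O_{32}-O_{31}O_{11}^{-1}O_{12},$$ $$O'_{33}=O_{33}+O_{31}O_{11}^{-1}O_{13},\quad O''_{33}=O'_{33}+O'_{32}O'^{-1}_{22}O'_{23}.$$ For $a=\pm q^k$, $|_{\zeta\to(a\zeta)^{1/s}}$ denotes the substitution $\zeta\mapsto c\,\zeta^{1/s}$ for an arbitrary $c\in\mathbb C[[\hbar]]^\times$ with $c^s=a$; the results are formal series in $\zeta$ with rational exponents. **Theorem.** (i) There is a unique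 homomorphism of $\mathbb C[[\hbar]]$-algebras (the Jimbo homomorphism) $\epsilon:\mathrm U_q(\mathcal L(\mathfrak{sl}_{2|1}))\to\mathrm U_q(\mathfrak{gl}_{2|1})$ with $h_0\mapsto-K_3-K_1$, $h_1\mapsto K_1-K_2$, $h_2\mapsto K_2+K_3$, $e_0\mapsto-F_{13}q^{K_1-K_3}$, $e_1\mapsto E_{12}$, $e_2\mapsto E_{23}$, $f_0\mapsto q^{-K_1+K_3}E_{13}$, $f_1\mapsto F_{12}$, $f_2\mapsto F_{23}$. (ii) Let $\mathcal E_{\alpha_{ij}}(\zeta)=\sum_{n\ge0}\epsilon(e_{\alpha_{ij}+n\delta})\zeta^n$, $\mathcal E_{\delta-\alpha_{ij}}(\zeta)=\sum_{n\ge0}\epsilon(e_{(\delta-\alpha_{ij})+n\delta})\zeta^n$, $\mathcal E'_{\delta,\alpha_i}(\zeta)=\sum_{n\ge1}\epsilon(e'_{n\delta,\alpha_i})\zeta^n$. After the substitutions below $O_{11}$ is invertible, and so is $O'_{22}$ wherever its inverse occurs, and $$\kappa_q\,\mathcal E_{\alpha_{12}}(\zeta)=-\zeta^{-s_{12}}O_{21}(\zeta)O_{11}(\zeta)^{-1}\big|_{\zeta\to(q^2\zeta)^{1/s}},$$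 $$\kappa_q\,\mathcal E_{\alpha_{13}}(\zeta)=\zeta^{-s_{13}}O_{31}(\zeta)O_{11}(\zeta)^{-1}\big|_{\zeta\to(-q^2\zeta)^{1/s}},$$ $$\kappa_q\,\mathcal E_{\alpha_{23}}(\zeta)=\zeta^{-s_{23}}O'_{32}(\zeta)O'_{22}(\zeta)^{-1}\big|_{\zeta\to(q^3\zeta)^{1/s}},$$ $$\kappa_q\,\mathcal E_{\delta-\alpha_{12}}(\zeta)=q\,\zeta^{-(s-s_{12})}O_{11}(\zeta)^{-1}O_{12}(\zeta)\big|_{\zeta\to(q^2\zeta)^{1/s}},$$ $$\kappa_q\,\mathcal E_{\delta-\alpha_{13}}(\zeta)=q\,\zeta^{-(s-s_{13})}O_{11}(\zeta)^{-1}O_{13}(\zeta)\big|_{\zeta\to(-q^2\zeta)^{1/s}},$$ $$\kappa_q\,\mathcal E_{\delta-\alpha_{23}}(\zeta)=-q^2\zeta^{-(s-s_{23})}O'_{22}(\zeta)^{-1}O'_{23}(\zeta)\big|_{\zeta\to(q^3\zeta)^{1/s}},$$ $$\kappa_q\,\mathcal E'_{\delta,\alpha_1}(\zeta)=1-O_{11}(\zeta)^{-1}O'_{22}(\zeta)\big|_{\zeta\to(q^2\zeta)^{1/s}},\qquad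 \kappa_q\,\mathcal E'_{\delta,\alpha_2}(\zeta)=1-O'_{22}(\zeta)^{-1}O''_{33}(\zeta)\big|_{\zeta\to(q^3\zeta)^{1/s}}.$$ -/

import Mathlib

noncomputable section

open PowerSeries

namespace QLoop

/-! ### Scalars: `ℂ⟦X⟧` is `ℂ[[ħ]]`, the variable `X` being `ħ` -/

/-- `q ^ n = exp (n ħ)` in `ℂ[[ħ]]`. -/
def qz (n : ℤ) : ℂ⟦X⟧ := rescale (n : ℂ) (PowerSeries.exp ℂ)

/-- `κ_q = q - q⁻¹`. -/
def kappa : ℂ⟦X⟧ := qz 1 - qz (-1)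

/-- Division by `ħ` of a power series in `ħ` without constant term. -/
def hDiv {A : Type*} [Semiring A] (f : A⟦X⟧) : A⟦X⟧ :=
  PowerSeries.mk fun n => coeff (n + 1) f

/-! ### Topological presentations over `ℂ[[ħ]]` -/

/-- The `ħ`-adic completion of the free `ℂ[[ħ]]`-algebra on `G`: power series in the central
variable `ħ` with coefficients in the free `ℂ`-algebra. -/
abbrev Free (G : Type) : Type := PowerSeries (FreeAlgebra ℂ G)

lemma commute_map {G : Type} (r : ℂ⟦X⟧) (x : Free G) :
    PowerSeries.map (algebraMap ℂ (FreeAlgebra ℂ G)) r * x =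
      x * PowerSeries.map (algebraMap ℂ (FreeAlgebra ℂ G)) r := by
  ext n
  rw [coeff_mul, coeff_mul, ← Finset.Nat.sum_antidiagonal_swap]
  refine Finset.sum_congr rfl fun p _ => ?_
  simp only [Prod.fst_swap, Prod.snd_swap, coeff_map]
  exact Algebra.commutes _ _

instance instAlgebraFree (G : Type) : Algebra ℂ⟦X⟧ (Free G) :=
  (PowerSeries.map (algebraMap ℂ (FreeAlgebra ℂ G))).toAlgebra' commute_map

/-- `J` is closed in the `ħ`-adic topology. -/
def IsHClosed {G : Type} (J : TwoSidedIdeal (Free G)) : Prop :=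
  ∀ x : Free G, (∀ n : ℕ, ∃ y ∈ J, ∃ z : Free G, x - y = PowerSeries.X ^ n * z) → x ∈ J

/-- The smallest `ħ`-adically closed two-sided ideal containing `rel`. -/
def relIdeal {G : Type} (rel : Set (Free G)) : TwoSidedIdeal (Free G) :=
  sInf {J | rel ⊆ (J : Set (Free G)) ∧ IsHClosed J}

/-- The `ħ`-adically complete `ℂ[[ħ]]`-algebra topologically generated by `G` with the defining
relations `x = 0`, `x ∈ rel`. -/
abbrev Presented {G : Type} (rel : Set (Free G)) : Type := (relIdeal rel).ringCon.Quotient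

/-- The class of an element of the completed free algebra. -/
def cls {G : Type} (rel : Set (Free G)) (x : Free G) : Presented rel :=
  (relIdeal rel).ringCon.mk' x

/-- `q ^ H = exp (ħ H)`. -/
def qexp {G : Type} (H : FreeAlgebra ℂ G) : Free G :=
  PowerSeries.mk fun n => ((n.factorial : ℂ)⁻¹) • H ^ n

/-- `[H]_q = (q ^ H - q ^ (-H)) / (q - q⁻¹)`; numerator and denominator are divisible by `ħ`, and
the denominator divided by `ħ` is invertible. -/
def qbracket {G : Type} (H : FreeAlgebra ℂ G) : Free G :=
  (hDiv kappa)⁻¹ • hDiv (qexp H - qexp (-H))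

/-! ### The `q`-supercommutator -/

section Bracket

variable {n : ℕ} {A : Type*} [Ring A] [Algebra ℂ⟦X⟧ A]

/-- The bilinear form on the root lattice with Gram matrix `a`. -/
def form (a : Matrix (Fin n) (Fin n) ℤ) (α β : Fin n → ℤ) : ℤ := ∑ i, ∑ j, α i * a i j * β j

/-- The parity of a weight, as an integer modulo two, for given parities of the simple roots. -/
def par (p : Fin n → ℤ) (α : Fin n → ℤ) : ℤ := ∑ i, α i * p i

/-- The exponent of `q` in the `q`-supercommutator of elements of weights `α`, `β`: it is `-(α|β)`
if both weights are in the positive cone, `(α|β)` if both are in the negative cone, and `0` for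
weights in opposite cones. -/
def qexponent (a : Matrix (Fin n) (Fin n) ℤ) (α β : Fin n → ℤ) : ℤ :=
  if (∀ i, 0 ≤ α i) ∧ (∀ i, 0 ≤ β i) then -form a α β
  else if (∀ i, α i ≤ 0) ∧ (∀ i, β i ≤ 0) then form a α β
  else 0

/-- The `q`-supercommutator of `x` of weight `α` and `y` of weight `β`. -/
def qcomm (a : Matrix (Fin n) (Fin n) ℤ) (p : Fin n → ℤ) (α β : Fin n → ℤ) (x y : A) : A :=
  x * y - (((par p α * par p β).negOnePow : ℤ) * qz (qexponent a α β) : ℂ⟦X⟧) • (y * x)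

end Bracket

/-! ### The quantum superalgebra `U_q(gl_{2|1})`

The indices `1, 2, 3` of `K` are `0, 1, 2 : Fin 3`; the indices `1, 2` of the simple roots are
`0, 1 : Fin 2`. -/

inductive GlGen : Type
  | K (i : Fin 3)
  | E (i : Fin 2)
  | F (i : Fin 2)

namespace Gl

/-- The Gram matrix of the simple roots `α₁, α₂`. -/
def cartan : Matrix (Fin 2) (Fin 2) ℤ := !![2, -1; -1, 0]

/-- The root `α₁` is even, the root `α₂` is odd. -/
def parity : Fin 2 → ℤ := ![0, 1]

/-- `α_j(K_i)`, for `α_j = Ξ_j - Ξ_{j+1}`. -/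
def rootVal (i : Fin 3) (j : Fin 2) : ℤ :=
  (if i = j.castSucc then 1 else 0) - (if i = j.succ then 1 else 0)

/-- The simple roots in the root lattice. -/
def sr (i : Fin 2) : Fin 2 → ℤ := Pi.single i 1

/-- The generator `K_i`, as an element of the free algebra. -/
def k (i : Fin 3) : FreeAlgebra ℂ GlGen := FreeAlgebra.ι ℂ (GlGen.K i)

/-- `H₁ = K₁ - K₂`, `H₂ = K₂ + K₃`. -/
def H : Fin 2 → FreeAlgebra ℂ GlGen := ![k 0 - k 1, k 1 + k 2]

def fK (i : Fin 3) : Free GlGen := PowerSeries.C (k i)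
def fE (i : Fin 2) : Free GlGen := PowerSeries.C (FreeAlgebra.ι ℂ (GlGen.E i))
def fF (i : Fin 2) : Free GlGen := PowerSeries.C (FreeAlgebra.ι ℂ (GlGen.F i))

/-- The `q`-supercommutator in (the free algebra of) `U_q(gl_{2|1})`. -/
def br {A : Type*} [Ring A] [Algebra ℂ⟦X⟧ A] (α β : Fin 2 → ℤ) (x y : A) : A :=
  qcomm cartan parity α β x y

/-- The defining relations `x = 0` of `U_q(gl_{2|1})`. -/
inductive Rel : Free GlGen → Prop
  | KK (i j : Fin 3) : Rel (br 0 0 (fK i) (fK j))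
  | KE (i : Fin 3) (j : Fin 2) :
      Rel (br 0 (sr j) (fK i) (fE j) - (rootVal i j : ℂ⟦X⟧) • fE j)
  | KF (i : Fin 3) (j : Fin 2) :
      Rel (br 0 (-sr j) (fK i) (fF j) + (rootVal i j : ℂ⟦X⟧) • fF j)
  | EF (i j : Fin 2) :
      Rel (br (sr i) (-sr j) (fE i) (fF j) - if i = j then qbracket (H i) else 0)
  | EE : Rel (br (sr 1) (sr 1) (fE 1) (fE 1))
  | FF : Rel (br (-sr 1) (-sr 1) (fF 1) (fF 1))
  | serreE : Rel (br (sr 0) (sr 0 + sr 1) (fE 0) (br (sr 0) (sr 1) (fE 0) (fE 1)))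
  | serreF : Rel (br (-sr 0) (-sr 0 - sr 1) (fF 0) (br (-sr 0) (-sr 1) (fF 0) (fF 1)))

end Gl

/-- The quantum superalgebra `U_q(gl_{2|1})`. -/
abbrev UGl : Type := Presented {x | Gl.Rel x}

namespace Gl

def K (i : Fin 3) : UGl := cls _ (fK i)
def E12 : UGl := cls _ (fE 0)
def E23 : UGl := cls _ (fE 1)
def F12 : UGl := cls _ (fF 0)
def F23 : UGl := cls _ (fF 1)

/-- `E₁₃ = E₁ E₂ - q E₂ E₁`. -/
def E13 : UGl := E12 * E23 - qz 1 • (E23 * E12)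

/-- `F₁₃ = F₂ F₁ - q⁻¹ F₁ F₂`. -/
def F13 : UGl := F23 * F12 - qz (-1) • (F12 * F23)

/-- `q ^ (a K₁ + b K₂ + c K₃)`. -/
def qK (a b c : ℤ) : UGl := cls _ (qexp ((a : ℂ) • k 0 + (b : ℂ) • k 1 + (c : ℂ) • k 2))

end Gl

/-! ### The quantum loop superalgebra `U_q(L(sl_{2|1}))` -/

inductive LoopGen : Type
  | h (i : Fin 3)
  | e (i : Fin 3)
  | f (i : Fin 3)

namespace Loop

/-- The Cartan matrix of the affine Lie superalgebra, which is also the Gram matrix of the simple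
roots `α₀, α₁, α₂`. -/
def cartan : Matrix (Fin 3) (Fin 3) ℤ := !![0, -1, 1; -1, 2, -1; 1, -1, 0]

/-- The roots `α₀`, `α₂` are odd, the root `α₁` is even. -/
def parity : Fin 3 → ℤ := ![1, 0, 1]

/-- The simple roots in the root lattice. -/
def sr (i : Fin 3) : Fin 3 → ℤ := Pi.single i 1

def h' (i : Fin 3) : FreeAlgebra ℂ LoopGen := FreeAlgebra.ι ℂ (LoopGen.h i)

def fh (i : Fin 3) : Free LoopGen := PowerSeries.C (h' i)
def fe (i : Fin 3) : Free LoopGen := PowerSeries.C (FreeAlgebra.ι ℂ (LoopGen.e i))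
def ff (i : Fin 3) : Free LoopGen := PowerSeries.C (FreeAlgebra.ι ℂ (LoopGen.f i))

/-- The `q`-supercommutator in (the free algebra of) `U_q(L(sl_{2|1}))`. -/
def br {A : Type*} [Ring A] [Algebra ℂ⟦X⟧ A] (α β : Fin 3 → ℤ) (x y : A) : A :=
  qcomm cartan parity α β x y

/-- `[[x_i, [[x_j, [[x_i, [[x_j, x₁]]]]]]]]` for generators `x_i` of weights `ε α_i`, `ε = ±1`. -/
def quintic (ε : ℤ) (x : Fin 3 → Free LoopGen) (i j : Fin 3) : Free LoopGen :=
  br (ε • sr i) (ε • (sr j + (sr i + (sr j + sr 1)))) (x i)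
    (br (ε • sr j) (ε • (sr i + (sr j + sr 1))) (x j)
      (br (ε • sr i) (ε • (sr j + sr 1)) (x i)
        (br (ε • sr j) (ε • sr 1) (x j) (x 1))))

/-- The defining relations `x = 0` of `U_q(L(sl_{2|1}))`. -/
inductive Rel : Free LoopGen → Prop
  | sum : Rel (fh 0 + fh 1 + fh 2)
  | hh (i j : Fin 3) : Rel (br 0 0 (fh i) (fh j))
  | he (i j : Fin 3) : Rel (br 0 (sr j) (fh i) (fe j) - (cartan i j : ℂ⟦X⟧) • fe j)
  | hf (i j : Fin 3) : Rel (br 0 (-sr j) (fh i) (ff j) + (cartan i j : ℂ⟦X⟧) • ff j)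
  | ef (i j : Fin 3) :
      Rel (br (sr i) (-sr j) (fe i) (ff j) - if i = j then qbracket (h' i) else 0)
  | ee0 : Rel (br (sr 0) (sr 0) (fe 0) (fe 0))
  | ff0 : Rel (br (-sr 0) (-sr 0) (ff 0) (ff 0))
  | ee2 : Rel (br (sr 2) (sr 2) (fe 2) (fe 2))
  | ff2 : Rel (br (-sr 2) (-sr 2) (ff 2) (ff 2))
  | serreE0 : Rel (br (sr 1) (sr 1 + sr 0) (fe 1) (br (sr 1) (sr 0) (fe 1) (fe 0)))
  | serreF0 : Rel (br (-sr 1) (-sr 1 - sr 0) (ff 1) (br (-sr 1) (-sr 0) (ff 1) (ff 0)))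
  | serreE2 : Rel (br (sr 1) (sr 1 + sr 2) (fe 1) (br (sr 1) (sr 2) (fe 1) (fe 2)))
  | serreF2 : Rel (br (-sr 1) (-sr 1 - sr 2) (ff 1) (br (-sr 1) (-sr 2) (ff 1) (ff 2)))
  | quinticE : Rel (quintic 1 fe 0 2 - quintic 1 fe 2 0)
  | quinticF : Rel (quintic (-1) ff 0 2 - quintic (-1) ff 2 0)

end Loop

/-- The quantum loop superalgebra `U_q(L(sl_{2|1}))`. -/
abbrev ULoop : Type := Presented {x | Loop.Rel x}

namespace Loop

def h (i : Fin 3) : ULoop := cls _ (fh i)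
def e (i : Fin 3) : ULoop := cls _ (fe i)
def f (i : Fin 3) : ULoop := cls _ (ff i)

/-! Roots and root vectors. -/

/-- `δ = α₀ + α₁ + α₂`. -/
def δ : Fin 3 → ℤ := sr 0 + sr 1 + sr 2

def α12 : Fin 3 → ℤ := sr 1
def α23 : Fin 3 → ℤ := sr 2
def α13 : Fin 3 → ℤ := sr 1 + sr 2

/-- `[2]_q = q + q⁻¹`. -/
def two : ℂ⟦X⟧ := qz 1 + qz (-1)

/-- `e_{δ - α₁₂} = [[e_{α₂₃}, e_{δ - α₁₃}]]`, where `e_{δ - α₁₃} = e₀`. -/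
def eδ12 : ULoop := br α23 (δ - α13) (e 2) (e 0)

/-- `e_{δ - α₂₃} = [[e_{α₁₂}, e_{δ - α₁₃}]]`. -/
def eδ23 : ULoop := br α12 (δ - α13) (e 1) (e 0)

/-- `e'_{δ, α₁} = [[e_{α₁}, e_{δ - α₁}]]`. -/
def eδ1 : ULoop := br α12 (δ - α12) (e 1) eδ12

/-- `e'_{δ, α₂} = -[[e_{α₂}, e_{δ - α₂}]]`. -/
def eδ2 : ULoop := -br α23 (δ - α23) (e 2) eδ23

/-- The root vectors `e_{α₁₂ + n δ}`. -/
def e12 : ℕ → ULoop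
  | 0 => e 1
  | n + 1 => two⁻¹ • br (α12 + n • δ) δ (e12 n) eδ1

/-- The root vectors `e_{α₁₃ + n δ}`. -/
def e13 : ℕ → ULoop
  | 0 => br α12 α23 (e 1) (e 2)
  | n + 1 => br (α13 + n • δ) δ (e13 n) eδ2

/-- The root vectors `e_{α₂₃ + n δ}`. -/
def e23 : ℕ → ULoop
  | 0 => e 2
  | n + 1 => -br (α23 + n • δ) δ (e23 n) eδ1

/-- The root vectors `e_{(δ - α₁₂) + n δ}`. -/
def d12 : ℕ → ULoop
  | 0 => eδ12
  | n + 1 => two⁻¹ • br δ (δ - α12 + n • δ) eδ1 (d12 n)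

/-- The root vectors `e_{(δ - α₁₃) + n δ}`. -/
def d13 : ℕ → ULoop
  | 0 => e 0
  | n + 1 => br δ (δ - α13 + n • δ) eδ2 (d13 n)

/-- The root vectors `e_{(δ - α₂₃) + n δ}`. -/
def d23 : ℕ → ULoop
  | 0 => eδ23
  | n + 1 => -br δ (δ - α23 + n • δ) eδ1 (d23 n)

/-- The root vectors `e'_{n δ, α₁} = [[e_{α₁ + (n - 1) δ}, e_{δ - α₁}]]`, `n ≥ 1`. -/
def im1 : ℕ → ULoop
  | 0 => 0
  | n + 1 => br (α12 + n • δ) (δ - α12) (e12 n) eδ12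

/-- The root vectors `e'_{n δ, α₂} = -[[e_{α₂ + (n - 1) δ}, e_{δ - α₂}]]`, `n ≥ 1`. -/
def im2 : ℕ → ULoop
  | 0 => 0
  | n + 1 => -br (α23 + n • δ) (δ - α23) (e23 n) eδ23

end Loop

/-! ### The Jimbo homomorphism and the generating functions -/

/-- The values of the Jimbo homomorphism on the generators. -/
structure IsJimbo (ε : ULoop →ₐ[ℂ⟦X⟧] UGl) : Prop where
  h0 : ε (Loop.h 0) = -Gl.K 2 - Gl.K 0
  h1 : ε (Loop.h 1) = Gl.K 0 - Gl.K 1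
  h2 : ε (Loop.h 2) = Gl.K 1 + Gl.K 2
  e0 : ε (Loop.e 0) = -(Gl.F13 * Gl.qK 1 0 (-1))
  e1 : ε (Loop.e 1) = Gl.E12
  e2 : ε (Loop.e 2) = Gl.E23
  f0 : ε (Loop.f 0) = Gl.qK (-1) 0 1 * Gl.E13
  f1 : ε (Loop.f 1) = Gl.F12
  f2 : ε (Loop.f 2) = Gl.F23

/-- The generating function `∑ ε(u n) ζ ^ n` of the images of a sequence of root vectors. -/
def gen (ε : ULoop →ₐ[ℂ⟦X⟧] UGl) (u : ℕ → ULoop) : PowerSeries UGl :=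
  PowerSeries.mk fun n => ε (u n)

/-- The embedding of formal power series in `ζ` into formal series in `ζ` with rational
exponents. -/
def toHahn (φ : PowerSeries UGl) : HahnSeries ℚ UGl := HahnSeries.ofPowerSeries ℚ UGl φ

/-! ### The operator `O(ζ)` -/

section Operator

/-- The monomial `a ζ ^ m` with `a ∈ U_q(gl_{2|1})`. -/
def monoU (a : UGl) (m : ℤ) : LaurentPolynomial UGl :=
  LaurentPolynomial.C a * LaurentPolynomial.T m

/-- The monomial `r ζ ^ m` with `r ∈ ℂ[[ħ]]`. -/
def mono (r : ℂ⟦X⟧) (m : ℤ) : LaurentPolynomial UGl := monoU (algebraMap ℂ⟦X⟧ UGl r) m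

/-- The components `O_{ij}(ζ)`, `i, j = 1, 2, 3`, of the operator `O(ζ)`. The integers
`s 0, s 1, s 2` are the parameters `s₀, s₁, s₂` of the spectral parameter grading; here
`S = s₀ + s₁ + s₂`, and `s₁₂ = s₁`, `s₁₃ = s₁ + s₂`, `s₂₃ = s₂`. -/
def O (s : Fin 3 → ℤ) : Matrix (Fin 3) (Fin 3) (LaurentPolynomial UGl) :=
  let S := s 0 + s 1 + s 2
  let b : ℂ⟦X⟧ := kappa * qz (-1)
  !![1 - monoU (Gl.qK 2 0 0) S,
      -monoU (b • (Gl.F12 * Gl.qK 1 1 0)) (S - s 1),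
      -monoU (b • (Gl.F13 * Gl.qK 1 0 (-1))) (S - (s 1 + s 2));
    -monoU (kappa • Gl.E12) (s 1),
      1 - monoU (Gl.qK 0 2 0) S,
      -monoU (b • (Gl.F23 * Gl.qK 0 1 (-1))) (S - s 2);
    monoU (kappa • Gl.E13) (s 1 + s 2),
      monoU (kappa • Gl.E23) (s 2),
      1 - monoU (Gl.qK 0 0 (-2)) S]

/-- The substitution `ζ → c ζ ^ (1 / S)` in a Laurent polynomial in `ζ`. -/
def zetaSubst (S : ℤ) (c : ℂ⟦X⟧ˣ) (p : LaurentPolynomial UGl) : HahnSeries ℚ UGl :=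
  p.coeff.sum fun n a => HahnSeries.single ((n : ℚ) / (S : ℚ)) (((c ^ n : ℂ⟦X⟧ˣ) : ℂ⟦X⟧) • a)

/-- The matrix `O(ζ)` after the substitution `ζ → c ζ ^ (1 / S)`, `S = s₀ + s₁ + s₂`. -/
def Osub (s : Fin 3 → ℤ) (c : ℂ⟦X⟧ˣ) : Matrix (Fin 3) (Fin 3) (HahnSeries ℚ UGl) :=
  (O s).map (zetaSubst (s 0 + s 1 + s 2) c)

end Operator

/-! Quasi-determinants of a `3 × 3` matrix over a noncommutative ring, with the signs of the
superalgebra conventions. -/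

section QuasiDet

variable {R : Type*} [Ring R] (A : Matrix (Fin 3) (Fin 3) R)

/-- `O'₂₂ = O₂₂ - O₂₁ O₁₁⁻¹ O₁₂`. -/
def qd22 : R := A 1 1 - A 1 0 * Ring.inverse (A 0 0) * A 0 1

/-- `O'₂₃ = O₂₃ - O₂₁ O₁₁⁻¹ O₁₃`. -/
def qd23 : R := A 1 2 - A 1 0 * Ring.inverse (A 0 0) * A 0 2

/-- `O'₃₂ = O₃₂ - O₃₁ O₁₁⁻¹ O₁₂`. -/
def qd32 : R := A 2 1 - A 2 0 * Ring.inverse (A 0 0) * A 0 1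

/-- `O'₃₃ = O₃₃ + O₃₁ O₁₁⁻¹ O₁₃`. -/
def qd33 : R := A 2 2 + A 2 0 * Ring.inverse (A 0 0) * A 0 2

/-- `O''₃₃ = O'₃₃ + O'₃₂ (O'₂₂)⁻¹ O'₂₃`. -/
def qdd33 : R := qd33 A + qd32 A * Ring.inverse (qd22 A) * qd23 A

end QuasiDet

end QLoop

end

noncomputable section

set_option linter.unusedSimpArgs false
set_option linter.unnecessarySeqFocus false

open PowerSeries

namespace QLoop


/-! ### Topological presentations -/

section Presentations

variable {G G' : Type}

/-! Existence in (i) is a finite check. A map on topological generators extends to the completed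
free algebra (`liftFree`) and descends to the quotient once it kills the relations
(`liftPresented`), because the preimage of a closed ideal is closed. Uniqueness (`algHom_ext`) holds
because presented algebras are `ħ`-adically separated and a `ℂ[[ħ]]`-linear map sends multiples of
`ħ ^ n` to multiples of `ħ ^ n`.

This check and all later computations in `U_q(gl_{2|1})` are normal ordering. `GlOrdering` collects
rules that straighten any product into the order `F₁, F₁₃, F₂, E₁, E₁₃, E₂, [H₁], [H₂], q ^ K`.
Independence of the ordered monomials is never needed, and neither is cancellation of `κ_q`: the
`[H_i]_q` are kept as symbols `b1`, `b2`, tied to the Cartan part by `κ_q b1 = q ^ H₁ - q ^ (-H₁)`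
and its analogue for `b2`.

For (ii) let `a` be the image of `e'_{δ,α₁}`. The commutator of `E₁` with `a` is `[2]_q E₁ q² q ^ (2
K₁)`, and `q ^ (2 K₁)` commutes with `a`; so the images of `e_{α₁₂+nδ}` form a geometric
progression, whose generating function is `E₁` times the inverse of `O₁₁` at `ζ ^ s → q² ζ`. The
same happens for `α₁₃`, with `e'_{δ,α₂}` and ratio `-q² q ^ (2 K₁)`, and for the dual root vectors.

For `α₂₃` the recursion has order two. One finds `[a, E₂] = E₂ D + N` and `[a, N] = -E₂ D'`, where
`D` and `D'` commute with `a`; hence `e_{n+2} = e_{n+1} D - e_n D'` (`CommutatorPair.e_add_two`),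
and the generating function times `1 - D X + D' X²` is `E₂ + N X`. That quadratic is `O'₂₂` at `ζ ^
s → q³ ζ` times a linear factor, on either side (`series22_mul`), and cancelling the linear factor
gives the quasi-determinant formulas.

The images of `e'_{nδ,α₂}` are, up to sign, the anticommutators `w_n` of `e_n` with `d_0`. They
satisfy an inhomogeneous form of the same recursion (`pairing_add_two`), with coefficients on the
right, whereas the theorem has `O'₂₂⁻¹` on the left. What reconciles the two is that `D` and `D'`
commute with every `w_n` (`D_pairing_all`, `D'_pairing`). The inhomogeneous term then accounts for
`O'₃₂ O'₂₂⁻¹ O'₂₃` in `O''₃₃`. -/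

lemma algebraMap_free (r : ℂ⟦X⟧) :
    algebraMap ℂ⟦X⟧ (Free G) r = PowerSeries.map (algebraMap ℂ (FreeAlgebra ℂ G)) r := rfl

lemma smul_free (r : ℂ⟦X⟧) (x : Free G) :
    r • x = PowerSeries.map (algebraMap ℂ (FreeAlgebra ℂ G)) r * x := rfl

lemma subset_relIdeal (rel : Set (Free G)) : rel ⊆ (relIdeal rel : Set (Free G)) := by
  intro x hx
  simp only [relIdeal, SetLike.mem_coe, TwoSidedIdeal.mem_sInf]
  exact fun J hJ => hJ.1 hx

lemma relIdeal_le {rel : Set (Free G)} {J : TwoSidedIdeal (Free G)}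
    (h : rel ⊆ (J : Set (Free G))) (hJ : IsHClosed J) : relIdeal rel ≤ J :=
  sInf_le ⟨h, hJ⟩

lemma isHClosed_relIdeal (rel : Set (Free G)) : IsHClosed (relIdeal rel) := by
  intro x hx
  simp only [relIdeal, TwoSidedIdeal.mem_sInf]
  intro J hJ
  refine hJ.2 x fun n => ?_
  obtain ⟨y, hy, z, hz⟩ := hx n
  exact ⟨y, relIdeal_le hJ.1 hJ.2 hy, z, hz⟩

/-- The projection `cls` as a homomorphism of algebras. -/
def clsHom (rel : Set (Free G)) : Free G →ₐ[ℂ⟦X⟧] Presented rel :=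
  RingCon.mkₐ ℂ⟦X⟧ (relIdeal rel).ringCon

lemma clsHom_surjective (rel : Set (Free G)) : Function.Surjective (clsHom rel) :=
  fun x => Quotient.inductionOn' x fun y => ⟨y, rfl⟩

lemma clsHom_eq_zero {rel : Set (Free G)} {x : Free G} :
    clsHom rel x = 0 ↔ x ∈ relIdeal rel := by
  rw [← map_zero (clsHom rel)]
  exact (RingCon.eq _).trans Iff.rfl

lemma clsHom_of_mem {rel : Set (Free G)} {x : Free G} (h : x ∈ rel) : clsHom rel x = 0 :=
  clsHom_eq_zero.2 (subset_relIdeal rel h)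

lemma exists_eq_sum_add_X_pow_mul {A : Type*} [Ring A] (x : A⟦X⟧) (n : ℕ) :
    ∃ z, x = ∑ i ∈ Finset.range n, PowerSeries.X ^ i * PowerSeries.C (coeff i x) +
      PowerSeries.X ^ n * z := by
  refine ⟨PowerSeries.mk fun i => coeff (i + n) x, ?_⟩
  ext m
  rw [map_add, map_sum, coeff_X_pow_mul']
  simp only [coeff_X_pow_mul', coeff_C, coeff_mk]
  by_cases h : n ≤ m
  · rw [Finset.sum_eq_zero, if_pos h, zero_add, Nat.sub_add_cancel h]
    intro i hi
    have := Finset.mem_range.1 hi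
    rw [if_pos (by omega), if_neg (by omega)]
  · rw [if_neg h, add_zero, Finset.sum_eq_single m]
    · simp
    · intro i _ hi
      split_ifs <;> first | rfl | omega
    · intro hm
      exact absurd (Finset.mem_range.2 (by omega)) hm

/-- This is where closedness of the ideal enters: each truncation of the series lies in the ideal,
and the remainder is a multiple of `ħ ^ n`. -/
lemma clsHom_eq_zero_of_coeff {rel : Set (Free G)} {x : Free G}
    (h : ∀ n, clsHom rel (PowerSeries.C (coeff n x)) = 0) : clsHom rel x = 0 := by
  refine clsHom_eq_zero.2 (isHClosed_relIdeal rel x fun n => ?_)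
  obtain ⟨z, hz⟩ := exists_eq_sum_add_X_pow_mul x n
  refine ⟨_, ?_, z, sub_eq_of_eq_add' hz⟩
  rw [← clsHom_eq_zero, map_sum]
  exact Finset.sum_eq_zero fun i _ => by rw [map_mul, h, mul_zero]

/-- The restriction of the projection to the constants. -/
def clsConst (rel : Set (Free G)) : FreeAlgebra ℂ G →+* Presented rel :=
  (clsHom rel).toRingHom.comp PowerSeries.C

lemma clsConst_apply (rel : Set (Free G)) (x : FreeAlgebra ℂ G) :
    clsConst rel x = clsHom rel (PowerSeries.C x) := rfl

/-- Two series whose coefficients have the same images have the same image. -/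
lemma clsHom_congr {rel : Set (Free G)} {x y : Free G}
    (h : PowerSeries.map (clsConst rel) x = PowerSeries.map (clsConst rel) y) :
    clsHom rel x = clsHom rel y := by
  rw [← sub_eq_zero, ← map_sub]
  refine clsHom_eq_zero_of_coeff fun n => ?_
  have := congrArg (coeff n) h
  rw [coeff_map, coeff_map, clsConst_apply, clsConst_apply] at this
  rw [map_sub, map_sub, map_sub, this, sub_self]

lemma smul_X_free (n : ℕ) (x : Free G) :
    (PowerSeries.X ^ n : ℂ⟦X⟧) • x = PowerSeries.X ^ n * x := by
  rw [smul_free, map_pow, PowerSeries.map_X]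

/-- The presented algebra is `ħ`-adically separated. -/
lemma presented_eq_zero {rel : Set (Free G)} {x : Presented rel}
    (h : ∀ n : ℕ, ∃ y : Presented rel, x = (PowerSeries.X ^ n : ℂ⟦X⟧) • y) : x = 0 := by
  obtain ⟨x, rfl⟩ := clsHom_surjective rel x
  refine clsHom_eq_zero.2 (isHClosed_relIdeal rel x fun n => ?_)
  obtain ⟨y, hy⟩ := h n
  obtain ⟨y, rfl⟩ := clsHom_surjective rel y
  refine ⟨x - PowerSeries.X ^ n * y, ?_, y, by abel⟩
  rw [← clsHom_eq_zero, map_sub, hy, ← smul_X_free, map_smul, sub_self]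

/-- Homomorphisms between presented algebras agree if they agree on the generators. -/
lemma algHom_ext {rel : Set (Free G)} {rel' : Set (Free G')}
    {φ ψ : Presented rel →ₐ[ℂ⟦X⟧] Presented rel'}
    (h : ∀ g, φ (clsHom rel (PowerSeries.C (FreeAlgebra.ι ℂ g))) =
      ψ (clsHom rel (PowerSeries.C (FreeAlgebra.ι ℂ g)))) : φ = ψ := by
  have hC : ∀ a : FreeAlgebra ℂ G, φ (clsHom rel (PowerSeries.C a)) =
      ψ (clsHom rel (PowerSeries.C a)) := by
    intro a
    induction a using FreeAlgebra.induction with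
    | grade0 r =>
      have : (PowerSeries.C (algebraMap ℂ (FreeAlgebra ℂ G) r) : Free G) =
          algebraMap ℂ⟦X⟧ (Free G) (PowerSeries.C r) := by
        rw [algebraMap_free, PowerSeries.map_C]
      rw [this, AlgHom.commutes, AlgHom.commutes, AlgHom.commutes]
    | grade1 g => exact h g
    | mul a b ha hb => rw [map_mul, map_mul, map_mul, map_mul, ha, hb]
    | add a b ha hb => rw [map_add, map_add, map_add, map_add, ha, hb]
  refine AlgHom.ext fun x => ?_
  obtain ⟨x, rfl⟩ := clsHom_surjective rel x
  -- No continuity has to be assumed: modulo `ħ ^ n` only finitely many coefficients matter, and on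
  -- these the two maps agree.
  rw [← sub_eq_zero]
  refine presented_eq_zero fun n => ?_
  obtain ⟨z, hz⟩ := exists_eq_sum_add_X_pow_mul x n
  refine ⟨φ (clsHom rel z) - ψ (clsHom rel z), ?_⟩
  have hs : ∀ χ : Presented rel →ₐ[ℂ⟦X⟧] Presented rel', χ (clsHom rel x) =
      ∑ i ∈ Finset.range n, (PowerSeries.X ^ i : ℂ⟦X⟧) •
        χ (clsHom rel (PowerSeries.C (coeff i x))) +
      (PowerSeries.X ^ n : ℂ⟦X⟧) • χ (clsHom rel z) := by
    intro χ
    conv_lhs => rw [hz]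
    simp only [map_add, map_sum, ← smul_X_free, map_smul]
  rw [hs φ, hs ψ, smul_sub, Finset.sum_congr rfl fun i _ => by rw [hC]]
  abel

/-- The ring homomorphism `A⟦Y⟧⟦X⟧ → A⟦X⟧`, `Y ↦ X`. -/
def diag (A : Type*) [Ring A] : A⟦X⟧⟦X⟧ →+* A⟦X⟧ where
  toFun x := PowerSeries.mk fun n =>
    ∑ p ∈ Finset.HasAntidiagonal.antidiagonal n, coeff p.2 (coeff p.1 x)
  map_one' := by
    ext n
    rw [coeff_mk]
    rw [Finset.sum_eq_single (0, n)]
    · simp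
    · intro p hp hne
      rw [coeff_one, if_neg, map_zero]
      intro h0
      apply hne
      rw [Finset.HasAntidiagonal.mem_antidiagonal] at hp
      ext <;> simp <;> omega
    · simp
  map_zero' := by ext n; simp
  map_add' x y := by ext n; simp [Finset.sum_add_distrib]
  map_mul' x y := by
    ext n
    simp only [coeff_mk, coeff_mul, map_sum, Finset.sum_mul_sum]
    simp only [← Finset.sum_product']
    rw [Finset.sum_sigma', Finset.sum_sigma']
    -- Both sides sum over quadruples with total `n`, read as a two by two array grouped by rows or
    -- by columns. Transposing the array is an involution, so the same map serves in both
    -- directions.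
    refine Finset.sum_nbij' (fun s => ⟨(s.2.1.1 + s.2.2.1, s.2.1.2 + s.2.2.2),
        ((s.2.1.1, s.2.2.1), (s.2.1.2, s.2.2.2))⟩)
      (fun s => ⟨(s.2.1.1 + s.2.2.1, s.2.1.2 + s.2.2.2),
        ((s.2.1.1, s.2.2.1), (s.2.1.2, s.2.2.2))⟩) ?_ ?_ ?_ ?_ ?_
    · rintro ⟨⟨a, b⟩, ⟨⟨c, d⟩, ⟨e, f⟩⟩⟩ h
      simp only [Finset.mem_sigma, Finset.mem_product,
        Finset.HasAntidiagonal.mem_antidiagonal] at h ⊢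
      refine ⟨?_, trivial, trivial⟩
      omega
    · rintro ⟨⟨a, b⟩, ⟨⟨c, d⟩, ⟨e, f⟩⟩⟩ h
      simp only [Finset.mem_sigma, Finset.mem_product,
        Finset.HasAntidiagonal.mem_antidiagonal] at h ⊢
      refine ⟨?_, trivial, trivial⟩
      omega
    · rintro ⟨⟨a, b⟩, ⟨⟨c, d⟩, ⟨e, f⟩⟩⟩ h
      simp only [Finset.mem_sigma, Finset.mem_product,
        Finset.HasAntidiagonal.mem_antidiagonal] at h ⊢
      obtain ⟨-, rfl, rfl⟩ := h
      rfl
    · rintro ⟨⟨a, b⟩, ⟨⟨c, d⟩, ⟨e, f⟩⟩⟩ h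
      simp only [Finset.mem_sigma, Finset.mem_product,
        Finset.HasAntidiagonal.mem_antidiagonal] at h ⊢
      obtain ⟨-, rfl, rfl⟩ := h
      rfl
    · intro s _
      rfl

lemma coeff_diag {A : Type*} [Ring A] (x : A⟦X⟧⟦X⟧) (n : ℕ) :
    coeff n (diag A x) =
      ∑ p ∈ Finset.HasAntidiagonal.antidiagonal n, coeff p.2 (coeff p.1 x) :=
  PowerSeries.coeff_mk n (R := A)
    (fun n => ∑ p ∈ Finset.HasAntidiagonal.antidiagonal n, coeff p.2 (coeff p.1 x))

lemma diag_C {A : Type*} [Ring A] (x : A⟦X⟧) :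
    diag A (PowerSeries.C x) = x := by
  ext n
  rw [coeff_diag, Finset.sum_eq_single (0, n)]
  · simp
  · intro p hp hne
    rw [coeff_C, if_neg, map_zero]
    intro h0
    apply hne
    rw [Finset.HasAntidiagonal.mem_antidiagonal] at hp
    ext <;> simp <;> omega
  · simp

lemma diag_map_C {A : Type*} [Ring A] (x : A⟦X⟧) :
    diag A (PowerSeries.map PowerSeries.C x) = x := by
  ext n
  rw [coeff_diag, Finset.sum_eq_single (n, 0)]
  · simp
  · intro p hp hne
    rw [coeff_map, coeff_C, if_neg]
    intro h0
    apply hne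
    rw [Finset.HasAntidiagonal.mem_antidiagonal] at hp
    ext <;> simp <;> omega
  · simp

/-- The extension of a map on generators to a homomorphism of completed free algebras. -/
def liftFree (g : G → Free G') : Free G →ₐ[ℂ⟦X⟧] Free G' where
  toRingHom := (diag (FreeAlgebra ℂ G')).comp
    (PowerSeries.map (FreeAlgebra.lift ℂ g : FreeAlgebra ℂ G →ₐ[ℂ] Free G').toRingHom)
  commutes' r := by
    change diag _ (PowerSeries.map _ (PowerSeries.map _ r)) = PowerSeries.map _ r
    conv_rhs => rw [← diag_map_C (PowerSeries.map _ r)]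
    congr 1
    ext1 n
    rw [coeff_map, coeff_map, coeff_map, coeff_map]
    exact (AlgHom.commutes (FreeAlgebra.lift ℂ g) _).trans
      (by rw [PowerSeries.algebraMap_apply])

lemma liftFree_apply (g : G → Free G') (x : Free G) :
    liftFree g x = diag (FreeAlgebra ℂ G')
      (PowerSeries.map (FreeAlgebra.lift ℂ g : FreeAlgebra ℂ G →ₐ[ℂ] Free G').toRingHom x) := rfl

lemma liftFree_C (g : G → Free G') (a : FreeAlgebra ℂ G) :
    liftFree g (PowerSeries.C a) = FreeAlgebra.lift ℂ g a := by
  rw [liftFree_apply, PowerSeries.map_C, diag_C]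
  rfl

lemma liftFree_ι (g : G → Free G') (i : G) :
    liftFree g (PowerSeries.C (FreeAlgebra.ι ℂ i)) = g i := by
  rw [liftFree_C, FreeAlgebra.lift_ι_apply]

/-- When the coefficients go to constants, the diagonal map mixes no powers of `ħ`. This applies to
exponentials and `q`-numbers of Cartan elements. -/
lemma liftFree_eq_of_coeff (g : G → Free G') {x : Free G} {y : Free G'}
    (h : ∀ n, FreeAlgebra.lift ℂ g (coeff n x) = PowerSeries.C (coeff n y)) :
    liftFree g x = y := by
  rw [liftFree_apply]
  conv_rhs => rw [← diag_map_C y]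
  congr 1
  ext1 n
  rw [coeff_map, coeff_map]
  exact h n

/-- The preimage of the target ideal is an ideal containing the relations, and it is closed because
`liftFree` is `ℂ[[ħ]]`-linear and so respects approximation modulo `ħ ^ n`. Minimality of `relIdeal`
finishes the argument. -/
lemma liftFree_relIdeal_le (g : G → Free G') {rel : Set (Free G)} {rel' : Set (Free G')}
    (h : ∀ x ∈ rel, clsHom rel' (liftFree g x) = 0) :
    relIdeal rel ≤ (relIdeal rel').comap (liftFree g) := by
  refine relIdeal_le (fun x hx => ?_) fun x hx => ?_
  · rw [SetLike.mem_coe, TwoSidedIdeal.mem_comap, ← clsHom_eq_zero]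
    exact h x hx
  · rw [TwoSidedIdeal.mem_comap]
    refine isHClosed_relIdeal rel' _ fun n => ?_
    obtain ⟨y, hy, z, hz⟩ := hx n
    refine ⟨liftFree g y, (TwoSidedIdeal.mem_comap _).1 hy, liftFree g z, ?_⟩
    rw [← map_sub, hz, ← smul_X_free, map_smul, smul_X_free]

/-- A map on generators which respects the relations extends to the presented algebra. -/
def liftPresented (g : G → Free G') {rel : Set (Free G)} {rel' : Set (Free G')}
    (h : ∀ x ∈ rel, clsHom rel' (liftFree g x) = 0) :
    Presented rel →ₐ[ℂ⟦X⟧] Presented rel' :=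
  RingCon.liftₐ _ ((clsHom rel').comp (liftFree g)) fun x y hxy => by
    have h1 := liftFree_relIdeal_le g h ((TwoSidedIdeal.rel_iff _ _ _).1 hxy)
    rw [TwoSidedIdeal.mem_comap, ← clsHom_eq_zero, map_sub, map_sub, sub_eq_zero] at h1
    exact h1

end Presentations


/-! ### Exponentials and `q`-numbers -/

section Exponentials

variable {A : Type*} [Ring A]

lemma X_mul_hDiv {f : A⟦X⟧} (hf : coeff 0 f = 0) : PowerSeries.X * hDiv f = f := by
  ext n
  cases n with
  | zero => rw [coeff_zero_X_mul, hf]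
  | succ n => rw [coeff_succ_X_mul, hDiv, coeff_mk]

lemma coeff_zero_mul (f g : A⟦X⟧) : coeff 0 (f * g) = coeff 0 f * coeff 0 g := by
  simp only [coeff_zero_eq_constantCoeff_apply, map_mul]

lemma hDiv_X_mul (f : A⟦X⟧) : hDiv (PowerSeries.X * f) = f := by
  ext n; rw [hDiv, coeff_mk, coeff_succ_X_mul]

lemma hDiv_add (f g : A⟦X⟧) : hDiv (f + g) = hDiv f + hDiv g := by
  ext n; simp [hDiv]

lemma hDiv_neg (f : A⟦X⟧) : hDiv (-f) = -hDiv f := by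
  ext n; simp [hDiv]

lemma hDiv_mul_right {f : A⟦X⟧} (g : A⟦X⟧) (hf : coeff 0 f = 0) :
    hDiv (f * g) = hDiv f * g := by
  apply PowerSeries.X_mul_cancel
  rw [← mul_assoc, X_mul_hDiv hf, X_mul_hDiv]
  rw [coeff_zero_mul, hf, zero_mul]

lemma hDiv_mul_left {f : A⟦X⟧} (g : A⟦X⟧) (hf : coeff 0 f = 0) :
    hDiv (g * f) = g * hDiv f := by
  apply PowerSeries.X_mul_cancel
  rw [← mul_assoc, PowerSeries.X_mul (φ := g), mul_assoc, X_mul_hDiv hf, X_mul_hDiv]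
  rw [coeff_zero_mul, hf, mul_zero]

lemma map_hDiv {B : Type*} [Ring B] (φ : A →+* B) (f : A⟦X⟧) :
    PowerSeries.map φ (hDiv f) = hDiv (PowerSeries.map φ f) := by
  ext n; simp [hDiv]

variable [Algebra ℂ A]

/-- The exponential `exp (ħ H)`. -/
def pexp (H : A) : A⟦X⟧ := PowerSeries.mk fun n => ((n.factorial : ℂ)⁻¹) • H ^ n

lemma coeff_zero_pexp (H : A) : coeff 0 (pexp H) = 1 := by simp [pexp]

lemma pexp_add {H H' : A} (h : Commute H H') : pexp (H + H') = pexp H * pexp H' := by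
  ext n
  rw [coeff_mul, pexp, coeff_mk, h.add_pow', Finset.smul_sum]
  refine Finset.sum_congr rfl fun p hp => ?_
  rw [Finset.HasAntidiagonal.mem_antidiagonal] at hp
  subst hp
  simp only [pexp, coeff_mk]
  rw [smul_mul_smul_comm, ← Nat.cast_smul_eq_nsmul ℂ, smul_smul]
  congr 1
  rw [Nat.cast_choose ℂ (Nat.le_add_right _ _), Nat.add_sub_cancel_left]
  have := Nat.cast_ne_zero (R := ℂ).2 (p.1 + p.2).factorial_ne_zero
  field_simp

lemma pexp_zero : pexp (0 : A) = 1 := by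
  ext n
  rw [pexp, coeff_mk, coeff_one]
  cases n <;> simp

lemma pexp_algebraMap (r : ℂ) : pexp (algebraMap ℂ A r) =
    PowerSeries.map (algebraMap ℂ A) (rescale r (PowerSeries.exp ℂ)) := by
  ext n
  rw [pexp, coeff_mk, coeff_map, coeff_rescale, coeff_exp, ← map_pow, Algebra.smul_def, ← map_mul]
  simp [mul_comm]

lemma map_pexp {B : Type*} [Ring B] [Algebra ℂ B] (φ : A →ₐ[ℂ] B) (H : A) :
    PowerSeries.map φ.toRingHom (pexp H) = pexp (φ H) := by
  ext n
  simp [pexp]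

lemma C_mul_pexp {x H H' : A} (h : x * H = H' * x) :
    PowerSeries.C x * pexp H = pexp H' * PowerSeries.C x := by
  ext n
  have hn : x * H ^ n = H' ^ n * x := (show SemiconjBy x H H' from h).pow_right n
  rw [coeff_C_mul, coeff_mul_C, pexp, pexp, coeff_mk, coeff_mk, mul_smul_comm, smul_mul_assoc, hn]

end Exponentials

lemma qz_zero : qz 0 = 1 := by
  simp [qz]

lemma qz_add (m n : ℤ) : qz (m + n) = qz m * qz n := by
  rw [qz, qz, qz, Int.cast_add]
  exact (PowerSeries.exp_mul_exp_eq_exp_add _ _).symm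

lemma coeff_zero_qz (n : ℤ) : coeff 0 (qz n) = 1 := by
  simp [qz]

lemma coeff_zero_kappa : coeff 0 kappa = 0 := by
  rw [kappa, map_sub, coeff_zero_qz, coeff_zero_qz, sub_self]

/-- The leading term of `q - q⁻¹` is `2 ħ`; its being nonzero makes the denominator of `[H]_q` a
unit after division by `ħ`. -/
lemma coeff_zero_hDiv_kappa : constantCoeff (hDiv kappa) = 2 := by
  rw [← coeff_zero_eq_constantCoeff_apply, hDiv, coeff_mk, kappa, map_sub, qz, qz, coeff_rescale,
    coeff_rescale, coeff_exp]
  norm_num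

lemma inv_mul_hDiv_kappa : (hDiv kappa)⁻¹ * hDiv kappa = 1 :=
  PowerSeries.inv_mul_cancel _ (by rw [coeff_zero_hDiv_kappa]; exact two_ne_zero)

/-! ### The `q`-numbers in the completed free algebra. -/

section Free

variable {G : Type}

lemma qexp_eq (H : FreeAlgebra ℂ G) : qexp H = pexp H := rfl

lemma qexp_add_int (H : FreeAlgebra ℂ G) (n : ℤ) :
    qexp (H + algebraMap ℂ _ (n : ℂ)) = qz n • qexp H := by
  rw [qexp_eq, qexp_eq, add_comm, pexp_add (Algebra.commutes _ _), pexp_algebraMap]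
  rfl

lemma coeff_zero_bracket (H : FreeAlgebra ℂ G) : coeff 0 (qexp H - qexp (-H)) = 0 := by
  rw [map_sub, qexp_eq, qexp_eq, coeff_zero_pexp, coeff_zero_pexp, sub_self]

lemma hDiv_smul (r : ℂ⟦X⟧) {f : Free G} (hf : coeff 0 f = 0) : hDiv (r • f) = r • hDiv f := by
  rw [smul_free, smul_free, hDiv_mul_left _ hf]

lemma hDiv_smul' {r : ℂ⟦X⟧} (f : Free G) (hr : coeff 0 r = 0) : hDiv (r • f) = hDiv r • f := by
  rw [smul_free, smul_free, hDiv_mul_right, map_hDiv]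
  rw [coeff_map, hr, map_zero]

lemma kappa_smul_qbracket (H : FreeAlgebra ℂ G) :
    kappa • qbracket H = qexp H - qexp (-H) := by
  have h : kappa * (hDiv kappa)⁻¹ = PowerSeries.X ^ 1 := by
    rw [← X_mul_hDiv coeff_zero_kappa, hDiv_X_mul, mul_assoc, mul_comm (hDiv kappa),
      inv_mul_hDiv_kappa, mul_one, pow_one]
  rw [qbracket, smul_smul, h, smul_X_free, pow_one, X_mul_hDiv (coeff_zero_bracket H)]

lemma qbracket_neg (H : FreeAlgebra ℂ G) : qbracket (-H) = -qbracket H := by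
  rw [qbracket, qbracket, neg_neg, ← neg_sub, hDiv_neg, smul_neg]

/-- This is `[H + 1] = q [H] + q ^ (-H)`. It is proved before passing to the quotient, where
division by `ħ` is legitimate; cancelling `κ_q` in the quotient would require torsion-freeness. -/
lemma qbracket_add_one (H : FreeAlgebra ℂ G) :
    qbracket (H + algebraMap ℂ _ ((1 : ℤ) : ℂ)) = qz 1 • qbracket H + qexp (-H) := by
  have h1 : -(H + algebraMap ℂ (FreeAlgebra ℂ G) ((1 : ℤ) : ℂ)) =
      -H + algebraMap ℂ _ ((-1 : ℤ) : ℂ) := by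
    rw [neg_add, ← map_neg, Int.cast_neg]
  have h2 : qexp (H + algebraMap ℂ (FreeAlgebra ℂ G) ((1 : ℤ) : ℂ)) -
      qexp (-(H + algebraMap ℂ (FreeAlgebra ℂ G) ((1 : ℤ) : ℂ))) =
      qz 1 • (qexp H - qexp (-H)) + kappa • qexp (-H) := by
    rw [h1, qexp_add_int, qexp_add_int, kappa, sub_smul, smul_sub]
    abel
  rw [qbracket, h2, hDiv_add, hDiv_smul _ (coeff_zero_bracket H), hDiv_smul' _ coeff_zero_kappa,
    smul_add, smul_smul, smul_smul, inv_mul_hDiv_kappa, one_smul, mul_comm, mul_smul, qbracket]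

end Free

/-! ### Exponentials and `q`-numbers in a presented algebra. -/

section Presented

variable {G : Type} {rel : Set (Free G)}

variable (rel) in
/-- The restriction of the projection to the constants, as a homomorphism of `ℂ`-algebras. -/
def clsConstHom : FreeAlgebra ℂ G →ₐ[ℂ] Presented rel where
  toRingHom := clsConst rel
  commutes' r := by
    change clsHom rel (PowerSeries.C (algebraMap ℂ _ r)) = _
    have : algebraMap ℂ (Presented rel) r = clsHom rel (algebraMap ℂ (Free G) r) := rfl
    rw [this, PowerSeries.algebraMap_apply]

lemma clsConstHom_apply (x : FreeAlgebra ℂ G) :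
    clsConstHom rel x = clsHom rel (PowerSeries.C x) := rfl

lemma map_clsConst_qexp (H : FreeAlgebra ℂ G) :
    PowerSeries.map (clsConst rel) (qexp H) = pexp (clsConstHom rel H) :=
  map_pexp (clsConstHom rel) H

/-- The free lifts of `H` and `H'` need not commute. By `clsHom_congr` the identity may be checked
after projecting the coefficients, where they do commute and the usual exponential law applies. -/
lemma clsHom_qexp_add {H H' : FreeAlgebra ℂ G}
    (h : Commute (clsConstHom rel H) (clsConstHom rel H')) :
    clsHom rel (qexp (H + H')) = clsHom rel (qexp H) * clsHom rel (qexp H') := by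
  rw [← map_mul]
  apply clsHom_congr
  rw [map_mul, map_clsConst_qexp, map_clsConst_qexp, map_clsConst_qexp, map_add, pexp_add h]

lemma mul_clsHom_qexp {x H H' : FreeAlgebra ℂ G}
    (h : clsConstHom rel x * clsConstHom rel H = clsConstHom rel H' * clsConstHom rel x) :
    clsConstHom rel x * clsHom rel (qexp H) = clsHom rel (qexp H') * clsConstHom rel x := by
  rw [clsConstHom_apply, ← map_mul, ← map_mul]
  apply clsHom_congr
  rw [map_mul, map_mul, map_clsConst_qexp, map_clsConst_qexp, PowerSeries.map_C]
  exact C_mul_pexp h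

lemma mul_clsHom_qbracket {x H H' : FreeAlgebra ℂ G}
    (h : clsConstHom rel x * clsConstHom rel H = clsConstHom rel H' * clsConstHom rel x) :
    clsConstHom rel x * clsHom rel (qbracket H) =
      clsHom rel (qbracket H') * clsConstHom rel x := by
  have h' : clsConstHom rel x * clsConstHom rel (-H) =
      clsConstHom rel (-H') * clsConstHom rel x := by
    rw [map_neg, map_neg, mul_neg, neg_mul, h]
  rw [qbracket, qbracket, map_smul, map_smul, mul_smul_comm, smul_mul_assoc, clsConstHom_apply,
    ← map_mul, ← map_mul]
  congr 1
  apply clsHom_congr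
  rw [← hDiv_mul_left _ (coeff_zero_bracket H), ← hDiv_mul_right _ (coeff_zero_bracket H'),
    map_hDiv, map_hDiv, mul_sub, sub_mul]
  simp only [map_mul, map_sub, map_clsConst_qexp, PowerSeries.map_C]
  congr 2
  · exact C_mul_pexp h
  · exact C_mul_pexp h'

lemma clsHom_qbracket_add {H H' : FreeAlgebra ℂ G}
    (h : Commute (clsConstHom rel H) (clsConstHom rel H')) :
    clsHom rel (qbracket (H + H')) = clsHom rel (qbracket H) * clsHom rel (qexp H') +
      clsHom rel (qexp (-H)) * clsHom rel (qbracket H') := by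
  rw [qbracket, qbracket, qbracket, map_smul, map_smul, map_smul, mul_smul_comm, smul_mul_assoc,
    ← smul_add, ← map_mul, ← map_mul, ← map_add]
  congr 1
  apply clsHom_congr
  rw [← hDiv_mul_left _ (coeff_zero_bracket H'), ← hDiv_mul_right _ (coeff_zero_bracket H),
    ← hDiv_add, map_hDiv, map_hDiv]
  congr 1
  simp only [map_add, map_mul, map_sub, map_clsConst_qexp, map_neg]
  have hn : Commute (-clsConstHom rel H) (-clsConstHom rel H') := h.neg_left.neg_right
  rw [neg_add, pexp_add h, pexp_add hn, sub_mul, mul_sub]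
  abel

end Presented


/-! ### The triangular relations of `U_q(gl_{2|1})` -/

/-- The relations of `U_q(gl_{2|1})`, for elements of an algebra: `Q n` stands for `q ^ n`,
`K a b c` stands for
`q ^ (a K₁ + b K₂ + c K₃)`, and `b1`, `b2` stand for `[H₁]_q`, `[H₂]_q`. -/
structure GlRelations {S A : Type*} [CommRing S] [Ring A] [Algebra S A] (Q : ℤ → S)
    (E1 E2 F1 F2 b1 b2 : A)
    (K : ℤ → ℤ → ℤ → A) : Prop where
  Q_zero : Q 0 = 1
  Q_add (m n : ℤ) : Q (m + n) = Q m * Q n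
  K_zero : K 0 0 0 = 1
  K_mul (a b c a' b' c' : ℤ) : K a b c * K a' b' c' = K (a + a') (b + b') (c + c')
  K_E1 (a b c : ℤ) : K a b c * E1 = Q (a - b) • (E1 * K a b c)
  K_E2 (a b c : ℤ) : K a b c * E2 = Q (b - c) • (E2 * K a b c)
  K_F1 (a b c : ℤ) : K a b c * F1 = Q (b - a) • (F1 * K a b c)
  K_F2 (a b c : ℤ) : K a b c * F2 = Q (c - b) • (F2 * K a b c)
  K_b1 (a b c : ℤ) : K a b c * b1 = b1 * K a b c
  K_b2 (a b c : ℤ) : K a b c * b2 = b2 * K a b c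
  b2_b1 : b2 * b1 = b1 * b2
  kappa_b1 : (Q 1 - Q (-1)) • b1 = K 1 (-1) 0 - K (-1) 1 0
  kappa_b2 : (Q 1 - Q (-1)) • b2 = K 0 1 1 - K 0 (-1) (-1)
  b1_E1 : b1 * E1 = E1 * (Q 2 • b1 + (Q 1 + Q (-1)) • K (-1) 1 0)
  b1_E2 : b1 * E2 = E2 * (Q (-1) • b1 - K (-1) 1 0)
  b1_F1 : b1 * F1 = F1 * (Q (-2) • b1 - (Q 1 + Q (-1)) • K (-1) 1 0)
  b1_F2 : b1 * F2 = F2 * (Q 1 • b1 + K (-1) 1 0)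
  b2_E1 : b2 * E1 = E1 * (Q (-1) • b2 - K 0 (-1) (-1))
  b2_E2 : b2 * E2 = E2 * b2
  b2_F1 : b2 * F1 = F1 * (Q 1 • b2 + K 0 (-1) (-1))
  b2_F2 : b2 * F2 = F2 * b2
  E1_F1 : E1 * F1 = F1 * E1 + b1
  E1_F2 : E1 * F2 = F2 * E1
  E2_F1 : E2 * F1 = F1 * E2
  E2_F2 : E2 * F2 = -(F2 * E2) + b2
  E2_E2 : E2 * E2 = 0
  F2_F2 : F2 * F2 = 0
  serreE : E1 * (E1 * E2 - Q 1 • (E2 * E1)) = Q (-1) • ((E1 * E2 - Q 1 • (E2 * E1)) * E1)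
  serreF : (F2 * F1 - Q (-1) • (F1 * F2)) * F1 = Q 1 • (F1 * (F2 * F1 - Q (-1) • (F1 * F2)))

/-- The relations between `E₁`, `E₂`, `F₁`, `F₂` and the root vectors `E₁₃`, `F₁₃`. They suffice to
write any product as a combination of ordered monomials. -/
structure GlOrdering {S A : Type*} [CommRing S] [Ring A] [Algebra S A] (Q : ℤ → S)
    (E1 E2 E3 F1 F2 F3 b1 b2 : A)
    (K : ℤ → ℤ → ℤ → A) : Prop extends GlRelations Q E1 E2 F1 F2 b1 b2 K where
  E2_E1 : E2 * E1 = Q (-1) • (E1 * E2 - E3)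
  F2_F1 : F2 * F1 = F3 + Q (-1) • (F1 * F2)
  E3_E1 : E3 * E1 = Q 1 • (E1 * E3)
  F3_F1 : F3 * F1 = Q 1 • (F1 * F3)
  E2_E3 : E2 * E3 = -Q (-1) • (E3 * E2)
  F2_F3 : F2 * F3 = -Q (-1) • (F3 * F2)
  E3_E3 : E3 * E3 = 0
  F3_F3 : F3 * F3 = 0
  K_E3 (a b c : ℤ) : K a b c * E3 = Q (a - c) • (E3 * K a b c)
  K_F3 (a b c : ℤ) : K a b c * F3 = Q (c - a) • (F3 * K a b c)
  b1_E3 : b1 * E3 = E3 * (Q 1 • b1 + K (-1) 1 0)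
  b1_F3 : b1 * F3 = F3 * (Q (-1) • b1 - K (-1) 1 0)
  b2_E3 : b2 * E3 = E3 * (Q (-1) • b2 - K 0 (-1) (-1))
  b2_F3 : b2 * F3 = F3 * (Q 1 • b2 + K 0 (-1) (-1))
  E1_F3 : E1 * F3 = F3 * E1 - Q (-1) • (F2 * K (-1) 1 0)
  E2_F3 : E2 * F3 = -(F3 * E2) + F1 * K 0 1 1
  E3_F1 : E3 * F1 = F1 * E3 - E2 * K 1 (-1) 0
  E3_F2 : E3 * F2 = -(F2 * E3) + Q 1 • (E1 * K 0 (-1) (-1))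
  E3_F3 : E3 * F3 = -(F3 * E3) + (b1 * K 0 1 1 + b2 * K (-1) 1 0)

namespace GlRelations

variable {S A : Type*} [CommRing S] [Ring A] [Algebra S A] {Q : ℤ → S}
  {E1 E2 F1 F2 b1 b2 : A} {K : ℤ → ℤ → ℤ → A}

lemma Q_mul_neg (R : GlRelations Q E1 E2 F1 F2 b1 b2 K) : Q 1 * Q (-1) = 1 := by
  rw [← R.Q_add, ← R.Q_zero]; rfl

lemma Q_natCast (R : GlRelations Q E1 E2 F1 F2 b1 b2 K) (n : ℕ) : Q n = Q 1 ^ n := by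
  induction n with
  | zero => rw [Nat.cast_zero, R.Q_zero, pow_zero]
  | succ n ih => rw [Nat.cast_succ, R.Q_add, ih, pow_succ]

lemma Q_neg_natCast (R : GlRelations Q E1 E2 F1 F2 b1 b2 K) (n : ℕ) :
    Q (-n) = Q (-1) ^ n := by
  induction n with
  | zero => rw [Nat.cast_zero, neg_zero, R.Q_zero, pow_zero]
  | succ n ih => rw [Nat.cast_succ, neg_add, R.Q_add, ih, pow_succ]

/-- The rewriting rule `a * b = c`, together with its form for longer products. -/
abbrev Rewrites (a b c : A) : Prop := a * b = c ∧ ∀ x, a * (b * x) = c * x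

lemma rewrites {a b c : A} (h : a * b = c) : Rewrites a b c :=
  ⟨h, fun x => by rw [← mul_assoc, h]⟩

/-- The relations, oriented for the simplifier: `F` moves left of `E`, both move left of `b1`, `b2`,
and `K` moves to the far right. -/
lemma rules (R : GlRelations Q E1 E2 F1 F2 b1 b2 K) :
    (∀ a b c a' b' c' : ℤ, Rewrites (K a b c) (K a' b' c') (K (a + a') (b + b') (c + c'))) ∧
    (∀ a b c : ℤ, Rewrites (K a b c) E1 (Q (a - b) • (E1 * K a b c))) ∧
    (∀ a b c : ℤ, Rewrites (K a b c) E2 (Q (b - c) • (E2 * K a b c))) ∧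
    (∀ a b c : ℤ, Rewrites (K a b c) F1 (Q (b - a) • (F1 * K a b c))) ∧
    (∀ a b c : ℤ, Rewrites (K a b c) F2 (Q (c - b) • (F2 * K a b c))) ∧
    (∀ a b c : ℤ, Rewrites (K a b c) b1 (b1 * K a b c)) ∧
    (∀ a b c : ℤ, Rewrites (K a b c) b2 (b2 * K a b c)) ∧
    Rewrites b2 b1 (b1 * b2) ∧
    Rewrites b1 E1 (E1 * (Q 2 • b1 + (Q 1 + Q (-1)) • K (-1) 1 0)) ∧
    Rewrites b1 E2 (E2 * (Q (-1) • b1 - K (-1) 1 0)) ∧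
    Rewrites b1 F1 (F1 * (Q (-2) • b1 - (Q 1 + Q (-1)) • K (-1) 1 0)) ∧
    Rewrites b1 F2 (F2 * (Q 1 • b1 + K (-1) 1 0)) ∧
    Rewrites b2 E1 (E1 * (Q (-1) • b2 - K 0 (-1) (-1))) ∧
    Rewrites b2 E2 (E2 * b2) ∧
    Rewrites b2 F1 (F1 * (Q 1 • b2 + K 0 (-1) (-1))) ∧
    Rewrites b2 F2 (F2 * b2) ∧
    Rewrites E1 F1 (F1 * E1 + b1) ∧
    Rewrites E1 F2 (F2 * E1) ∧
    Rewrites E2 F1 (F1 * E2) ∧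
    Rewrites E2 F2 (-(F2 * E2) + b2) ∧
    Rewrites E2 E2 0 ∧
    Rewrites F2 F2 0 :=
  ⟨fun _ _ _ _ _ _ => rewrites (R.K_mul _ _ _ _ _ _), fun _ _ _ => rewrites (R.K_E1 _ _ _), fun
   _ _ _ => rewrites (R.K_E2 _ _ _), fun _ _ _ => rewrites (R.K_F1 _ _ _), fun _ _ _ => rewrites
   (R.K_F2 _ _ _), fun _ _ _ => rewrites (R.K_b1 _ _ _), fun _ _ _ => rewrites (R.K_b2 _ _ _),
   rewrites R.b2_b1, rewrites R.b1_E1, rewrites R.b1_E2, rewrites R.b1_F1, rewrites R.b1_F2,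
   rewrites R.b2_E1, rewrites R.b2_E2, rewrites R.b2_F1, rewrites R.b2_F2, rewrites R.E1_F1,
   rewrites R.E1_F2, rewrites R.E2_F1, rewrites R.E2_F2, rewrites R.E2_E2, rewrites R.F2_F2⟩

/-- All powers of `q` become monomials in `Q 1` and `Q (-1)`, so that comparing coefficients leaves
polynomial identities modulo `Q 1 * Q (-1) = 1`. -/
lemma scalar_rules (R : GlRelations Q E1 E2 F1 F2 b1 b2 K) :
    (∀ (n : ℕ) [n.AtLeastTwo], Q (OfNat.ofNat n) = Q 1 ^ n) ∧
    (∀ (n : ℕ) [n.AtLeastTwo], Q (-OfNat.ofNat n) = Q (-1) ^ n) ∧ Q 0 = 1 ∧ K 0 0 0 = 1 :=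
  ⟨fun n _ => R.Q_natCast n, fun n _ => R.Q_neg_natCast n, R.Q_zero, R.K_zero⟩

/-- The Serre relations say how `E₁₃` and `F₁₃` pass `E₁` and `F₁`, nilpotency of `E₂` and `F₂`
gives the exchange with these, and the mixed rules follow by expanding one root vector. The
hypothesis `hS` serves only to conclude that `E₁₃` and `F₁₃` square to zero. -/
lemma ordering (R : GlRelations Q E1 E2 F1 F2 b1 b2 K)
    (hS : ∀ x : A, (1 + Q 2) • x = 0 → x = 0) :
    GlOrdering Q E1 E2 (E1 * E2 - Q 1 • (E2 * E1)) F1 F2 (F2 * F1 - Q (-1) • (F1 * F2))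
      b1 b2 K := by
  have hq := R.Q_mul_neg
  have hQ2 : Q 2 = Q 1 ^ 2 := R.scalar_rules.1 2
  have hK1 : K 1 (-1) 0 = K (-1) 1 0 + (Q 1 - Q (-1)) • b1 := by rw [R.kappa_b1]; abel
  have hK2 : K 0 1 1 = K 0 (-1) (-1) + (Q 1 - Q (-1)) • b2 := by rw [R.kappa_b2]; abel
  -- Opaque names let the rewriting treat the root vectors as letters, expanded only where this is
  -- asked for.
  obtain ⟨E3, hE3⟩ : ∃ x, x = E1 * E2 - Q 1 • (E2 * E1) := ⟨_, rfl⟩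
  obtain ⟨F3, hF3⟩ : ∃ x, x = F2 * F1 - Q (-1) • (F1 * F2) := ⟨_, rfl⟩
  have hE21 : E2 * E1 = Q (-1) • (E1 * E2 - E3) := by
    rw [hE3]; match_scalars <;> grind
  have hF21 : F2 * F1 = F3 + Q (-1) • (F1 * F2) := by
    rw [hF3]; match_scalars <;> grind
  have hE13 : E1 * E3 = Q (-1) • (E3 * E1) := by rw [hE3]; exact R.serreE
  have hE31 : E3 * E1 = Q 1 • (E1 * E3) := by
    rw [hE13]; match_scalars <;> grind
  have hF31 : F3 * F1 = Q 1 • (F1 * F3) := by rw [hF3]; exact R.serreF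
  have hF13 : F1 * F3 = Q (-1) • (F3 * F1) := by
    rw [hF31]; match_scalars; grind
  have hE23 : E2 * E3 = -Q (-1) • (E3 * E2) := by
    conv_lhs => rw [hE3]
    rw [mul_sub, mul_smul_comm, ← mul_assoc E2 E2, R.E2_E2, zero_mul, smul_zero, sub_zero,
      ← mul_assoc, hE21, smul_mul_assoc, sub_mul, mul_assoc, R.E2_E2, mul_zero, zero_sub, smul_neg,
      neg_smul]
  have hF23 : F2 * F3 = -Q (-1) • (F3 * F2) := by
    have h : F3 * F2 = F2 * (F1 * F2) := by
      rw [hF3, sub_mul, smul_mul_assoc, mul_assoc, mul_assoc, R.F2_F2,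
        mul_zero, smul_zero, sub_zero]
    rw [h, hF3, mul_sub, ← mul_assoc, R.F2_F2, zero_mul, zero_sub, mul_smul_comm, neg_smul]
  -- Moving `E₁₃` through the two factors of `E₁ E₂` costs `q⁻¹` and `-q⁻¹`, so its square equals
  -- `-q⁻²` times itself and is killed by `1 + q²`. The same argument works for `F₁₃`.
  have hsq : ∀ x : A, x = -(Q (-1) * Q (-1)) • x → x = 0 := by
    intro x hx
    apply hS
    have h2 : Q 2 • x = -x := by
      nth_rewrite 1 [hx]
      match_scalars
      grind
    rw [add_smul, one_smul, h2, add_neg_cancel]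
  have hE33 : E3 * E3 = 0 := by
    apply hsq
    have h : (E1 * E2 - Q 1 • (E2 * E1)) * E3 =
        -(Q (-1) * Q (-1)) • (E3 * (E1 * E2 - Q 1 • (E2 * E1))) := by
      simp only [sub_mul, mul_sub, smul_mul_assoc, mul_smul_comm, mul_assoc, rewrites hE23,
        rewrites hE13, smul_smul, smul_sub]
      match_scalars <;> grind
    rwa [← hE3] at h
  have hF33 : F3 * F3 = 0 := by
    apply hsq
    have h : (F2 * F1 - Q (-1) • (F1 * F2)) * F3 =
        -(Q (-1) * Q (-1)) • (F3 * (F2 * F1 - Q (-1) • (F1 * F2))) := by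
      simp only [sub_mul, mul_sub, smul_mul_assoc, mul_smul_comm, mul_assoc, rewrites hF23,
        rewrites hF13, smul_smul, smul_sub]
      match_scalars <;> grind
    rwa [← hF3] at h
  have hKE (a b c : ℤ) : K a b c * E3 = Q (a - c) • (E3 * K a b c) := by
    have h : Q (a - c) = Q (a - b) * Q (b - c) := by rw [← R.Q_add, sub_add_sub_cancel]
    rw [hE3, h]
    simp only [mul_sub, sub_mul, mul_smul_comm, smul_mul_assoc, mul_assoc, R.rules, smul_smul]
    match_scalars <;> ring
  have hKF (a b c : ℤ) : K a b c * F3 = Q (c - a) • (F3 * K a b c) := by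
    have h : Q (c - a) = Q (c - b) * Q (b - a) := by rw [← R.Q_add, sub_add_sub_cancel]
    rw [hF3, h]
    simp only [mul_sub, sub_mul, mul_smul_comm, smul_mul_assoc, mul_assoc, R.rules, smul_smul]
    match_scalars <;> ring
  have hb1_E3 : b1 * E3 = E3 * (Q 1 • b1 + K (-1) 1 0) := by
    rw [hE3]
    simp only [R.rules, R.scalar_rules, add_mul, sub_mul, neg_mul, smul_mul_assoc, mul_add,
      mul_sub, mul_neg, mul_smul_comm, smul_add, smul_sub, smul_neg, smul_smul, neg_neg,
      mul_assoc, Int.reduceAdd, Int.reduceSub, Int.reduceNeg]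
    match_scalars <;> grind
  have hb1_F3 : b1 * F3 = F3 * (Q (-1) • b1 - K (-1) 1 0) := by
    rw [hF3]
    simp only [R.rules, R.scalar_rules, add_mul, sub_mul, neg_mul, smul_mul_assoc, mul_add,
      mul_sub, mul_neg, mul_smul_comm, smul_add, smul_sub, smul_neg, smul_smul, neg_neg,
      mul_assoc, Int.reduceAdd, Int.reduceSub, Int.reduceNeg]
    match_scalars <;> grind
  have hb2_E3 : b2 * E3 = E3 * (Q (-1) • b2 - K 0 (-1) (-1)) := by
    rw [hE3]
    simp only [R.rules, R.scalar_rules, add_mul, sub_mul, neg_mul, smul_mul_assoc, mul_add,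
      mul_sub, mul_neg, mul_smul_comm, smul_add, smul_sub, smul_neg, smul_smul, neg_neg,
      mul_assoc, Int.reduceAdd, Int.reduceSub, Int.reduceNeg]
    match_scalars <;> grind
  have hb2_F3 : b2 * F3 = F3 * (Q 1 • b2 + K 0 (-1) (-1)) := by
    rw [hF3]
    simp only [R.rules, R.scalar_rules, add_mul, sub_mul, neg_mul, smul_mul_assoc, mul_add,
      mul_sub, mul_neg, mul_smul_comm, smul_add, smul_sub, smul_neg, smul_smul, neg_neg,
      mul_assoc, Int.reduceAdd, Int.reduceSub, Int.reduceNeg]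
    match_scalars <;> grind
  have hE1_F3 : E1 * F3 = F3 * E1 - Q (-1) • (F2 * K (-1) 1 0) := by
    rw [hF3]
    simp only [R.rules, R.scalar_rules, add_mul, sub_mul, neg_mul, smul_mul_assoc, mul_add,
      mul_sub, mul_neg, mul_smul_comm, smul_add, smul_sub, smul_neg, smul_smul, neg_neg,
      mul_assoc, Int.reduceAdd, Int.reduceSub, Int.reduceNeg]
    match_scalars <;> grind
  have hE2_F3 : E2 * F3 = -(F3 * E2) + F1 * K 0 1 1 := by
    rw [hF3, hK2]
    simp only [R.rules, R.scalar_rules, add_mul, sub_mul, neg_mul, smul_mul_assoc, mul_add,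
      mul_sub, mul_neg, mul_smul_comm, smul_add, smul_sub, smul_neg, smul_smul, neg_neg,
      mul_assoc, Int.reduceAdd, Int.reduceSub, Int.reduceNeg]
    match_scalars <;> grind
  have hE3_F1 : E3 * F1 = F1 * E3 - E2 * K 1 (-1) 0 := by
    rw [hE3, hK1]
    simp only [R.rules, R.scalar_rules, add_mul, sub_mul, neg_mul, smul_mul_assoc, mul_add,
      mul_sub, mul_neg, mul_smul_comm, smul_add, smul_sub, smul_neg, smul_smul, neg_neg,
      mul_assoc, Int.reduceAdd, Int.reduceSub, Int.reduceNeg]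
    match_scalars <;> grind
  have hE3_F2 : E3 * F2 = -(F2 * E3) + Q 1 • (E1 * K 0 (-1) (-1)) := by
    rw [hE3]
    simp only [R.rules, R.scalar_rules, add_mul, sub_mul, neg_mul, smul_mul_assoc, mul_add,
      mul_sub, mul_neg, mul_smul_comm, smul_add, smul_sub, smul_neg, smul_smul, neg_neg,
      mul_assoc, Int.reduceAdd, Int.reduceSub, Int.reduceNeg]
    match_scalars <;> grind
  have hE3_F3 : E3 * F3 = -(F3 * E3) + (b1 * K 0 1 1 + b2 * K (-1) 1 0) := by
    rw [hE3]
    simp only [R.rules, R.scalar_rules, rewrites hE1_F3, rewrites hE2_F3, add_mul, sub_mul,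
      neg_mul, smul_mul_assoc, mul_add, mul_sub, mul_neg, mul_smul_comm, smul_add, smul_sub,
      smul_neg, smul_smul, neg_neg, mul_assoc, Int.reduceAdd, Int.reduceSub, Int.reduceNeg]
    match_scalars <;> grind
  rw [← hE3, ← hF3]
  exact ⟨R, hE21, hF21, hE31, hF31, hE23, hF23, hE33, hF33, hKE, hKF, hb1_E3, hb1_F3, hb2_E3,
    hb2_F3, hE1_F3, hE2_F3, hE3_F1, hE3_F2, hE3_F3⟩

end GlRelations

open GlRelations in
lemma GlOrdering.rules {S A : Type*} [CommRing S] [Ring A] [Algebra S A] {Q : ℤ → S}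
    {E1 E2 E3 F1 F2 F3 b1 b2 : A} {K : ℤ → ℤ → ℤ → A}
    (R : GlOrdering Q E1 E2 E3 F1 F2 F3 b1 b2 K) :
    Rewrites E2 E1 (Q (-1) • (E1 * E2 - E3)) ∧
    Rewrites F2 F1 (F3 + Q (-1) • (F1 * F2)) ∧
    Rewrites E3 E1 (Q 1 • (E1 * E3)) ∧
    Rewrites F3 F1 (Q 1 • (F1 * F3)) ∧
    Rewrites E2 E3 (-Q (-1) • (E3 * E2)) ∧
    Rewrites F2 F3 (-Q (-1) • (F3 * F2)) ∧
    Rewrites E3 E3 0 ∧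
    Rewrites F3 F3 0 ∧
    (∀ a b c : ℤ, Rewrites (K a b c) E3 (Q (a - c) • (E3 * K a b c))) ∧
    (∀ a b c : ℤ, Rewrites (K a b c) F3 (Q (c - a) • (F3 * K a b c))) ∧
    Rewrites b1 E3 (E3 * (Q 1 • b1 + K (-1) 1 0)) ∧
    Rewrites b1 F3 (F3 * (Q (-1) • b1 - K (-1) 1 0)) ∧
    Rewrites b2 E3 (E3 * (Q (-1) • b2 - K 0 (-1) (-1))) ∧
    Rewrites b2 F3 (F3 * (Q 1 • b2 + K 0 (-1) (-1))) ∧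
    Rewrites E1 F3 (F3 * E1 - Q (-1) • (F2 * K (-1) 1 0)) ∧
    Rewrites E2 F3 (-(F3 * E2) + F1 * K 0 1 1) ∧
    Rewrites E3 F1 (F1 * E3 - E2 * K 1 (-1) 0) ∧
    Rewrites E3 F2 (-(F2 * E3) + Q 1 • (E1 * K 0 (-1) (-1))) ∧
    Rewrites E3 F3 (-(F3 * E3) + (b1 * K 0 1 1 + b2 * K (-1) 1 0)) :=
  ⟨rewrites R.E2_E1, rewrites R.F2_F1, rewrites R.E3_E1, rewrites R.F3_F1, rewrites R.E2_E3,
   rewrites R.F2_F3, rewrites R.E3_E3, rewrites R.F3_F3, fun _ _ _ => rewrites (R.K_E3 _ _ _),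
   fun _ _ _ => rewrites (R.K_F3 _ _ _), rewrites R.b1_E3, rewrites R.b1_F3, rewrites R.b2_E3,
   rewrites R.b2_F3, rewrites R.E1_F3, rewrites R.E2_F3, rewrites R.E3_F1, rewrites R.E3_F2,
   rewrites R.E3_F3⟩


namespace GlRelations

variable {S A : Type*} [CommRing S] [Ring A] [Algebra S A] {Q : ℤ → S}
  {E1 E2 F1 F2 b1 b2 : A} {K : ℤ → ℤ → ℤ → A}

/-- The straightening rules leave one redundancy, the relation between `κ_q b1` and a difference of
Cartan exponentials. Chosen instances of this lemma and of `K_eq_add_b2` reduce the exponentials in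
a computation to a common one before coefficients are compared. -/
lemma K_eq_add_b1 (R : GlRelations Q E1 E2 F1 F2 b1 b2 K) (a b c : ℤ) :
    K (a + 1) (b + -1) c = K (a + -1) (b + 1) c + (Q 1 - Q (-1)) • (b1 * K a b c) := by
  rw [← smul_mul_assoc, R.kappa_b1, sub_mul, R.K_mul, R.K_mul]
  simp only [zero_add, add_comm]
  abel_nf

lemma K_eq_add_b2 (R : GlRelations Q E1 E2 F1 F2 b1 b2 K) (a b c : ℤ) :
    K a (b + 1) (c + 1) = K a (b + -1) (c + -1) + (Q 1 - Q (-1)) • (b2 * K a b c) := by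
  rw [← smul_mul_assoc, R.kappa_b2, sub_mul, R.K_mul, R.K_mul]
  simp only [zero_add, add_comm]
  abel_nf

end GlRelations

/-! ### The loop relations for the images of the generators. -/

namespace GlOrdering

variable {S A : Type*} [CommRing S] [Ring A] [Algebra S A] {Q : ℤ → S}
  {E1 E2 E3 F1 F2 F3 b1 b2 : A} {K : ℤ → ℤ → ℤ → A}

/-- The right-hand side is `[h₀]_q` for `h₀ = -(H₁ + H₂)`, written out by the addition rule for
`q`-numbers; see `qbracket_jimboH_zero`. -/
lemma affine_e0_f0 (R : GlOrdering Q E1 E2 E3 F1 F2 F3 b1 b2 K) :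
    -(F3 * K 1 0 (-1)) * (K (-1) 0 1 * E3) + K (-1) 0 1 * E3 * -(F3 * K 1 0 (-1)) =
      -(b1 * K 0 1 1 + b2 * K (-1) 1 0) := by
  have hq := R.Q_mul_neg
  simp only [R.rules, R.toGlRelations.rules, R.scalar_rules, add_mul, sub_mul, neg_mul,
    smul_mul_assoc, mul_add, mul_sub, mul_neg, mul_smul_comm, smul_add, smul_sub, smul_neg,
    smul_smul, neg_smul, neg_neg, neg_zero, mul_zero, zero_mul, smul_zero, mul_assoc, mul_one,
    one_mul, sub_zero, zero_sub, add_zero, zero_add, sub_neg_eq_add, Int.reduceAdd,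
    Int.reduceSub, Int.reduceNeg]
  match_scalars <;> grind

lemma affine_e0_f1 (R : GlOrdering Q E1 E2 E3 F1 F2 F3 b1 b2 K) :
    -(F3 * K 1 0 (-1)) * F1 = F1 * -(F3 * K 1 0 (-1)) := by
  have hq := R.Q_mul_neg
  simp only [R.rules, R.toGlRelations.rules, R.scalar_rules, add_mul, sub_mul, neg_mul,
    smul_mul_assoc, mul_add, mul_sub, mul_neg, mul_smul_comm, smul_add, smul_sub, smul_neg,
    smul_smul, neg_smul, neg_neg, neg_zero, mul_zero, zero_mul, smul_zero, mul_assoc, mul_one,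
    one_mul, sub_zero, zero_sub, add_zero, zero_add, sub_neg_eq_add, Int.reduceAdd,
    Int.reduceSub, Int.reduceNeg]
  match_scalars <;> grind

lemma affine_e0_f2 (R : GlOrdering Q E1 E2 E3 F1 F2 F3 b1 b2 K) :
    -(F3 * K 1 0 (-1)) * F2 + F2 * -(F3 * K 1 0 (-1)) = 0 := by
  have hq := R.Q_mul_neg
  simp only [R.rules, R.toGlRelations.rules, R.scalar_rules, add_mul, sub_mul, neg_mul,
    smul_mul_assoc, mul_add, mul_sub, mul_neg, mul_smul_comm, smul_add, smul_sub, smul_neg,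
    smul_smul, neg_smul, neg_neg, neg_zero, mul_zero, zero_mul, smul_zero, mul_assoc, mul_one,
    one_mul, sub_zero, zero_sub, add_zero, zero_add, sub_neg_eq_add, Int.reduceAdd,
    Int.reduceSub, Int.reduceNeg]
  match_scalars <;> grind

lemma affine_e0_e0 (R : GlOrdering Q E1 E2 E3 F1 F2 F3 b1 b2 K) :
    F3 * K 1 0 (-1) * (F3 * K 1 0 (-1)) = 0 := by
  simp only [R.rules, R.toGlRelations.rules, R.scalar_rules, add_mul, sub_mul, neg_mul,
    smul_mul_assoc, mul_add, mul_sub, mul_neg, mul_smul_comm, smul_add, smul_sub, smul_neg,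
    smul_smul, neg_smul, neg_neg, neg_zero, mul_zero, zero_mul, smul_zero, mul_assoc, mul_one,
    one_mul, sub_zero, zero_sub, add_zero, zero_add, sub_neg_eq_add, Int.reduceAdd,
    Int.reduceSub, Int.reduceNeg]

lemma affine_f0_f0 (R : GlOrdering Q E1 E2 E3 F1 F2 F3 b1 b2 K) :
    K (-1) 0 1 * E3 * (K (-1) 0 1 * E3) = 0 := by
  simp only [R.rules, R.toGlRelations.rules, R.scalar_rules, add_mul, sub_mul, neg_mul,
    smul_mul_assoc, mul_add, mul_sub, mul_neg, mul_smul_comm, smul_add, smul_sub, smul_neg,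
    smul_smul, neg_smul, neg_neg, neg_zero, mul_zero, zero_mul, smul_zero, mul_assoc, mul_one,
    one_mul, sub_zero, zero_sub, add_zero, zero_add, sub_neg_eq_add, Int.reduceAdd,
    Int.reduceSub, Int.reduceNeg]

lemma affine_e1_f0 (R : GlOrdering Q E1 E2 E3 F1 F2 F3 b1 b2 K) :
    E1 * (K (-1) 0 1 * E3) = K (-1) 0 1 * E3 * E1 := by
  have hq := R.Q_mul_neg
  simp only [R.rules, R.toGlRelations.rules, R.scalar_rules, add_mul, sub_mul, neg_mul,
    smul_mul_assoc, mul_add, mul_sub, mul_neg, mul_smul_comm, smul_add, smul_sub, smul_neg,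
    smul_smul, neg_smul, neg_neg, neg_zero, mul_zero, zero_mul, smul_zero, mul_assoc, mul_one,
    one_mul, sub_zero, zero_sub, add_zero, zero_add, sub_neg_eq_add, Int.reduceAdd,
    Int.reduceSub, Int.reduceNeg]
  match_scalars <;> grind

lemma affine_e2_f0 (R : GlOrdering Q E1 E2 E3 F1 F2 F3 b1 b2 K) :
    E2 * (K (-1) 0 1 * E3) + K (-1) 0 1 * E3 * E2 = 0 := by
  have hq := R.Q_mul_neg
  simp only [R.rules, R.toGlRelations.rules, R.scalar_rules, add_mul, sub_mul, neg_mul,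
    smul_mul_assoc, mul_add, mul_sub, mul_neg, mul_smul_comm, smul_add, smul_sub, smul_neg,
    smul_smul, neg_smul, neg_neg, neg_zero, mul_zero, zero_mul, smul_zero, mul_assoc, mul_one,
    one_mul, sub_zero, zero_sub, add_zero, zero_add, sub_neg_eq_add, Int.reduceAdd,
    Int.reduceSub, Int.reduceNeg]
  match_scalars <;> grind

lemma affine_serre_E0 (R : GlOrdering Q E1 E2 E3 F1 F2 F3 b1 b2 K) :
    ∀ e0 y : A, e0 = -(F3 * K 1 0 (-1)) → y = E1 * e0 - Q 1 • (e0 * E1) →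
      E1 * y = Q (-1) • (y * E1) := by
  rintro _ _ rfl rfl
  have hq := R.Q_mul_neg
  simp only [R.rules, R.toGlRelations.rules, R.scalar_rules, add_mul, sub_mul, neg_mul,
    smul_mul_assoc, mul_add, mul_sub, mul_neg, mul_smul_comm, smul_add, smul_sub, smul_neg,
    smul_smul, neg_smul, neg_neg, neg_zero, mul_zero, zero_mul, smul_zero, mul_assoc, mul_one,
    one_mul, sub_zero, zero_sub, add_zero, zero_add, sub_neg_eq_add, Int.reduceAdd,
    Int.reduceSub, Int.reduceNeg]
  match_scalars <;> grind

lemma affine_serre_F0 (R : GlOrdering Q E1 E2 E3 F1 F2 F3 b1 b2 K) :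
    ∀ f0 y : A, f0 = K (-1) 0 1 * E3 → y = F1 * f0 - Q (-1) • (f0 * F1) →
      F1 * y = Q 1 • (y * F1) := by
  rintro _ _ rfl rfl
  have hq := R.Q_mul_neg
  simp only [R.rules, R.toGlRelations.rules, R.scalar_rules, add_mul, sub_mul, neg_mul,
    smul_mul_assoc, mul_add, mul_sub, mul_neg, mul_smul_comm, smul_add, smul_sub, smul_neg,
    smul_smul, neg_smul, neg_neg, neg_zero, mul_zero, zero_mul, smul_zero, mul_assoc, mul_one,
    one_mul, sub_zero, zero_sub, add_zero, zero_add, sub_neg_eq_add, Int.reduceAdd,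
    Int.reduceSub, Int.reduceNeg]
  match_scalars <;> grind

/-- The quintic relation is handled one bracket at a time, each inner bracket being replaced by its
normal form before the next is taken. The right-hand sides of these step lemmas are such normal
forms. -/
lemma quintic_step_E2 (R : GlOrdering Q E1 E2 E3 F1 F2 F3 b1 b2 K) :
    ∀ e0 : A, e0 = -(F3 * K 1 0 (-1)) → ∀ y1 : A, y1 = E2 * E1 - Q 1 • (E1 * E2) →
    e0 * y1 + y1 * e0 =
      (Q 1 - Q (-1)) • (F1 * E1 * K 1 1 0) + (Q 1 - Q (-1)) • (F2 * E2 * K 0 1 (-1)) +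
      (Q 1 ^ 3 - 2 * Q 1 + Q (-1)) • (F3 * E1 * E2 * K 1 0 (-1)) +
      (Q 1 - Q (-1)) • (F3 * E3 * K 1 0 (-1)) + Q 1 • (b1 * K 1 1 0) +
        Q (-1) • (b2 * K 0 1 (-1)) := by
  rintro _ rfl _ rfl
  have hq := R.Q_mul_neg
  simp only [R.rules, R.toGlRelations.rules, R.scalar_rules, add_mul, sub_mul, neg_mul,
    smul_mul_assoc, mul_add, mul_sub, mul_neg, mul_smul_comm, smul_add, smul_sub, smul_neg,
    smul_smul, neg_smul, neg_neg, neg_zero, mul_zero, zero_mul, smul_zero, mul_assoc, mul_one,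
    one_mul, sub_zero, zero_sub, add_zero, zero_add, sub_neg_eq_add, Int.reduceAdd,
    Int.reduceSub, Int.reduceNeg]
  match_scalars <;> grind

lemma quintic_step_E3 (R : GlOrdering Q E1 E2 E3 F1 F2 F3 b1 b2 K) :
    ∀ y2 : A, y2 =
      (Q 1 - Q (-1)) • (F1 * E1 * K 1 1 0) + (Q 1 - Q (-1)) • (F2 * E2 * K 0 1 (-1)) +
      (Q 1 ^ 3 - 2 * Q 1 + Q (-1)) • (F3 * E1 * E2 * K 1 0 (-1)) +
      (Q 1 - Q (-1)) • (F3 * E3 * K 1 0 (-1)) + Q 1 • (b1 * K 1 1 0) + Q (-1) • (b2 * K 0 1 (-1)) →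
    E2 * y2 - y2 * E2 = Q 1 ^ 2 • (E2 * K 0 2 0) := by
  rintro _ rfl
  have hq := R.Q_mul_neg
  have h1 : K 2 0 0 = K 0 2 0 + (Q 1 - Q (-1)) • (b1 * K 1 1 0) := by
    simpa only [Int.reduceAdd, Int.reduceNeg] using R.K_eq_add_b1 1 1 0
  have h2 : K 0 2 0 = K 0 0 (-2) + (Q 1 - Q (-1)) • (b2 * K 0 1 (-1)) := by
    simpa only [Int.reduceAdd, Int.reduceNeg] using R.K_eq_add_b2 0 1 (-1)
  simp only [R.rules, R.toGlRelations.rules, R.scalar_rules, add_mul, sub_mul, neg_mul,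
    smul_mul_assoc, mul_add, mul_sub, mul_neg, mul_smul_comm, smul_add, smul_sub, smul_neg,
    smul_smul, neg_smul, neg_neg, neg_zero, mul_zero, zero_mul, smul_zero, mul_assoc, mul_one,
    one_mul, sub_zero, zero_sub, add_zero, zero_add, sub_neg_eq_add, Int.reduceAdd,
    Int.reduceSub, Int.reduceNeg]
  simp only [h1, h2, mul_add, smul_add, mul_smul_comm, smul_smul]
  match_scalars <;> grind

lemma quintic_step_E2' (R : GlOrdering Q E1 E2 E3 F1 F2 F3 b1 b2 K) :
    ∀ e0 : A, e0 = -(F3 * K 1 0 (-1)) → ∀ z1 : A, z1 = e0 * E1 - Q 1 • (E1 * e0) →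
    E2 * z1 + z1 * E2 =
      (-Q 1 ^ 2 + 1) • (F2 * E2 * K 0 1 (-1)) - b2 * K 0 1 (-1) := by
  rintro _ rfl _ rfl
  have hq := R.Q_mul_neg
  simp only [R.rules, R.toGlRelations.rules, R.scalar_rules, add_mul, sub_mul, neg_mul,
    smul_mul_assoc, mul_add, mul_sub, mul_neg, mul_smul_comm, smul_add, smul_sub, smul_neg,
    smul_smul, neg_smul, neg_neg, neg_zero, mul_zero, zero_mul, smul_zero, mul_assoc, mul_one,
    one_mul, sub_zero, zero_sub, add_zero, zero_add, sub_neg_eq_add, Int.reduceAdd,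
    Int.reduceSub, Int.reduceNeg]
  match_scalars <;> grind

lemma quintic_step_E3' (R : GlOrdering Q E1 E2 E3 F1 F2 F3 b1 b2 K) :
    ∀ e0 : A, e0 = -(F3 * K 1 0 (-1)) →
      ∀ z2 : A, z2 = (-Q 1 ^ 2 + 1) • (F2 * E2 * K 0 1 (-1)) - b2 * K 0 1 (-1) →
    e0 * z2 - z2 * e0 =
      (-1 + Q (-1) ^ 2) • (F1 * F2 * K 1 2 (-1)) +
      (Q 1 ^ 2 - 2 + Q (-1) ^ 2) • (F3 * F2 * E2 * K 1 1 (-2)) - Q (-1) • (F3 * K 1 0 (-3)) +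
      (-Q 1 + Q (-1)) • (F3 * K 1 2 (-1)) := by
  rintro _ rfl _ rfl
  have hq := R.Q_mul_neg
  simp only [R.rules, R.toGlRelations.rules, R.scalar_rules, add_mul, sub_mul, neg_mul,
    smul_mul_assoc, mul_add, mul_sub, mul_neg, mul_smul_comm, smul_add, smul_sub, smul_neg,
    smul_smul, neg_smul, neg_neg, neg_zero, mul_zero, zero_mul, smul_zero, mul_assoc, mul_one,
    one_mul, sub_zero, zero_sub, add_zero, zero_add, sub_neg_eq_add, Int.reduceAdd,
    Int.reduceSub, Int.reduceNeg]
  match_scalars <;> grind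

lemma quintic_step_E4 (R : GlOrdering Q E1 E2 E3 F1 F2 F3 b1 b2 K) :
    ∀ e0 : A, e0 = -(F3 * K 1 0 (-1)) → ∀ y3 z3 : A, y3 = Q 1 ^ 2 • (E2 * K 0 2 0) →
    z3 = (-1 + Q (-1) ^ 2) • (F1 * F2 * K 1 2 (-1)) +
      (Q 1 ^ 2 - 2 + Q (-1) ^ 2) • (F3 * F2 * E2 * K 1 1 (-2)) - Q (-1) • (F3 * K 1 0 (-3)) +
      (-Q 1 + Q (-1)) • (F3 * K 1 2 (-1)) →
    e0 * y3 + Q (-1) • (y3 * e0) = E2 * z3 + Q (-1) • (z3 * E2) := by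
  rintro _ rfl _ _ rfl rfl
  have hq := R.Q_mul_neg
  have h1 : K 1 3 0 = K 1 1 (-2) + (Q 1 - Q (-1)) • (b2 * K 1 2 (-1)) := by
    simpa only [Int.reduceAdd, Int.reduceNeg] using R.K_eq_add_b2 1 2 (-1)
  have h2 : K 1 2 (-1) = K 1 0 (-3) + (Q 1 - Q (-1)) • (b2 * K 1 1 (-2)) := by
    simpa only [Int.reduceAdd, Int.reduceNeg] using R.K_eq_add_b2 1 1 (-2)
  simp only [R.rules, R.toGlRelations.rules, R.scalar_rules, add_mul, sub_mul, neg_mul,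
    smul_mul_assoc, mul_add, mul_sub, mul_neg, mul_smul_comm, smul_add, smul_sub, smul_neg,
    smul_smul, neg_smul, neg_neg, neg_zero, mul_zero, zero_mul, smul_zero, mul_assoc, mul_one,
    one_mul, sub_zero, zero_sub, add_zero, zero_add, sub_neg_eq_add, Int.reduceAdd,
    Int.reduceSub, Int.reduceNeg]
  simp only [h1, h2, mul_add, smul_add, mul_smul_comm, smul_smul]
  match_scalars <;> grind

lemma affine_quintic_E (R : GlOrdering Q E1 E2 E3 F1 F2 F3 b1 b2 K) :
    ∀ e0 : A, e0 = -(F3 * K 1 0 (-1)) → ∀ y1 y2 y3 z1 z2 z3 : A,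
    y1 = E2 * E1 - Q 1 • (E1 * E2) → y2 = e0 * y1 + y1 * e0 → y3 = E2 * y2 - y2 * E2 →
    z1 = e0 * E1 - Q 1 • (E1 * e0) → z2 = E2 * z1 + z1 * E2 → z3 = e0 * z2 - z2 * e0 →
    e0 * y3 + Q (-1) • (y3 * e0) = E2 * z3 + Q (-1) • (z3 * E2) := by
  intro e0 he0 y1 y2 y3 z1 z2 z3 hy1 hy2 hy3 hz1 hz2 hz3
  rw [R.quintic_step_E2 e0 he0 y1 hy1] at hy2
  rw [R.quintic_step_E3 y2 hy2] at hy3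
  rw [R.quintic_step_E2' e0 he0 z1 hz1] at hz2
  rw [R.quintic_step_E3' e0 he0 z2 hz2] at hz3
  exact R.quintic_step_E4 e0 he0 y3 z3 hy3 hz3

lemma quintic_step_F2 (R : GlOrdering Q E1 E2 E3 F1 F2 F3 b1 b2 K) :
    ∀ f0 : A, f0 = K (-1) 0 1 * E3 → ∀ y1 : A, y1 = F2 * F1 - Q (-1) • (F1 * F2) →
    f0 * y1 + y1 * f0 =
      (-1 + Q (-1) ^ 2) • (F3 * E3 * K (-1) 0 1) + b1 * K (-1) 1 2 + b2 * K (-2) 1 1 := by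
  rintro _ rfl _ rfl
  have hq := R.Q_mul_neg
  simp only [R.rules, R.toGlRelations.rules, R.scalar_rules, add_mul, sub_mul, neg_mul,
    smul_mul_assoc, mul_add, mul_sub, mul_neg, mul_smul_comm, smul_add, smul_sub, smul_neg,
    smul_smul, neg_smul, neg_neg, neg_zero, mul_zero, zero_mul, smul_zero, mul_assoc, mul_one,
    one_mul, sub_zero, zero_sub, add_zero, zero_add, sub_neg_eq_add, Int.reduceAdd,
    Int.reduceSub, Int.reduceNeg]
  match_scalars <;> grind

lemma quintic_step_F3 (R : GlOrdering Q E1 E2 E3 F1 F2 F3 b1 b2 K) :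
    ∀ y2 : A, y2 = (-1 + Q (-1) ^ 2) • (F3 * E3 * K (-1) 0 1) + b1 * K (-1) 1 2 + b2 * K (-2) 1 1 →
    F2 * y2 - y2 * F2 =
      -Q 1 • (F2 * K 0 0 2) + (Q 1 ^ 2 - 1) • (F3 * E1 * K (-1) (-1) 0) +
      (-Q 1 + 2 * Q (-1) - Q (-1) ^ 3) • (F3 * F2 * E3 * K (-1) 0 1) := by
  rintro _ rfl
  have hq := R.Q_mul_neg
  have h1 : K 0 0 2 = K (-2) 2 2 + (Q 1 - Q (-1)) • (b1 * K (-1) 1 2) := by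
    simpa only [Int.reduceAdd, Int.reduceNeg] using R.K_eq_add_b1 (-1) 1 2
  simp only [R.rules, R.toGlRelations.rules, R.scalar_rules, add_mul, sub_mul, neg_mul,
    smul_mul_assoc, mul_add, mul_sub, mul_neg, mul_smul_comm, smul_add, smul_sub, smul_neg,
    smul_smul, neg_smul, neg_neg, neg_zero, mul_zero, zero_mul, smul_zero, mul_assoc, mul_one,
    one_mul, sub_zero, zero_sub, add_zero, zero_add, sub_neg_eq_add, Int.reduceAdd,
    Int.reduceSub, Int.reduceNeg]
  simp only [h1, mul_add, smul_add, mul_smul_comm, smul_smul]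
  match_scalars <;> grind

lemma quintic_step_F2' (R : GlOrdering Q E1 E2 E3 F1 F2 F3 b1 b2 K) :
    ∀ f0 : A, f0 = K (-1) 0 1 * E3 → ∀ z1 : A, z1 = f0 * F1 - Q (-1) • (F1 * f0) →
    F2 * z1 + z1 * F2 =
      (Q 1 - Q (-1)) • (F1 * E1 * K (-1) (-1) 0) +
      (-1 + 2 * Q (-1) ^ 2 - Q (-1) ^ 4) • (F1 * F2 * E3 * K (-1) 0 1) +
      (Q 1 - Q (-1)) • (F2 * E2 * K 0 (-1) 1) + (Q (-1) - Q (-1) ^ 3) • (F3 * E3 * K (-1) 0 1) -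
      Q 1 • (b2 * K 0 (-1) 1) := by
  rintro _ rfl _ rfl
  have hq := R.Q_mul_neg
  simp only [R.rules, R.toGlRelations.rules, R.scalar_rules, add_mul, sub_mul, neg_mul,
    smul_mul_assoc, mul_add, mul_sub, mul_neg, mul_smul_comm, smul_add, smul_sub, smul_neg,
    smul_smul, neg_smul, neg_neg, neg_zero, mul_zero, zero_mul, smul_zero, mul_assoc, mul_one,
    one_mul, sub_zero, zero_sub, add_zero, zero_add, sub_neg_eq_add, Int.reduceAdd,
    Int.reduceSub, Int.reduceNeg]
  match_scalars <;> grind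

lemma quintic_step_F3' (R : GlOrdering Q E1 E2 E3 F1 F2 F3 b1 b2 K) :
    ∀ f0 : A, f0 = K (-1) 0 1 * E3 → ∀ z2 : A, z2 =
      (Q 1 - Q (-1)) • (F1 * E1 * K (-1) (-1) 0) +
      (-1 + 2 * Q (-1) ^ 2 - Q (-1) ^ 4) • (F1 * F2 * E3 * K (-1) 0 1) +
      (Q 1 - Q (-1)) • (F2 * E2 * K 0 (-1) 1) + (Q (-1) - Q (-1) ^ 3) • (F3 * E3 * K (-1) 0 1) -
      Q 1 • (b2 * K 0 (-1) 1) →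
    f0 * z2 - z2 * f0 = -Q (-1) ^ 4 • (E3 * K (-3) 0 1) := by
  rintro _ rfl _ rfl
  have hq := R.Q_mul_neg
  have h1 : K (-1) 0 3 = K (-1) (-2) 1 + (Q 1 - Q (-1)) • (b2 * K (-1) (-1) 2) := by
    simpa only [Int.reduceAdd, Int.reduceNeg] using R.K_eq_add_b2 (-1) (-1) 2
  have h2 : K (-1) 0 3 = K (-3) 2 3 + (Q 1 - Q (-1)) • (b1 * K (-2) 1 3) := by
    simpa only [Int.reduceAdd, Int.reduceNeg] using R.K_eq_add_b1 (-2) 1 3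
  have h3 : K (-3) 2 3 = K (-3) 0 1 + (Q 1 - Q (-1)) • (b2 * K (-3) 1 2) := by
    simpa only [Int.reduceAdd, Int.reduceNeg] using R.K_eq_add_b2 (-3) 1 2
  -- Here `h1` is needed in the opposite direction: `K (-1) (-2) 1` is raised to `K (-1) 0 3`, which
  -- `h2` and `h3` then bring down to `K (-3) 0 1`.
  have h4 := (eq_sub_of_add_eq h1.symm)
  simp only [R.rules, R.toGlRelations.rules, R.scalar_rules, add_mul, sub_mul, neg_mul,
    smul_mul_assoc, mul_add, mul_sub, mul_neg, mul_smul_comm, smul_add, smul_sub, smul_neg,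
    smul_smul, neg_smul, neg_neg, neg_zero, mul_zero, zero_mul, smul_zero, mul_assoc, mul_one,
    one_mul, sub_zero, zero_sub, add_zero, zero_add, sub_neg_eq_add, Int.reduceAdd,
    Int.reduceSub, Int.reduceNeg]
  simp only [h4, h2, h3, smul_sub, mul_sub, mul_add, smul_add, mul_smul_comm, smul_smul]
  match_scalars <;> grind

lemma quintic_step_F4 (R : GlOrdering Q E1 E2 E3 F1 F2 F3 b1 b2 K) :
    ∀ f0 : A, f0 = K (-1) 0 1 * E3 → ∀ y3 z3 : A,
    y3 = -Q 1 • (F2 * K 0 0 2) + (Q 1 ^ 2 - 1) • (F3 * E1 * K (-1) (-1) 0) +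
      (-Q 1 + 2 * Q (-1) - Q (-1) ^ 3) • (F3 * F2 * E3 * K (-1) 0 1) →
    z3 = -Q (-1) ^ 4 • (E3 * K (-3) 0 1) →
    f0 * y3 + Q 1 • (y3 * f0) = F2 * z3 + Q 1 • (z3 * F2) := by
  rintro _ rfl _ _ rfl rfl
  have hq := R.Q_mul_neg
  have h1 : K (-1) (-1) 2 = K (-3) 1 2 + (Q 1 - Q (-1)) • (b1 * K (-2) 0 2) := by
    simpa only [Int.reduceAdd, Int.reduceNeg] using R.K_eq_add_b1 (-2) 0 2
  have h2 : K (-3) 1 2 = K (-3) (-1) 0 + (Q 1 - Q (-1)) • (b2 * K (-3) 0 1) := by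
    simpa only [Int.reduceAdd, Int.reduceNeg] using R.K_eq_add_b2 (-3) 0 1
  have h3 : K (-1) 0 3 = K (-3) 2 3 + (Q 1 - Q (-1)) • (b1 * K (-2) 1 3) := by
    simpa only [Int.reduceAdd, Int.reduceNeg] using R.K_eq_add_b1 (-2) 1 3
  have h4 : K (-3) 2 3 = K (-3) 0 1 + (Q 1 - Q (-1)) • (b2 * K (-3) 1 2) := by
    simpa only [Int.reduceAdd, Int.reduceNeg] using R.K_eq_add_b2 (-3) 1 2
  simp only [R.rules, R.toGlRelations.rules, R.scalar_rules, add_mul, sub_mul, neg_mul,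
    smul_mul_assoc, mul_add, mul_sub, mul_neg, mul_smul_comm, smul_add, smul_sub, smul_neg,
    smul_smul, neg_smul, neg_neg, neg_zero, mul_zero, zero_mul, smul_zero, mul_assoc, mul_one,
    one_mul, sub_zero, zero_sub, add_zero, zero_add, sub_neg_eq_add, Int.reduceAdd,
    Int.reduceSub, Int.reduceNeg]
  simp only [h1, h2, h3, h4, mul_add, smul_add, mul_smul_comm, smul_smul]
  match_scalars <;> grind

lemma affine_quintic_F (R : GlOrdering Q E1 E2 E3 F1 F2 F3 b1 b2 K) :
    ∀ f0 : A, f0 = K (-1) 0 1 * E3 → ∀ y1 y2 y3 z1 z2 z3 : A,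
    y1 = F2 * F1 - Q (-1) • (F1 * F2) → y2 = f0 * y1 + y1 * f0 → y3 = F2 * y2 - y2 * F2 →
    z1 = f0 * F1 - Q (-1) • (F1 * f0) → z2 = F2 * z1 + z1 * F2 → z3 = f0 * z2 - z2 * f0 →
    f0 * y3 + Q 1 • (y3 * f0) = F2 * z3 + Q 1 • (z3 * F2) := by
  intro f0 hf0 y1 y2 y3 z1 z2 z3 hy1 hy2 hy3 hz1 hz2 hz3
  rw [R.quintic_step_F2 f0 hf0 y1 hy1] at hy2
  rw [R.quintic_step_F3 y2 hy2] at hy3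
  rw [R.quintic_step_F2' f0 hf0 z1 hz1] at hz2
  rw [R.quintic_step_F3' f0 hf0 z2 hz2] at hz3
  exact R.quintic_step_F4 f0 hf0 y3 z3 hy3 hz3

end GlOrdering


/-! ### The `q`-supercommutator for given weights -/

section Bracket

variable {n : ℕ} {A B : Type*} [Ring A] [Algebra ℂ⟦X⟧ A] [Ring B] [Algebra ℂ⟦X⟧ B]
  {a : Matrix (Fin n) (Fin n) ℤ} {p : Fin n → ℤ} {α β : Fin n → ℤ}

lemma qcomm_of_even (h : Even (par p α * par p β)) (ν : ℤ) (hν : qexponent a α β = ν) (x y : A) :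
    qcomm a p α β x y = x * y - qz ν • (y * x) := by
  rw [qcomm, hν, Int.negOnePow_even _ h]
  simp

lemma qcomm_of_odd (h : Odd (par p α * par p β)) (ν : ℤ) (hν : qexponent a α β = ν) (x y : A) :
    qcomm a p α β x y = x * y + qz ν • (y * x) := by
  rw [qcomm, hν, Int.negOnePow_odd _ h]
  simp

lemma qcomm_of_even_zero (h : Even (par p α * par p β)) (hν : qexponent a α β = 0) (x y : A) :
    qcomm a p α β x y = x * y - y * x := by
  rw [qcomm_of_even h 0 hν, qz_zero, one_smul]

lemma qcomm_of_odd_zero (h : Odd (par p α * par p β)) (hν : qexponent a α β = 0) (x y : A) :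
    qcomm a p α β x y = x * y + y * x := by
  rw [qcomm_of_odd h 0 hν, qz_zero, one_smul]

lemma map_qcomm (φ : A →ₐ[ℂ⟦X⟧] B) (x y : A) :
    φ (qcomm a p α β x y) = qcomm a p α β (φ x) (φ y) := by
  rw [qcomm, qcomm, map_sub, map_smul, map_mul, map_mul]

end Bracket

namespace Gl

/-! ### The triangular relations hold in `U_q(gl_{2|1})` -/

/-- The projection onto `U_q(gl_{2|1})`. -/
abbrev π : Free GlGen →ₐ[ℂ⟦X⟧] UGl := clsHom {x | Rel x}

/-- The projection onto `U_q(gl_{2|1})`, on the constants. -/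
abbrev θ : FreeAlgebra ℂ GlGen →ₐ[ℂ] UGl := clsConstHom {x | Rel x}

lemma π_rel {x : Free GlGen} (h : Rel x) : π x = 0 := clsHom_of_mem h

lemma K_comm (i j : Fin 3) : θ (k i) * θ (k j) = θ (k j) * θ (k i) := by
  have h := π_rel (Rel.KK i j)
  rw [br, qcomm_of_even_zero (by decide) (by decide), map_sub, map_mul, map_mul, sub_eq_zero] at h
  exact h

lemma K_E (i : Fin 3) (j : Fin 2) : θ (k i) * θ (FreeAlgebra.ι ℂ (GlGen.E j)) =
    θ (FreeAlgebra.ι ℂ (GlGen.E j)) * (θ (k i) + algebraMap ℂ UGl (rootVal i j : ℤ)) := by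
  have h := π_rel (Rel.KE i j)
  rw [br, qcomm_of_even_zero (by fin_cases j <;> decide) (by fin_cases j <;> decide), map_sub,
    map_sub, map_mul, map_mul, map_smul, sub_eq_zero, sub_eq_iff_eq_add] at h
  rw [mul_add, map_intCast]
  refine h.trans ((add_comm _ _).trans ?_)
  rw [Int.cast_smul_eq_zsmul, zsmul_eq_mul, Int.cast_comm]
  rfl

lemma K_F (i : Fin 3) (j : Fin 2) : θ (k i) * θ (FreeAlgebra.ι ℂ (GlGen.F j)) =
    θ (FreeAlgebra.ι ℂ (GlGen.F j)) * (θ (k i) + algebraMap ℂ UGl (-rootVal i j : ℤ)) := by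
  have h := π_rel (Rel.KF i j)
  rw [br, qcomm_of_even_zero (by fin_cases j <;> decide) (by fin_cases j <;> decide), map_add,
    map_sub, map_mul, map_mul, map_smul, ← sub_neg_eq_add, sub_eq_zero, sub_eq_iff_eq_add] at h
  rw [mul_add, map_intCast]
  refine h.trans ((add_comm _ _).trans ?_)
  rw [← neg_smul, ← Int.cast_neg, Int.cast_smul_eq_zsmul, zsmul_eq_mul, Int.cast_comm]
  rfl

/-- The element `a K₁ + b K₂ + c K₃`. -/
def kk (a b c : ℤ) : FreeAlgebra ℂ GlGen := (a : ℂ) • k 0 + (b : ℂ) • k 1 + (c : ℂ) • k 2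

lemma qK_eq (a b c : ℤ) : qK a b c = π (qexp (kk a b c)) := rfl

lemma kk_neg (a b c : ℤ) : -kk a b c = kk (-a) (-b) (-c) := by
  simp only [kk, Int.cast_neg, neg_smul]
  abel

lemma kk_add (a b c a' b' c' : ℤ) : kk a b c + kk a' b' c' = kk (a + a') (b + b') (c + c') := by
  simp only [kk, Int.cast_add, add_smul]
  abel

lemma H_zero : H 0 = kk 1 (-1) 0 := by
  simp [H, kk, sub_eq_add_neg]

lemma H_one : H 1 = kk 0 1 1 := by
  simp [H, kk]

lemma commute_kk (a b c a' b' c' : ℤ) : Commute (θ (kk a b c)) (θ (kk a' b' c')) := by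
  have h : ∀ i j, Commute (θ (k i)) (θ (k j)) := K_comm
  simp only [kk, map_add, map_smul]
  refine Commute.add_left (Commute.add_left ?_ ?_) ?_ <;>
    refine Commute.add_right (Commute.add_right ?_ ?_) ?_ <;>
    exact ((h _ _).smul_left _).smul_right _

lemma qK_mul (a b c a' b' c' : ℤ) : qK a b c * qK a' b' c' = qK (a + a') (b + b') (c + c') := by
  rw [qK_eq, qK_eq, qK_eq, ← kk_add, clsHom_qexp_add (commute_kk _ _ _ _ _ _)]

lemma qK_zero : qK 0 0 0 = 1 := by
  have h : kk 0 0 0 = 0 := by simp [kk]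
  rw [qK_eq, h, qexp_eq, pexp_zero, map_one]

/-- `x` has weight `w` with respect to the elements `K_i`. -/
def HasWeight (x : FreeAlgebra ℂ GlGen) (w : Fin 3 → ℤ) : Prop :=
  ∀ i, θ (k i) * θ x = θ x * (θ (k i) + algebraMap ℂ UGl (w i : ℤ))

/-- Passing a weight vector shifts a Cartan element by a scalar. The shift is put inside the free
algebra, so that the shift formulas for `qexp` and `qbracket` apply verbatim. -/
lemma HasWeight.kk_mul {x : FreeAlgebra ℂ GlGen} {w : Fin 3 → ℤ} (hx : HasWeight x w)
    (a b c n : ℤ) (hn : n = a * w 0 + b * w 1 + c * w 2) :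
    θ x * θ (kk a b c + algebraMap ℂ _ (n : ℂ)) = θ (kk a b c) * θ x := by
  simp only [kk, map_add, map_smul, add_mul, smul_mul_assoc, hx _, AlgHom.commutes]
  rw [hn]
  simp only [mul_add, mul_smul_comm, Int.cast_add, Int.cast_mul, map_add, map_mul, map_intCast,
    smul_add]
  simp only [← Int.cast_smul_eq_zsmul ℂ, ← Algebra.algebraMap_eq_smul_one, Algebra.smul_def,
    map_intCast, ← mul_assoc]
  have h : ∀ m : ℤ, (m : UGl) * θ x = θ x * m := fun m => Int.cast_comm m _
  simp only [h]
  abel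

lemma HasWeight.qK_mul {x : FreeAlgebra ℂ GlGen} {w : Fin 3 → ℤ} (hx : HasWeight x w)
    (a b c n : ℤ) (hn : n = a * w 0 + b * w 1 + c * w 2) :
    qK a b c * θ x = qz n • (θ x * qK a b c) := by
  rw [qK_eq, ← mul_clsHom_qexp (hx.kk_mul a b c n hn), qexp_add_int, map_smul, mul_smul_comm]

lemma HasWeight.qbracket_mul {x : FreeAlgebra ℂ GlGen} {w : Fin 3 → ℤ} (hx : HasWeight x w)
    (a b c n : ℤ) (hn : n = a * w 0 + b * w 1 + c * w 2) :
    π (qbracket (kk a b c)) * θ x =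
      θ x * π (qbracket (kk a b c + algebraMap ℂ _ (n : ℂ))) :=
  (mul_clsHom_qbracket (hx.kk_mul a b c n hn)).symm

end Gl

/-! ### Commutation through coefficients, and integer shifts of `q`-numbers. -/

section Free

variable {G : Type} (H : FreeAlgebra ℂ G)

/-- The coefficients of a `q`-number are polynomials in its argument; so what commutes with the
argument commutes with the `q`-number. -/
lemma coeff_qbracket_mem (n : ℕ) : coeff n (qbracket H) ∈ Algebra.adjoin ℂ {H} := by
  rw [qbracket, smul_free, coeff_mul]
  refine Subalgebra.sum_mem _ fun p _ => ?_
  have hc : coeff p.2 (hDiv (qexp H - qexp (-H))) =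
      (((p.2 + 1).factorial : ℂ)⁻¹) • H ^ (p.2 + 1) -
        (((p.2 + 1).factorial : ℂ)⁻¹) • (-H) ^ (p.2 + 1) := by
    rw [hDiv, coeff_mk, map_sub, qexp, qexp, coeff_mk, coeff_mk]
  rw [coeff_map, ← Algebra.smul_def, hc]
  have h : H ∈ Algebra.adjoin ℂ {H} := Algebra.subset_adjoin rfl
  exact Subalgebra.smul_mem _ (Subalgebra.sub_mem _
    (Subalgebra.smul_mem _ (Subalgebra.pow_mem _ h _) _)
    (Subalgebra.smul_mem _ (Subalgebra.pow_mem _ (Subalgebra.neg_mem _ h) _) _)) _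

/-- Commutation with the coefficients gives a commutator divisible by every `ħ ^ n`, which vanishes
by separatedness. -/
lemma commute_clsHom {rel : Set (Free G)} {x : Free G} {y : Presented rel}
    (h : ∀ n, Commute (clsHom rel (PowerSeries.C (coeff n x))) y) : Commute (clsHom rel x) y := by
  refine sub_eq_zero.1 (presented_eq_zero fun n => ?_)
  obtain ⟨z, hz⟩ := exists_eq_sum_add_X_pow_mul x n
  refine ⟨clsHom rel z * y - y * clsHom rel z, ?_⟩
  have hs : clsHom rel x = ∑ i ∈ Finset.range n, (PowerSeries.X ^ i : ℂ⟦X⟧) •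
      clsHom rel (PowerSeries.C (coeff i x)) + (PowerSeries.X ^ n : ℂ⟦X⟧) • clsHom rel z := by
    conv_lhs => rw [hz]
    simp only [map_add, map_sum, ← smul_X_free, map_smul]
  rw [hs, add_mul, mul_add, Finset.sum_mul, Finset.mul_sum, smul_sub]
  simp only [smul_mul_assoc, mul_smul_comm, (h _).eq]
  abel

lemma qbracket_sub_one : qbracket (H + algebraMap ℂ _ ((-1 : ℤ) : ℂ)) =
    qz (-1) • qbracket H - qexp (-H) := by
  have h := qbracket_add_one (H + algebraMap ℂ _ ((-1 : ℤ) : ℂ))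
  have h1 : -(H + algebraMap ℂ (FreeAlgebra ℂ G) ((-1 : ℤ) : ℂ)) =
      -H + algebraMap ℂ _ ((1 : ℤ) : ℂ) := by
    rw [neg_add, ← map_neg, Int.cast_neg, neg_neg]
  rw [add_assoc, ← map_add, ← Int.cast_add, neg_add_cancel, Int.cast_zero, map_zero, add_zero, h1,
    qexp_add_int] at h
  rw [h, smul_add, smul_smul, smul_smul, ← qz_add, neg_add_cancel, qz_zero, one_smul, one_smul,
    add_sub_cancel_right]

lemma qbracket_add_two : qbracket (H + algebraMap ℂ _ ((2 : ℤ) : ℂ)) =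
    qz 2 • qbracket H + (qz 1 + qz (-1)) • qexp (-H) := by
  have h := qbracket_add_one (H + algebraMap ℂ _ ((1 : ℤ) : ℂ))
  have h1 : -(H + algebraMap ℂ (FreeAlgebra ℂ G) ((1 : ℤ) : ℂ)) =
      -H + algebraMap ℂ _ ((-1 : ℤ) : ℂ) := by
    rw [neg_add, ← map_neg, Int.cast_neg]
  rw [add_assoc, ← map_add, ← Int.cast_add, one_add_one_eq_two, h1, qexp_add_int,
    qbracket_add_one, smul_add, smul_smul, ← qz_add, one_add_one_eq_two] at h
  rw [h, add_smul, add_assoc]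

lemma qbracket_sub_two : qbracket (H + algebraMap ℂ _ ((-2 : ℤ) : ℂ)) =
    qz (-2) • qbracket H - (qz 1 + qz (-1)) • qexp (-H) := by
  have h := qbracket_sub_one (H + algebraMap ℂ _ ((-1 : ℤ) : ℂ))
  have h1 : -(H + algebraMap ℂ (FreeAlgebra ℂ G) ((-1 : ℤ) : ℂ)) =
      -H + algebraMap ℂ _ ((1 : ℤ) : ℂ) := by
    rw [neg_add, ← map_neg, Int.cast_neg, neg_neg]
  rw [add_assoc, ← map_add, ← Int.cast_add, show (-1 + -1 : ℤ) = -2 from rfl, h1, qexp_add_int,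
    qbracket_sub_one, smul_sub, smul_smul, ← qz_add, show (-1 + -1 : ℤ) = -2 from rfl] at h
  rw [h, add_smul]
  abel

end Free

namespace Gl

section

variable {x : FreeAlgebra ℂ GlGen} {w : Fin 3 → ℤ} (a b c : ℤ)

lemma HasWeight.qbracket_zero (hx : HasWeight x w) (hn : 0 = a * w 0 + b * w 1 + c * w 2) :
    π (qbracket (kk a b c)) * θ x = θ x * π (qbracket (kk a b c)) := by
  rw [hx.qbracket_mul a b c 0 hn, Int.cast_zero, map_zero, add_zero]

lemma HasWeight.qbracket_one (hx : HasWeight x w) (hn : 1 = a * w 0 + b * w 1 + c * w 2) :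
    π (qbracket (kk a b c)) * θ x =
      θ x * (qz 1 • π (qbracket (kk a b c)) + qK (-a) (-b) (-c)) := by
  rw [hx.qbracket_mul a b c 1 hn, qbracket_add_one, map_add, map_smul, kk_neg, ← qK_eq]

lemma HasWeight.qbracket_neg_one (hx : HasWeight x w) (hn : -1 = a * w 0 + b * w 1 + c * w 2) :
    π (qbracket (kk a b c)) * θ x =
      θ x * (qz (-1) • π (qbracket (kk a b c)) - qK (-a) (-b) (-c)) := by
  rw [hx.qbracket_mul a b c (-1) hn, qbracket_sub_one, map_sub, map_smul, kk_neg, ← qK_eq]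

lemma HasWeight.qbracket_two (hx : HasWeight x w) (hn : 2 = a * w 0 + b * w 1 + c * w 2) :
    π (qbracket (kk a b c)) * θ x =
      θ x * (qz 2 • π (qbracket (kk a b c)) + (qz 1 + qz (-1)) • qK (-a) (-b) (-c)) := by
  rw [hx.qbracket_mul a b c 2 hn, qbracket_add_two, map_add, map_smul, map_smul, kk_neg, ← qK_eq]

lemma HasWeight.qbracket_neg_two (hx : HasWeight x w) (hn : -2 = a * w 0 + b * w 1 + c * w 2) :
    π (qbracket (kk a b c)) * θ x =
      θ x * (qz (-2) • π (qbracket (kk a b c)) - (qz 1 + qz (-1)) • qK (-a) (-b) (-c)) := by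
  rw [hx.qbracket_mul a b c (-2) hn, qbracket_sub_two, map_sub, map_smul, map_smul, kk_neg,
    ← qK_eq]

end

lemma hasWeight_E (j : Fin 2) : HasWeight (FreeAlgebra.ι ℂ (GlGen.E j)) (rootVal · j) :=
  fun i => K_E i j

lemma hasWeight_F (j : Fin 2) : HasWeight (FreeAlgebra.ι ℂ (GlGen.F j)) (-rootVal · j) :=
  fun i => K_F i j

lemma rootVal_zero : (rootVal · 0) = ![1, -1, 0] := by decide
lemma rootVal_one : (rootVal · 1) = ![0, 1, -1] := by decide

lemma hasWeight_E1 : HasWeight (FreeAlgebra.ι ℂ (GlGen.E 0)) ![1, -1, 0] :=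
  rootVal_zero ▸ hasWeight_E 0

lemma hasWeight_E2 : HasWeight (FreeAlgebra.ι ℂ (GlGen.E 1)) ![0, 1, -1] :=
  rootVal_one ▸ hasWeight_E 1

lemma hasWeight_F1 : HasWeight (FreeAlgebra.ι ℂ (GlGen.F 0)) ![-1, 1, 0] := by
  have h : (-rootVal · 0) = ![-1, 1, 0] := by decide
  exact h ▸ hasWeight_F 0

lemma hasWeight_F2 : HasWeight (FreeAlgebra.ι ℂ (GlGen.F 1)) ![0, -1, 1] := by
  have h : (-rootVal · 1) = ![0, -1, 1] := by decide
  exact h ▸ hasWeight_F 1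

/-- `[H₁]_q` and `[H₂]_q`. -/
def br1 : UGl := π (qbracket (kk 1 (-1) 0))
def br2 : UGl := π (qbracket (kk 0 1 1))

lemma commute_kk_qbracket (a b c a' b' c' : ℤ) :
    Commute (θ (kk a b c)) (π (qbracket (kk a' b' c'))) :=
  mul_clsHom_qbracket (commute_kk a b c a' b' c')

lemma qbracket_commute (a b c a' b' c' : ℤ) :
    qK a b c * π (qbracket (kk a' b' c')) = π (qbracket (kk a' b' c')) * qK a b c := by
  refine commute_clsHom fun n => ?_
  rw [qexp, coeff_mk]
  change Commute (θ _) _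
  rw [map_smul, map_pow]
  exact ((commute_kk_qbracket a b c a' b' c').pow_left n).smul_left _

lemma qbracket_qbracket_commute (a b c a' b' c' : ℤ) :
    π (qbracket (kk a b c)) * π (qbracket (kk a' b' c')) =
      π (qbracket (kk a' b' c')) * π (qbracket (kk a b c)) := by
  refine commute_clsHom fun n => ?_
  refine Algebra.adjoin_induction (fun x hx => ?_) (fun r => ?_)
    (fun x y _ _ hx hy => ?_) (fun x y _ _ hx hy => ?_) (coeff_qbracket_mem (kk a b c) n)
  · rw [Set.mem_singleton_iff.1 hx]
    exact commute_kk_qbracket a b c a' b' c'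
  · change Commute (θ _) _
    rw [AlgHom.commutes]
    exact Algebra.commute_algebraMap_left r _
  · rw [map_add, map_add]
    exact hx.add_left hy
  · rw [map_mul, map_mul]
    exact hx.mul_left hy

lemma eq_zero_of_two_smul {x : UGl} (h : 2 • x = 0) : x = 0 := by
  have h2 : (2⁻¹ : ℂ) • (2 : ℂ) • x = x := by rw [smul_smul, inv_mul_cancel₀ two_ne_zero, one_smul]
  rw [← h2, ofNat_smul_eq_nsmul, h, smul_zero]

lemma serre_F : F12 * (F12 * F23 - qz (-1) • (F23 * F12)) =
    qz 1 • ((F12 * F23 - qz (-1) • (F23 * F12)) * F12) := by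
  have h := π_rel Rel.serreF
  rw [br, br, qcomm_of_even (by decide) 1 (by decide), qcomm_of_even (by decide) (-1) (by decide),
    map_sub, map_smul, map_mul, map_mul, map_sub, map_smul, map_mul, map_mul, sub_eq_zero] at h
  exact h

theorem glRelations : GlRelations qz E12 E23 F12 F23 br1 br2 qK where
  Q_zero := qz_zero
  Q_add := qz_add
  K_zero := qK_zero
  K_mul := qK_mul
  K_E1 a b c := hasWeight_E1.qK_mul a b c _ (by simp; ring)
  K_E2 a b c := hasWeight_E2.qK_mul a b c _ (by simp; ring)
  K_F1 a b c := hasWeight_F1.qK_mul a b c _ (by simp; ring)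
  K_F2 a b c := hasWeight_F2.qK_mul a b c _ (by simp; ring)
  K_b1 a b c := qbracket_commute _ _ _ _ _ _
  K_b2 a b c := qbracket_commute _ _ _ _ _ _
  b2_b1 := qbracket_qbracket_commute _ _ _ _ _ _
  kappa_b1 := by
    change kappa • br1 = _
    rw [br1, ← map_smul, kappa_smul_qbracket, map_sub, kk_neg]
    rfl
  kappa_b2 := by
    change kappa • br2 = _
    rw [br2, ← map_smul, kappa_smul_qbracket, map_sub, kk_neg]
    rfl
  b1_E1 := hasWeight_E1.qbracket_two 1 (-1) 0 rfl
  b1_E2 := hasWeight_E2.qbracket_neg_one 1 (-1) 0 rfl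
  b1_F1 := hasWeight_F1.qbracket_neg_two 1 (-1) 0 rfl
  b1_F2 := hasWeight_F2.qbracket_one 1 (-1) 0 rfl
  b2_E1 := hasWeight_E1.qbracket_neg_one 0 1 1 rfl
  b2_E2 := hasWeight_E2.qbracket_zero 0 1 1 rfl
  b2_F1 := hasWeight_F1.qbracket_one 0 1 1 rfl
  b2_F2 := hasWeight_F2.qbracket_zero 0 1 1 rfl
  E1_F1 := by
    have h := π_rel (Rel.EF 0 0)
    rw [br, qcomm_of_even_zero (by decide) (by decide), if_pos rfl, H_zero, map_sub, map_sub,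
      map_mul, map_mul, sub_eq_zero, sub_eq_iff_eq_add, add_comm] at h
    exact h
  E1_F2 := by
    have h := π_rel (Rel.EF 0 1)
    rw [br, qcomm_of_even_zero (by decide) (by decide), if_neg (by decide), sub_zero, map_sub,
      map_mul, map_mul, sub_eq_zero] at h
    exact h
  E2_F1 := by
    have h := π_rel (Rel.EF 1 0)
    rw [br, qcomm_of_even_zero (by decide) (by decide), if_neg (by decide), sub_zero, map_sub,
      map_mul, map_mul, sub_eq_zero] at h
    exact h
  E2_F2 := by
    have h := π_rel (Rel.EF 1 1)
    rw [br, qcomm_of_odd_zero (by decide) (by decide), if_pos rfl, H_one, map_sub, map_add,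
      map_mul, map_mul, sub_eq_zero, ← eq_sub_iff_add_eq, sub_eq_neg_add] at h
    exact h
  E2_E2 := by
    have h := π_rel Rel.EE
    rw [br, qcomm_of_odd_zero (by decide) (by decide), ← two_nsmul, map_nsmul, map_mul] at h
    exact eq_zero_of_two_smul h
  F2_F2 := by
    have h := π_rel Rel.FF
    rw [br, qcomm_of_odd_zero (by decide) (by decide), ← two_nsmul, map_nsmul, map_mul] at h
    exact eq_zero_of_two_smul h
  serreE := by
    have h := π_rel Rel.serreE
    rw [br, br, qcomm_of_even (by decide) (-1) (by decide), qcomm_of_even (by decide) 1 (by decide),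
      map_sub, map_smul, map_mul, map_mul, map_sub, map_smul, map_mul, map_mul, sub_eq_zero] at h
    exact h
  serreF := by
    have h := serre_F
    -- The defining relation and the required one nest the bracket differently, but both expand to
    -- `F₁² F₂ - (q + q⁻¹) F₁ F₂ F₁ + F₂ F₁² = 0`.
    have hq : qz 1 * qz (-1) = 1 := by rw [← qz_add, ← qz_zero]; rfl
    simp only [mul_sub, sub_mul, smul_sub, mul_smul_comm, smul_mul_assoc, smul_smul, hq, one_smul,
      mul_assoc] at h ⊢
    rw [sub_eq_sub_iff_add_eq_add] at h ⊢
    rw [add_comm, ← h, add_comm]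

lemma one_add_qz_smul_eq_zero {x : UGl} (h : (1 + qz 2) • x = 0) : x = 0 := by
  have h1 : IsUnit (1 + qz 2) := by
    have h2 : constantCoeff (qz 2) = 1 := by
      rw [← coeff_zero_eq_constantCoeff_apply, coeff_zero_qz]
    rw [isUnit_iff_constantCoeff, map_add, h2, map_one]
    norm_num
  exact (h1.smul_eq_zero).1 h

theorem glOrdering : GlOrdering qz E12 E23 E13 F12 F23 F13 br1 br2 qK :=
  glRelations.ordering fun _ => one_add_qz_smul_eq_zero

end Gl


/-! ### Transport of `q`-numbers along maps of completed free algebras. -/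

section Free

variable {G G' : Type} (g : G → Free G') {H : FreeAlgebra ℂ G} {H' : FreeAlgebra ℂ G'}

lemma lift_smul_pow (h : FreeAlgebra.lift ℂ g H = PowerSeries.C H') (r : ℂ) (n : ℕ) :
    FreeAlgebra.lift ℂ g (r • H ^ n) = PowerSeries.C (r • H' ^ n) := by
  rw [map_smul, map_pow, h, ← map_pow]
  ext m
  rw [coeff_smul, coeff_C, coeff_C]
  split_ifs <;> simp

lemma liftFree_qbracket (h : FreeAlgebra.lift ℂ g H = PowerSeries.C H') :
    liftFree g (qbracket H) = qbracket H' := by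
  have h' : FreeAlgebra.lift ℂ g (-H) = PowerSeries.C (-H') := by rw [map_neg, h, map_neg]
  rw [qbracket, map_smul, qbracket]
  congr 1
  refine liftFree_eq_of_coeff g fun n => ?_
  rw [hDiv, hDiv, coeff_mk, coeff_mk, map_sub, map_sub, map_sub, map_sub, qexp, qexp, qexp, qexp,
    coeff_mk, coeff_mk, coeff_mk, coeff_mk, lift_smul_pow g h, lift_smul_pow g h']

end Free

namespace Gl

/-! ### Weights for the adjoint action of the `K_i` -/

/-- `y` has weight `w` for the adjoint action of the elements `K_i`. -/
def AdWeight (y : UGl) (w : Fin 3 → ℤ) : Prop :=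
  ∀ i, θ (k i) * y = y * (θ (k i) + (w i : UGl))

lemma HasWeight.adWeight {x : FreeAlgebra ℂ GlGen} {w : Fin 3 → ℤ} (h : HasWeight x w) :
    AdWeight (θ x) w := fun i => by rw [h i, map_intCast]

lemma AdWeight.mul {x y : UGl} {v w : Fin 3 → ℤ} (hx : AdWeight x v) (hy : AdWeight y w) :
    AdWeight (x * y) (v + w) := fun i => by
  have h : (v i : UGl) * y = y * v i := Int.cast_comm _ _
  rw [← mul_assoc, hx i, mul_assoc, add_mul, hy i, h, ← mul_add, mul_assoc, Pi.add_apply,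
    Int.cast_add]
  congr 2
  abel

lemma AdWeight.sub {x y : UGl} {w : Fin 3 → ℤ} (hx : AdWeight x w) (hy : AdWeight y w) :
    AdWeight (x - y) w := fun i => by rw [mul_sub, hx i, hy i, sub_mul]

lemma AdWeight.neg {x : UGl} {w : Fin 3 → ℤ} (hx : AdWeight x w) :
    AdWeight (-x) w := fun i => by rw [mul_neg, hx i, neg_mul]

lemma AdWeight.smul {x : UGl} {w : Fin 3 → ℤ} (r : ℂ⟦X⟧) (hx : AdWeight x w) :
    AdWeight (r • x) w := fun i => by rw [mul_smul_comm, hx i, smul_mul_assoc]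

lemma adWeight_qK (a b c : ℤ) : AdWeight (qK a b c) 0 := fun i => by
  rw [Pi.zero_apply, Int.cast_zero, add_zero]
  have h : θ (k i) * θ (kk a b c) = θ (kk a b c) * θ (k i) := by
    simp only [kk, map_add, map_smul, mul_add, add_mul, mul_smul_comm, smul_mul_assoc, K_comm i]
  exact mul_clsHom_qexp h

lemma AdWeight.kk_mul {y : UGl} {w : Fin 3 → ℤ} (hy : AdWeight y w) (a b c : ℤ) :
    θ (kk a b c) * y = y * θ (kk a b c) + ((a * w 0 + b * w 1 + c * w 2 : ℤ) : ℂ⟦X⟧) • y := by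
  have h : ∀ m : ℤ, y * (m : UGl) = m • y := fun m => by rw [zsmul_eq_mul, Int.cast_comm]
  simp only [kk, map_add, Int.cast_smul_eq_zsmul, map_zsmul, add_mul, mul_add, smul_mul_assoc,
    hy _, h, mul_smul_comm, smul_add, add_smul, mul_smul]
  abel

/-! ### The images of the generators -/

def jimboH : Fin 3 → FreeAlgebra ℂ GlGen := ![kk (-1) 0 (-1), kk 1 (-1) 0, kk 0 1 1]

/-- The images of the generators, in the completed free algebra. -/
def jimboGen : LoopGen → Free GlGen
  | .h i => PowerSeries.C (jimboH i)
  | .e i => ![-((fF 1 * fF 0 - qz (-1) • (fF 0 * fF 1)) * qexp (kk 1 0 (-1))), fE 0, fE 1] i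
  | .f i => ![qexp (kk (-1) 0 1) * (fE 0 * fE 1 - qz 1 • (fE 1 * fE 0)), fF 0, fF 1] i

abbrev jimboFree : Free LoopGen →ₐ[ℂ⟦X⟧] UGl := π.comp (liftFree jimboGen)

def jimboE : Fin 3 → UGl := ![-(F13 * qK 1 0 (-1)), E12, E23]
def jimboF : Fin 3 → UGl := ![qK (-1) 0 1 * E13, F12, F23]

lemma jimboFree_fh (i : Fin 3) : jimboFree (Loop.fh i) = θ (jimboH i) := by
  change π (liftFree jimboGen (PowerSeries.C (FreeAlgebra.ι ℂ _))) = _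
  rw [liftFree_ι]
  rfl

lemma jimboFree_fe (i : Fin 3) : jimboFree (Loop.fe i) = jimboE i := by
  change π (liftFree jimboGen (PowerSeries.C (FreeAlgebra.ι ℂ _))) = _
  rw [liftFree_ι]
  fin_cases i <;> rfl

lemma jimboFree_ff (i : Fin 3) : jimboFree (Loop.ff i) = jimboF i := by
  change π (liftFree jimboGen (PowerSeries.C (FreeAlgebra.ι ℂ _))) = _
  rw [liftFree_ι]
  fin_cases i <;> rfl

lemma jimboFree_qbracket (i : Fin 3) :
    jimboFree (qbracket (Loop.h' i)) = π (qbracket (jimboH i)) :=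
  congrArg π (liftFree_qbracket _ (FreeAlgebra.lift_ι_apply _ _))

/-- Since `h₀ = -(H₁ + H₂)`, this is oddness of the `q`-number combined with `[H₁ + H₂] = [H₁] q ^
H₂ + q ^ (-H₁) [H₂]`. -/
lemma qbracket_jimboH_zero :
    π (qbracket (jimboH 0)) = -(br1 * qK 0 1 1 + br2 * qK (-1) 1 0) := by
  have h : jimboH 0 = -(kk 1 (-1) 0 + kk 0 1 1) := by rw [kk_add, kk_neg]; rfl
  rw [h, qbracket_neg, map_neg, clsHom_qbracket_add (commute_kk _ _ _ _ _ _), kk_neg]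
  change -(br1 * qK 0 1 1 + qK (-1) (- -1) (-0) * br2) = _
  rw [br2, qbracket_commute]
  rfl

lemma adWeight_jimboE (j : Fin 3) :
    AdWeight (jimboE j) (![![-1, 0, 1], ![1, -1, 0], ![0, 1, -1]] j) := by
  have h1 := hasWeight_F1.adWeight
  have h2 := hasWeight_F2.adWeight
  fin_cases j
  · have h3 : AdWeight (F12 * F23) (![0, -1, 1] + ![-1, 1, 0]) := by
      rw [add_comm]
      exact h1.mul h2
    have h := (((h2.mul h1).sub (h3.smul (qz (-1)))).mul
      (adWeight_qK 1 0 (-1))).neg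
    have hw : (![0, -1, 1] + ![-1, 1, 0] + 0 : Fin 3 → ℤ) = ![-1, 0, 1] := by decide
    rw [hw] at h
    exact h
  · exact hasWeight_E1.adWeight
  · exact hasWeight_E2.adWeight

lemma adWeight_jimboF (j : Fin 3) :
    AdWeight (jimboF j) (![![1, 0, -1], ![-1, 1, 0], ![0, -1, 1]] j) := by
  have h1 := hasWeight_E1.adWeight
  have h2 := hasWeight_E2.adWeight
  fin_cases j
  · have h3 : AdWeight (E23 * E12) (![1, -1, 0] + ![0, 1, -1]) := by
      rw [add_comm]
      exact h2.mul h1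
    have h := (adWeight_qK (-1) 0 1).mul ((h1.mul h2).sub (h3.smul (qz 1)))
    have hw : (0 + (![1, -1, 0] + ![0, 1, -1]) : Fin 3 → ℤ) = ![1, 0, -1] := by decide
    rw [hw] at h
    exact h
  · exact hasWeight_F1.adWeight
  · exact hasWeight_F2.adWeight

lemma jimboH_jimboE (i j : Fin 3) : θ (jimboH i) * jimboE j =
    jimboE j * θ (jimboH i) + (Loop.cartan i j : ℂ⟦X⟧) • jimboE j := by
  fin_cases i <;> refine ((adWeight_jimboE j).kk_mul _ _ _).trans ?_ <;> fin_cases j <;> rfl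

lemma jimboH_jimboF (i j : Fin 3) : θ (jimboH i) * jimboF j =
    jimboF j * θ (jimboH i) - (Loop.cartan i j : ℂ⟦X⟧) • jimboF j := by
  rw [sub_eq_add_neg, ← neg_smul, ← Int.cast_neg]
  fin_cases i <;> refine ((adWeight_jimboF j).kk_mul _ _ _).trans ?_ <;> fin_cases j <;> rfl

lemma jimboH_comm (i j : Fin 3) : θ (jimboH i) * θ (jimboH j) = θ (jimboH j) * θ (jimboH i) := by
  fin_cases i <;> fin_cases j <;> exact commute_kk _ _ _ _ _ _

end Gl


namespace Gl

/-! ### The Jimbo homomorphism -/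

lemma jimboFree_hh (i j : Fin 3) : jimboFree (Loop.br 0 0 (Loop.fh i) (Loop.fh j)) = 0 := by
  rw [Loop.br, map_qcomm, qcomm_of_even_zero (by decide) (by decide), jimboFree_fh, jimboFree_fh,
    jimboH_comm, sub_self]

lemma jimboFree_he (i j : Fin 3) :
    jimboFree (Loop.br 0 (Loop.sr j) (Loop.fh i) (Loop.fe j) -
      (Loop.cartan i j : ℂ⟦X⟧) • Loop.fe j) = 0 := by
  rw [Loop.br, map_sub, map_qcomm, map_smul,
    qcomm_of_even_zero (by fin_cases j <;> decide) (by fin_cases j <;> decide),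
    jimboFree_fh, jimboFree_fe, jimboH_jimboE, add_sub_cancel_left, sub_self]

lemma jimboFree_hf (i j : Fin 3) :
    jimboFree (Loop.br 0 (-Loop.sr j) (Loop.fh i) (Loop.ff j) +
      (Loop.cartan i j : ℂ⟦X⟧) • Loop.ff j) = 0 := by
  rw [Loop.br, map_add, map_qcomm, map_smul,
    qcomm_of_even_zero (by fin_cases j <;> decide) (by fin_cases j <;> decide),
    jimboFree_fh, jimboFree_ff, jimboH_jimboF]
  abel

lemma jimboFree_ef (i j : Fin 3) :
    jimboFree (Loop.br (Loop.sr i) (-Loop.sr j) (Loop.fe i) (Loop.ff j) -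
      if i = j then qbracket (Loop.h' i) else 0) = 0 := by
  have R := glOrdering
  rw [Loop.br, map_sub, map_qcomm, apply_ite jimboFree, map_zero, jimboFree_fe, jimboFree_ff,
    jimboFree_qbracket, sub_eq_zero]
  fin_cases i <;> fin_cases j
  · rw [qcomm_of_odd_zero (by decide) (by decide), if_pos rfl]
    exact R.affine_e0_f0.trans qbracket_jimboH_zero.symm
  · rw [qcomm_of_even_zero (by decide) (by decide), if_neg (by decide), sub_eq_zero]
    exact R.affine_e0_f1
  · rw [qcomm_of_odd_zero (by decide) (by decide), if_neg (by decide)]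
    exact R.affine_e0_f2
  · rw [qcomm_of_even_zero (by decide) (by decide), if_neg (by decide), sub_eq_zero]
    exact R.affine_e1_f0
  · rw [qcomm_of_even_zero (by decide) (by decide), if_pos rfl]
    exact sub_eq_of_eq_add' R.E1_F1
  · rw [qcomm_of_even_zero (by decide) (by decide), if_neg (by decide), sub_eq_zero]
    exact R.E1_F2
  · rw [qcomm_of_odd_zero (by decide) (by decide), if_neg (by decide)]
    exact R.affine_e2_f0
  · rw [qcomm_of_even_zero (by decide) (by decide), if_neg (by decide), sub_eq_zero]
    exact R.E2_F1
  · rw [qcomm_of_odd_zero (by decide) (by decide), if_pos rfl, ← eq_sub_iff_add_eq,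
      sub_eq_neg_add]
    exact R.E2_F2

lemma jimboFree_quinticE :
    jimboFree (Loop.quintic 1 Loop.fe 0 2 - Loop.quintic 1 Loop.fe 2 0) = 0 := by
  have R := glOrdering
  simp only [Loop.quintic, Loop.br, map_sub, map_qcomm, jimboFree_fe]
  rw [qcomm_of_odd (β := 1 • (Loop.sr 2 + _)) (by decide) (-1) (by decide),
    qcomm_of_even_zero (β := 1 • (Loop.sr 0 + _)) (by decide) (by decide),
    qcomm_of_odd_zero (α := 1 • Loop.sr 0) (β := 1 • (Loop.sr 2 + Loop.sr 1))
      (by decide) (by decide),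
    qcomm_of_even (α := 1 • Loop.sr 2) (β := 1 • (Loop.sr 1)) (by decide) 1 (by decide),
    qcomm_of_odd (β := 1 • (Loop.sr 0 + _)) (by decide) (-1) (by decide),
    qcomm_of_even_zero (β := 1 • (Loop.sr 2 + _)) (by decide) (by decide),
    qcomm_of_odd_zero (α := 1 • Loop.sr 2) (β := 1 • (Loop.sr 0 + Loop.sr 1))
      (by decide) (by decide),
    qcomm_of_even (α := 1 • Loop.sr 0) (β := 1 • (Loop.sr 1)) (by decide) 1 (by decide),
    sub_eq_zero]
  exact R.affine_quintic_E _ rfl _ _ _ _ _ _ rfl rfl rfl rfl rfl rfl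

lemma jimboFree_quinticF :
    jimboFree (Loop.quintic (-1) Loop.ff 0 2 - Loop.quintic (-1) Loop.ff 2 0) = 0 := by
  have R := glOrdering
  simp only [Loop.quintic, Loop.br, map_sub, map_qcomm, jimboFree_ff]
  rw [qcomm_of_odd (β := -1 • (Loop.sr 2 + _)) (by decide) 1 (by decide),
    qcomm_of_even_zero (β := -1 • (Loop.sr 0 + _)) (by decide) (by decide),
    qcomm_of_odd_zero (α := -1 • Loop.sr 0) (β := -1 • (Loop.sr 2 + Loop.sr 1))
      (by decide) (by decide),
    qcomm_of_even (α := -1 • Loop.sr 2) (β := -1 • (Loop.sr 1)) (by decide) (-1) (by decide),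
    qcomm_of_odd (β := -1 • (Loop.sr 0 + _)) (by decide) 1 (by decide),
    qcomm_of_even_zero (β := -1 • (Loop.sr 2 + _)) (by decide) (by decide),
    qcomm_of_odd_zero (α := -1 • Loop.sr 2) (β := -1 • (Loop.sr 0 + Loop.sr 1))
      (by decide) (by decide),
    qcomm_of_even (α := -1 • Loop.sr 0) (β := -1 • (Loop.sr 1)) (by decide) (-1) (by decide),
    sub_eq_zero]
  exact R.affine_quintic_F _ rfl _ _ _ _ _ _ rfl rfl rfl rfl rfl rfl

lemma jimboFree_rel {x : Free LoopGen} (hx : Loop.Rel x) : jimboFree x = 0 := by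
  have R := glOrdering
  cases hx with
  | sum =>
    rw [map_add, map_add, jimboFree_fh, jimboFree_fh, jimboFree_fh, ← map_add, ← map_add]
    change θ (kk _ _ _ + kk _ _ _ + kk _ _ _) = 0
    rw [kk_add, kk_add]
    simp [kk]
  | hh i j => exact jimboFree_hh i j
  | he i j => exact jimboFree_he i j
  | hf i j => exact jimboFree_hf i j
  | ef i j => exact jimboFree_ef i j
  | ee0 =>
    rw [Loop.br, map_qcomm, jimboFree_fe, qcomm_of_odd_zero (by decide) (by decide)]
    have h : jimboE 0 * jimboE 0 = 0 := (neg_mul_neg _ _).trans R.affine_e0_e0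
    rw [h, add_zero]
  | ff0 =>
    rw [Loop.br, map_qcomm, jimboFree_ff, qcomm_of_odd_zero (by decide) (by decide)]
    have h : jimboF 0 * jimboF 0 = 0 := R.affine_f0_f0
    rw [h, add_zero]
  | ee2 =>
    rw [Loop.br, map_qcomm, jimboFree_fe, qcomm_of_odd_zero (by decide) (by decide)]
    change E23 * E23 + E23 * E23 = 0
    rw [R.E2_E2, add_zero]
  | ff2 =>
    rw [Loop.br, map_qcomm, jimboFree_ff, qcomm_of_odd_zero (by decide) (by decide)]
    change F23 * F23 + F23 * F23 = 0
    rw [R.F2_F2, add_zero]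
  | serreE0 =>
    rw [Loop.br, Loop.br, map_qcomm, map_qcomm, jimboFree_fe, jimboFree_fe,
      qcomm_of_even (by decide) (-1) (by decide), qcomm_of_even (by decide) 1 (by decide),
      sub_eq_zero]
    exact R.affine_serre_E0 _ _ rfl rfl
  | serreF0 =>
    rw [Loop.br, Loop.br, map_qcomm, map_qcomm, jimboFree_ff, jimboFree_ff,
      qcomm_of_even (by decide) 1 (by decide), qcomm_of_even (by decide) (-1) (by decide),
      sub_eq_zero]
    exact R.affine_serre_F0 _ _ rfl rfl
  | serreE2 =>
    rw [Loop.br, Loop.br, map_qcomm, map_qcomm, jimboFree_fe, jimboFree_fe,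
      qcomm_of_even (by decide) (-1) (by decide), qcomm_of_even (by decide) 1 (by decide),
      sub_eq_zero]
    exact R.serreE
  | serreF2 =>
    rw [Loop.br, Loop.br, map_qcomm, map_qcomm, jimboFree_ff, jimboFree_ff,
      qcomm_of_even (by decide) 1 (by decide), qcomm_of_even (by decide) (-1) (by decide),
      sub_eq_zero]
    exact serre_F
  | quinticE => exact jimboFree_quinticE
  | quinticF => exact jimboFree_quinticF

def jimbo : ULoop →ₐ[ℂ⟦X⟧] UGl := liftPresented jimboGen fun _ hx => jimboFree_rel hx

theorem isJimbo_jimbo : IsJimbo jimbo where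
  h0 := by
    refine (jimboFree_fh 0).trans ?_
    change θ (kk (-1) 0 (-1)) = -θ (k 2) - θ (k 0)
    rw [← map_neg, ← map_sub]
    congr 1
    simp only [kk, Int.cast_neg, Int.cast_one, Int.cast_zero, neg_smul, one_smul, zero_smul]
    abel
  h1 := by
    refine (jimboFree_fh 1).trans ?_
    change θ (kk 1 (-1) 0) = θ (k 0) - θ (k 1)
    rw [← H_zero, ← map_sub]
    rfl
  h2 := by
    refine (jimboFree_fh 2).trans ?_
    change θ (kk 0 1 1) = θ (k 1) + θ (k 2)
    rw [← H_one, ← map_add]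
    rfl
  e0 := jimboFree_fe 0
  e1 := jimboFree_fe 1
  e2 := jimboFree_fe 2
  f0 := jimboFree_ff 0
  f1 := jimboFree_ff 1
  f2 := jimboFree_ff 2

theorem existsUnique_jimbo : ∃! ε : ULoop →ₐ[ℂ⟦X⟧] UGl, IsJimbo ε := by
  refine ⟨jimbo, isJimbo_jimbo, fun ε h => algHom_ext fun g => ?_⟩
  have h' := isJimbo_jimbo
  cases g with
  | h i => fin_cases i; exacts [h.h0.trans h'.h0.symm, h.h1.trans h'.h1.symm, h.h2.trans h'.h2.symm]
  | e i => fin_cases i; exacts [h.e0.trans h'.e0.symm, h.e1.trans h'.e1.symm, h.e2.trans h'.e2.symm]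
  | f i => fin_cases i; exacts [h.f0.trans h'.f0.symm, h.f1.trans h'.f1.symm, h.f2.trans h'.f2.symm]

end Gl


/-! ### Commutators of the images of root vectors. -/

namespace GlOrdering

variable {S A : Type*} [CommRing S] [Ring A] [Algebra S A] {Q : ℤ → S}
  {E1 E2 E3 F1 F2 F3 b1 b2 : A} {K : ℤ → ℤ → ℤ → A}

lemma loop_d12 (R : GlOrdering Q E1 E2 E3 F1 F2 F3 b1 b2 K) :
        E2 * -(F3 * K 1 0 (-1)) + Q (-1) • (-(F3 * K 1 0 (-1)) * E2) = -(F1 * K 1 1 0) := by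
  have hq := R.Q_mul_neg
  simp only [R.rules, R.toGlRelations.rules, R.scalar_rules, add_mul, sub_mul, neg_mul,
    smul_mul_assoc, mul_add, mul_sub, mul_neg, mul_smul_comm, smul_add, smul_sub, smul_neg,
    smul_smul, neg_smul, neg_neg, neg_zero, mul_zero, zero_mul, smul_zero, mul_assoc, mul_one,
    one_mul, sub_zero, zero_sub, add_zero, zero_add, sub_neg_eq_add, Int.reduceAdd,
    Int.reduceSub, Int.reduceNeg]
  match_scalars <;> grind

lemma loop_d23 (R : GlOrdering Q E1 E2 E3 F1 F2 F3 b1 b2 K) :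
        E1 * -(F3 * K 1 0 (-1)) - Q 1 • (-(F3 * K 1 0 (-1)) * E1) = Q 1 • (F2 * K 0 1 (-1) + (Q 1
    - Q (-1)) • (E1 * F3 * K 1 0 (-1))) := by
  have hq := R.Q_mul_neg
  simp only [R.rules, R.toGlRelations.rules, R.scalar_rules, add_mul, sub_mul, neg_mul,
    smul_mul_assoc, mul_add, mul_sub, mul_neg, mul_smul_comm, smul_add, smul_sub, smul_neg,
    smul_smul, neg_smul, neg_neg, neg_zero, mul_zero, zero_mul, smul_zero, mul_assoc, mul_one,
    one_mul, sub_zero, zero_sub, add_zero, zero_add, sub_neg_eq_add, Int.reduceAdd,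
    Int.reduceSub, Int.reduceNeg]
  match_scalars <;> grind

lemma loop_im1 (R : GlOrdering Q E1 E2 E3 F1 F2 F3 b1 b2 K) :
        E1 * -(F1 * K 1 1 0) - Q 2 • (-(F1 * K 1 1 0) * E1) = Q 2 • (F1 * E1 * K 1 1 0) - E1 * F1
    * K 1 1 0 := by
  have hq := R.Q_mul_neg
  simp only [R.rules, R.toGlRelations.rules, R.scalar_rules, add_mul, sub_mul, neg_mul,
    smul_mul_assoc, mul_add, mul_sub, mul_neg, mul_smul_comm, smul_add, smul_sub, smul_neg,
    smul_smul, neg_smul, neg_neg, neg_zero, mul_zero, zero_mul, smul_zero, mul_assoc, mul_one,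
    one_mul, sub_zero, zero_sub, add_zero, zero_add, sub_neg_eq_add, Int.reduceAdd,
    Int.reduceSub, Int.reduceNeg]
  match_scalars <;> grind

/-- The factor `[2]_q` is the one removed in the definition of the root vectors, so each step in `δ`
multiplies `E₁` by `q² q ^ (2 K₁)` on the right. -/
lemma E1_comm_im1 (R : GlOrdering Q E1 E2 E3 F1 F2 F3 b1 b2 K) :
        ∀ a : A, a = Q 2 • (F1 * E1 * K 1 1 0) - E1 * F1 * K 1 1 0 → E1 * a - a * E1 = (Q 1 + Q
    (-1)) • (E1 * Q 2 • K 2 0 0) := by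
  rintro _ rfl
  have hq := R.Q_mul_neg
  have h1 : K 2 0 0 = K 0 2 0 + (Q 1 - Q (-1)) • (b1 * K 1 1 0) := by
    simpa only [Int.reduceAdd, Int.reduceNeg] using R.K_eq_add_b1 1 1 0
  simp only [R.rules, R.toGlRelations.rules, R.scalar_rules, add_mul, sub_mul, neg_mul,
    smul_mul_assoc, mul_add, mul_sub, mul_neg, mul_smul_comm, smul_add, smul_sub, smul_neg,
    smul_smul, neg_smul, neg_neg, neg_zero, mul_zero, zero_mul, smul_zero, mul_assoc, mul_one,
    one_mul, sub_zero, zero_sub, add_zero, zero_add, sub_neg_eq_add, Int.reduceAdd,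
    Int.reduceSub, Int.reduceNeg]
  simp only [h1, mul_add, smul_add, mul_smul_comm, smul_smul]
  match_scalars <;> grind

lemma im1_comm_d12 (R : GlOrdering Q E1 E2 E3 F1 F2 F3 b1 b2 K) :
        ∀ a : A, a = Q 2 • (F1 * E1 * K 1 1 0) - E1 * F1 * K 1 1 0 → a * -(F1 * K 1 1 0) - -(F1 *
    K 1 1 0) * a = (Q 1 + Q (-1)) • (Q 2 • K 2 0 0 * -(F1 * K 1 1 0)) := by
  rintro _ rfl
  have hq := R.Q_mul_neg
  have h1 : K 3 1 0 = K 1 3 0 + (Q 1 - Q (-1)) • (b1 * K 2 2 0) := by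
    simpa only [Int.reduceAdd, Int.reduceNeg] using R.K_eq_add_b1 2 2 0
  simp only [R.rules, R.toGlRelations.rules, R.scalar_rules, add_mul, sub_mul, neg_mul,
    smul_mul_assoc, mul_add, mul_sub, mul_neg, mul_smul_comm, smul_add, smul_sub, smul_neg,
    smul_smul, neg_smul, neg_neg, neg_zero, mul_zero, zero_mul, smul_zero, mul_assoc, mul_one,
    one_mul, sub_zero, zero_sub, add_zero, zero_add, sub_neg_eq_add, Int.reduceAdd,
    Int.reduceSub, Int.reduceNeg]
  simp only [h1, mul_add, smul_add, mul_smul_comm, smul_smul]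
  match_scalars <;> grind

lemma commute_K_im1 (R : GlOrdering Q E1 E2 E3 F1 F2 F3 b1 b2 K) :
        ∀ a : A, a = Q 2 • (F1 * E1 * K 1 1 0) - E1 * F1 * K 1 1 0 → K 2 0 0 * a = a * K 2 0 0 :=
    by
  rintro _ rfl
  have hq := R.Q_mul_neg
  simp only [R.rules, R.toGlRelations.rules, R.scalar_rules, add_mul, sub_mul, neg_mul,
    smul_mul_assoc, mul_add, mul_sub, mul_neg, mul_smul_comm, smul_add, smul_sub, smul_neg,
    smul_smul, neg_smul, neg_neg, neg_zero, mul_zero, zero_mul, smul_zero, mul_assoc, mul_one,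
    one_mul, sub_zero, zero_sub, add_zero, zero_add, sub_neg_eq_add, Int.reduceAdd,
    Int.reduceSub, Int.reduceNeg]
  match_scalars <;> grind

lemma commute_K_im1' (R : GlOrdering Q E1 E2 E3 F1 F2 F3 b1 b2 K) :
        ∀ a : A, a = Q 2 • (F1 * E1 * K 1 1 0) - E1 * F1 * K 1 1 0 → K 2 2 0 * a = a * K 2 2 0 :=
    by
  rintro _ rfl
  have hq := R.Q_mul_neg
  simp only [R.rules, R.toGlRelations.rules, R.scalar_rules, add_mul, sub_mul, neg_mul,
    smul_mul_assoc, mul_add, mul_sub, mul_neg, mul_smul_comm, smul_add, smul_sub, smul_neg,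
    smul_smul, neg_smul, neg_neg, neg_zero, mul_zero, zero_mul, smul_zero, mul_assoc, mul_one,
    one_mul, sub_zero, zero_sub, add_zero, zero_add, sub_neg_eq_add, Int.reduceAdd,
    Int.reduceSub, Int.reduceNeg]
  match_scalars <;> grind

lemma commute_K_im2 (R : GlOrdering Q E1 E2 E3 F1 F2 F3 b1 b2 K) :
        ∀ d : A, d = Q 1 • (F2 * K 0 1 (-1) + (Q 1 - Q (-1)) • (E1 * F3 * K 1 0 (-1))) → K 2 0 0 *
    (E2 * d + d * E2) = (E2 * d + d * E2) * K 2 0 0 := by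
  rintro _ rfl
  have hq := R.Q_mul_neg
  simp only [R.rules, R.toGlRelations.rules, R.scalar_rules, add_mul, sub_mul, neg_mul,
    smul_mul_assoc, mul_add, mul_sub, mul_neg, mul_smul_comm, smul_add, smul_sub, smul_neg,
    smul_smul, neg_smul, neg_neg, neg_zero, mul_zero, zero_mul, smul_zero, mul_assoc, mul_one,
    one_mul, sub_zero, zero_sub, add_zero, zero_add, sub_neg_eq_add, Int.reduceAdd,
    Int.reduceSub, Int.reduceNeg]
  match_scalars <;> grind

/-- The image of `e'_{δ,α₂}` is minus the anticommutator appearing here; that sign becomes the `-q²`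
in the substitution for `α₁₃`. -/
lemma E3_comm_im2 (R : GlOrdering Q E1 E2 E3 F1 F2 F3 b1 b2 K) :
        ∀ d : A, d = Q 1 • (F2 * K 0 1 (-1) + (Q 1 - Q (-1)) • (E1 * F3 * K 1 0 (-1))) → E3 * (E2
    * d + d * E2) - (E2 * d + d * E2) * E3 = E3 * Q 2 • K 2 0 0 := by
  rintro _ rfl
  have hq := R.Q_mul_neg
  have h1 : K 2 0 0 = K 0 2 0 + (Q 1 - Q (-1)) • (b1 * K 1 1 0) := by
    simpa only [Int.reduceAdd, Int.reduceNeg] using R.K_eq_add_b1 1 1 0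
  have h2 : K 0 2 0 = K 0 0 (-2) + (Q 1 - Q (-1)) • (b2 * K 0 1 (-1)) := by
    simpa only [Int.reduceAdd, Int.reduceNeg] using R.K_eq_add_b2 0 1 (-1)
  simp only [R.rules, R.toGlRelations.rules, R.scalar_rules, add_mul, sub_mul, neg_mul,
    smul_mul_assoc, mul_add, mul_sub, mul_neg, mul_smul_comm, smul_add, smul_sub, smul_neg,
    smul_smul, neg_smul, neg_neg, neg_zero, mul_zero, zero_mul, smul_zero, mul_assoc, mul_one,
    one_mul, sub_zero, zero_sub, add_zero, zero_add, sub_neg_eq_add, Int.reduceAdd,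
    Int.reduceSub, Int.reduceNeg]
  simp only [h1, h2, mul_add, smul_add, mul_smul_comm, smul_smul]
  match_scalars <;> grind

lemma im2_comm_d13 (R : GlOrdering Q E1 E2 E3 F1 F2 F3 b1 b2 K) :
        ∀ d : A, d = Q 1 • (F2 * K 0 1 (-1) + (Q 1 - Q (-1)) • (E1 * F3 * K 1 0 (-1))) → (E2 * d +
    d * E2) * (F3 * K 1 0 (-1)) - F3 * K 1 0 (-1) * (E2 * d + d * E2) = Q 2 • K 2 0 0 * (F3 * K 1
    0 (-1)) := by
  rintro _ rfl
  have hq := R.Q_mul_neg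
  have h1 : K 3 0 (-1) = K 1 2 (-1) + (Q 1 - Q (-1)) • (b1 * K 2 1 (-1)) := by
    simpa only [Int.reduceAdd, Int.reduceNeg] using R.K_eq_add_b1 2 1 (-1)
  have h2 : K 1 2 (-1) = K 1 0 (-3) + (Q 1 - Q (-1)) • (b2 * K 1 1 (-2)) := by
    simpa only [Int.reduceAdd, Int.reduceNeg] using R.K_eq_add_b2 1 1 (-2)
  simp only [R.rules, R.toGlRelations.rules, R.scalar_rules, add_mul, sub_mul, neg_mul,
    smul_mul_assoc, mul_add, mul_sub, mul_neg, mul_smul_comm, smul_add, smul_sub, smul_neg,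
    smul_smul, neg_smul, neg_neg, neg_zero, mul_zero, zero_mul, smul_zero, mul_assoc, mul_one,
    one_mul, sub_zero, zero_sub, add_zero, zero_add, sub_neg_eq_add, Int.reduceAdd,
    Int.reduceSub, Int.reduceNeg]
  simp only [h1, h2, mul_add, smul_add, mul_smul_comm, smul_smul]
  match_scalars <;> grind

/-- The coefficient `D` of the second-order recursion differs from a multiple of `a` only by a
multiple of `q ^ (2 K₁)`. Its commutation properties therefore reduce to those of `a` and `q ^ (2
K₁)`. -/
lemma im1_eq (R : GlOrdering Q E1 E2 E3 F1 F2 F3 b1 b2 K) :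
        ∀ a D : A, a = Q 2 • (F1 * E1 * K 1 1 0) - E1 * F1 * K 1 1 0 → D = Q 3 • K 0 2 0 + Q 1 • K
    2 0 0 + ((Q 1 - Q (-1)) ^ 2 * Q 2) • (E1 * F1 * K 1 1 0) → ((Q 1 - Q (-1)) * Q 1) • a = D - (Q
    3 + Q 1) • K 2 0 0 := by
  rintro _ _ rfl rfl
  have hq := R.Q_mul_neg
  have h1 : K 2 0 0 = K 0 2 0 + (Q 1 - Q (-1)) • (b1 * K 1 1 0) := by
    simpa only [Int.reduceAdd, Int.reduceNeg] using R.K_eq_add_b1 1 1 0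
  simp only [R.rules, R.toGlRelations.rules, R.scalar_rules, add_mul, sub_mul, neg_mul,
    smul_mul_assoc, mul_add, mul_sub, mul_neg, mul_smul_comm, smul_add, smul_sub, smul_neg,
    smul_smul, neg_smul, neg_neg, neg_zero, mul_zero, zero_mul, smul_zero, mul_assoc, mul_one,
    one_mul, sub_zero, zero_sub, add_zero, zero_add, sub_neg_eq_add, Int.reduceAdd,
    Int.reduceSub, Int.reduceNeg]
  simp only [h1, mul_add, smul_add, mul_smul_comm, smul_smul]
  match_scalars <;> grind

/-- Unlike `E₁`, the vector `E₂` is not multiplied by a Cartan element; the defect `N` is what makes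
the recursion for `α₂₃` second order. It closes up by `im1_comm_N`. -/
lemma im1_comm_E2 (R : GlOrdering Q E1 E2 E3 F1 F2 F3 b1 b2 K) :
        ∀ a D N : A, a = Q 2 • (F1 * E1 * K 1 1 0) - E1 * F1 * K 1 1 0 → D = Q 3 • K 0 2 0 + Q 1 •
    K 2 0 0 + ((Q 1 - Q (-1)) ^ 2 * Q 2) • (E1 * F1 * K 1 1 0) → N = ((Q 1 - Q (-1)) * Q 2) • (E3
    * F1 * K 1 1 0) - Q 1 • (E2 * K 2 0 0) → a * E2 - E2 * a = E2 * D + N := by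
  rintro _ _ _ rfl rfl rfl
  have hq := R.Q_mul_neg
  have h1 : K 2 0 0 = K 0 2 0 + (Q 1 - Q (-1)) • (b1 * K 1 1 0) := by
    simpa only [Int.reduceAdd, Int.reduceNeg] using R.K_eq_add_b1 1 1 0
  simp only [R.rules, R.toGlRelations.rules, R.scalar_rules, add_mul, sub_mul, neg_mul,
    smul_mul_assoc, mul_add, mul_sub, mul_neg, mul_smul_comm, smul_add, smul_sub, smul_neg,
    smul_smul, neg_smul, neg_neg, neg_zero, mul_zero, zero_mul, smul_zero, mul_assoc, mul_one,
    one_mul, sub_zero, zero_sub, add_zero, zero_add, sub_neg_eq_add, Int.reduceAdd,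
    Int.reduceSub, Int.reduceNeg]
  simp only [h1, mul_add, smul_add, mul_smul_comm, smul_smul]
  match_scalars <;> grind

lemma im1_comm_N (R : GlOrdering Q E1 E2 E3 F1 F2 F3 b1 b2 K) :
        ∀ a N : A, a = Q 2 • (F1 * E1 * K 1 1 0) - E1 * F1 * K 1 1 0 → N = ((Q 1 - Q (-1)) * Q 2)
    • (E3 * F1 * K 1 1 0) - Q 1 • (E2 * K 2 0 0) → a * N - N * a = -(E2 * Q 4 • K 2 2 0) := by
  rintro _ _ rfl rfl
  have hq := R.Q_mul_neg
  have h1 : K 3 1 0 = K 1 3 0 + (Q 1 - Q (-1)) • (b1 * K 2 2 0) := by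
    simpa only [Int.reduceAdd, Int.reduceNeg] using R.K_eq_add_b1 2 2 0
  simp only [R.rules, R.toGlRelations.rules, R.scalar_rules, add_mul, sub_mul, neg_mul,
    smul_mul_assoc, mul_add, mul_sub, mul_neg, mul_smul_comm, smul_add, smul_sub, smul_neg,
    smul_smul, neg_smul, neg_neg, neg_zero, mul_zero, zero_mul, smul_zero, mul_assoc, mul_one,
    one_mul, sub_zero, zero_sub, add_zero, zero_add, sub_neg_eq_add, Int.reduceAdd,
    Int.reduceSub, Int.reduceNeg]
  simp only [h1, mul_add, smul_add, mul_smul_comm, smul_smul]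
  match_scalars <;> grind

lemma d23_comm_im1 (R : GlOrdering Q E1 E2 E3 F1 F2 F3 b1 b2 K) :
        ∀ a d D M : A, a = Q 2 • (F1 * E1 * K 1 1 0) - E1 * F1 * K 1 1 0 → d = Q 1 • (F2 * K 0 1
    (-1) + (Q 1 - Q (-1)) • (E1 * F3 * K 1 0 (-1))) → D = Q 3 • K 0 2 0 + Q 1 • K 2 0 0 + ((Q 1 -
    Q (-1)) ^ 2 * Q 2) • (E1 * F1 * K 1 1 0) → M = -(Q 2 • (K 2 0 0 * F2 * K 0 1 (-1))) → d * a -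
    a * d = D * d + M := by
  rintro _ _ _ _ rfl rfl rfl rfl
  have hq := R.Q_mul_neg
  have h1 : K 3 0 (-1) = K 1 2 (-1) + (Q 1 - Q (-1)) • (b1 * K 2 1 (-1)) := by
    simpa only [Int.reduceAdd, Int.reduceNeg] using R.K_eq_add_b1 2 1 (-1)
  have h2 : K 2 1 (-1) = K 0 3 (-1) + (Q 1 - Q (-1)) • (b1 * K 1 2 (-1)) := by
    simpa only [Int.reduceAdd, Int.reduceNeg] using R.K_eq_add_b1 1 2 (-1)
  simp only [R.rules, R.toGlRelations.rules, R.scalar_rules, add_mul, sub_mul, neg_mul,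
    smul_mul_assoc, mul_add, mul_sub, mul_neg, mul_smul_comm, smul_add, smul_sub, smul_neg,
    smul_smul, neg_smul, neg_neg, neg_zero, mul_zero, zero_mul, smul_zero, mul_assoc, mul_one,
    one_mul, sub_zero, zero_sub, add_zero, zero_add, sub_neg_eq_add, Int.reduceAdd,
    Int.reduceSub, Int.reduceNeg]
  simp only [h1, h2, mul_add, smul_add, mul_smul_comm, smul_smul]
  match_scalars <;> grind

lemma M_comm_im1 (R : GlOrdering Q E1 E2 E3 F1 F2 F3 b1 b2 K) :
        ∀ a d M : A, a = Q 2 • (F1 * E1 * K 1 1 0) - E1 * F1 * K 1 1 0 → d = Q 1 • (F2 * K 0 1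
    (-1) + (Q 1 - Q (-1)) • (E1 * F3 * K 1 0 (-1))) → M = -(Q 2 • (K 2 0 0 * F2 * K 0 1 (-1))) → M
    * a - a * M = -(Q 4 • K 2 2 0 * d) := by
  rintro _ _ _ rfl rfl rfl
  have hq := R.Q_mul_neg
  simp only [R.rules, R.toGlRelations.rules, R.scalar_rules, add_mul, sub_mul, neg_mul,
    smul_mul_assoc, mul_add, mul_sub, mul_neg, mul_smul_comm, smul_add, smul_sub, smul_neg,
    smul_smul, neg_smul, neg_neg, neg_zero, mul_zero, zero_mul, smul_zero, mul_assoc, mul_one,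
    one_mul, sub_zero, zero_sub, add_zero, zero_add, sub_neg_eq_add, Int.reduceAdd,
    Int.reduceSub, Int.reduceNeg]
  match_scalars <;> grind

lemma im2_eq (R : GlOrdering Q E1 E2 E3 F1 F2 F3 b1 b2 K) :
        ∀ d D : A, d = Q 1 • (F2 * K 0 1 (-1) + (Q 1 - Q (-1)) • (E1 * F3 * K 1 0 (-1))) → D = Q 3
    • K 0 2 0 + Q 1 • K 2 0 0 + ((Q 1 - Q (-1)) ^ 2 * Q 2) • (E1 * F1 * K 1 1 0) → (Q 1 - Q (-1))
    • (E2 * d + d * E2) = D - Q 1 • K 2 0 0 - Q 3 • K 0 0 (-2) - ((Q 1 - Q (-1)) ^ 2 * Q 2) • (E3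
    * F3 * K 1 0 (-1)) - ((Q 1 - Q (-1)) ^ 2 * Q 1) • (E2 * d) := by
  rintro _ _ rfl rfl
  have hq := R.Q_mul_neg
  have h1 : K 0 2 0 = K 0 0 (-2) + (Q 1 - Q (-1)) • (b2 * K 0 1 (-1)) := by
    simpa only [Int.reduceAdd, Int.reduceNeg] using R.K_eq_add_b2 0 1 (-1)
  simp only [R.rules, R.toGlRelations.rules, R.scalar_rules, add_mul, sub_mul, neg_mul,
    smul_mul_assoc, mul_add, mul_sub, mul_neg, mul_smul_comm, smul_add, smul_sub, smul_neg,
    smul_smul, neg_smul, neg_neg, neg_zero, mul_zero, zero_mul, smul_zero, mul_assoc, mul_one,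
    one_mul, sub_zero, zero_sub, add_zero, zero_add, sub_neg_eq_add, Int.reduceAdd,
    Int.reduceSub, Int.reduceNeg]
  simp only [h1, mul_add, smul_add, mul_smul_comm, smul_smul]
  match_scalars <;> grind

/-- Commutativity of the two imaginary root vectors at level `δ`; it is the base case for commuting
`D` with all pairings. -/
lemma im1_comm_im2 (R : GlOrdering Q E1 E2 E3 F1 F2 F3 b1 b2 K) :
        ∀ a d : A, a = Q 2 • (F1 * E1 * K 1 1 0) - E1 * F1 * K 1 1 0 → d = Q 1 • (F2 * K 0 1 (-1)
    + (Q 1 - Q (-1)) • (E1 * F3 * K 1 0 (-1))) → a * (E2 * d + d * E2) = (E2 * d + d * E2) * a :=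
    by
  rintro _ _ rfl rfl
  have hq := R.Q_mul_neg
  have h1 : K 3 0 (-1) = K 1 2 (-1) + (Q 1 - Q (-1)) • (b1 * K 2 1 (-1)) := by
    simpa only [Int.reduceAdd, Int.reduceNeg] using R.K_eq_add_b1 2 1 (-1)
  simp only [R.rules, R.toGlRelations.rules, R.scalar_rules, add_mul, sub_mul, neg_mul,
    smul_mul_assoc, mul_add, mul_sub, mul_neg, mul_smul_comm, smul_add, smul_sub, smul_neg,
    smul_smul, neg_smul, neg_neg, neg_zero, mul_zero, zero_mul, smul_zero, mul_assoc, mul_one,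
    one_mul, sub_zero, zero_sub, add_zero, zero_add, sub_neg_eq_add, Int.reduceAdd,
    Int.reduceSub, Int.reduceNeg]
  simp only [h1, mul_add, smul_add, mul_smul_comm, smul_smul]
  match_scalars <;> grind

lemma d23_comm_N (R : GlOrdering Q E1 E2 E3 F1 F2 F3 b1 b2 K) :
        ∀ d N : A, d = Q 1 • (F2 * K 0 1 (-1) + (Q 1 - Q (-1)) • (E1 * F3 * K 1 0 (-1))) → N = ((Q
    1 - Q (-1)) * Q 2) • (E3 * F1 * K 1 1 0) - Q 1 • (E2 * K 2 0 0) → d * N + Q 2 • (N * d) = -(Q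
    4 • (b2 * K 2 1 (-1))) := by
  rintro _ _ rfl rfl
  have hq := R.Q_mul_neg
  have h1 : K 3 1 0 = K 1 3 0 + (Q 1 - Q (-1)) • (b1 * K 2 2 0) := by
    simpa only [Int.reduceAdd, Int.reduceNeg] using R.K_eq_add_b1 2 2 0
  have h2 : K 1 3 0 = K 1 1 (-2) + (Q 1 - Q (-1)) • (b2 * K 1 2 (-1)) := by
    simpa only [Int.reduceAdd, Int.reduceNeg] using R.K_eq_add_b2 1 2 (-1)
  have h3 : K 3 0 (-1) = K 1 2 (-1) + (Q 1 - Q (-1)) • (b1 * K 2 1 (-1)) := by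
    simpa only [Int.reduceAdd, Int.reduceNeg] using R.K_eq_add_b1 2 1 (-1)
  simp only [R.rules, R.toGlRelations.rules, R.scalar_rules, add_mul, sub_mul, neg_mul,
    smul_mul_assoc, mul_add, mul_sub, mul_neg, mul_smul_comm, smul_add, smul_sub, smul_neg,
    smul_smul, neg_smul, neg_neg, neg_zero, mul_zero, zero_mul, smul_zero, mul_assoc, mul_one,
    one_mul, sub_zero, zero_sub, add_zero, zero_add, sub_neg_eq_add, Int.reduceAdd,
    Int.reduceSub, Int.reduceNeg]
  simp only [h1, h2, h3, mul_add, smul_add, mul_smul_comm, smul_smul]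
  match_scalars <;> grind

lemma im1_comm_b2 (R : GlOrdering Q E1 E2 E3 F1 F2 F3 b1 b2 K) :
        ∀ a : A, a = Q 2 • (F1 * E1 * K 1 1 0) - E1 * F1 * K 1 1 0 → a * (b2 * K 2 1 (-1)) = b2 *
    K 2 1 (-1) * a := by
  rintro _ rfl
  have hq := R.Q_mul_neg
  simp only [R.rules, R.toGlRelations.rules, R.scalar_rules, add_mul, sub_mul, neg_mul,
    smul_mul_assoc, mul_add, mul_sub, mul_neg, mul_smul_comm, smul_add, smul_sub, smul_neg,
    smul_smul, neg_smul, neg_neg, neg_zero, mul_zero, zero_mul, smul_zero, mul_assoc, mul_one,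
    one_mul, sub_zero, zero_sub, add_zero, zero_add, sub_neg_eq_add, Int.reduceAdd,
    Int.reduceSub, Int.reduceNeg]
  match_scalars <;> grind

end GlOrdering


namespace Loop

/-! ### Brackets of root vectors -/

lemma form_cartan (α β : Fin 3 → ℤ) : form cartan α β =
    -(α 0 * β 1) + α 0 * β 2 - α 1 * β 0 + 2 * (α 1 * β 1) - α 1 * β 2 + α 2 * β 0 - α 2 * β 1 := by
  simp [form, Fin.sum_univ_three, cartan]
  ring

lemma par_parity (α : Fin 3 → ℤ) : par parity α = α 0 + α 2 := by
  simp [par, Fin.sum_univ_three, parity]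

lemma δ_apply (i : Fin 3) : δ i = 1 := by
  fin_cases i <;> rfl

lemma add_nsmul_δ_nonneg {α : Fin 3 → ℤ} (hα : ∀ i, 0 ≤ α i) (n : ℕ) (i : Fin 3) :
    0 ≤ (α + n • δ) i := by
  rw [Pi.add_apply, Pi.smul_apply, δ_apply]
  exact add_nonneg (hα i) (by positivity)

/-- The root `δ` lies in the kernel of the form, so adding multiples of it does not change the
exponent. -/
lemma qexponent_add_nsmul {α β : Fin 3 → ℤ} (hα : ∀ i, 0 ≤ α i) (hβ : ∀ i, 0 ≤ β i) (n : ℕ) :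
    qexponent cartan (α + n • δ) β = -form cartan α β := by
  rw [qexponent, if_pos ⟨add_nsmul_δ_nonneg hα n, hβ⟩, form_cartan, form_cartan]
  simp only [Pi.add_apply, Pi.smul_apply, δ_apply]
  ring

variable {A : Type*} [Ring A] [Algebra ℂ⟦X⟧ A]

/-- As `δ` is even and orthogonal to every root, brackets with imaginary vectors of weight `δ` are
plain commutators. -/
lemma br_add_nsmul_δ {α : Fin 3 → ℤ} (hα : ∀ i, 0 ≤ α i) (n : ℕ) (x y : A) :
    br (α + n • δ) δ x y = x * y - y * x := by
  refine qcomm_of_even_zero (Even.mul_left (by decide) _) ?_ x y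
  rw [qexponent_add_nsmul hα (by decide), form_cartan]
  simp only [δ_apply]
  ring

lemma br_δ_add_nsmul {α : Fin 3 → ℤ} (hα : ∀ i, 0 ≤ α i) (n : ℕ) (x y : A) :
    br δ (α + n • δ) x y = x * y - y * x := by
  refine qcomm_of_even_zero (Even.mul_right (by decide) _) ?_ x y
  rw [qexponent, if_pos ⟨by decide, add_nsmul_δ_nonneg hα n⟩, form_cartan]
  simp only [δ_apply]
  ring

lemma br_α12_δ_sub (n : ℕ) (x y : A) :
    br (α12 + n • δ) (δ - α12) x y = x * y - qz 2 • (y * x) :=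
  qcomm_of_even (Even.mul_left (by decide) _) _
    ((qexponent_add_nsmul (by decide) (by decide) n).trans (by decide)) x y

lemma br_α23_δ_sub (n : ℕ) (x y : A) :
    br (α23 + n • δ) (δ - α23) x y = x * y + y * x := by
  refine qcomm_of_odd_zero (Odd.mul ?_ (by decide))
    ((qexponent_add_nsmul (by decide) (by decide) n).trans (by decide)) x y
  rw [par_parity]
  simp only [Pi.add_apply, Pi.smul_apply, δ_apply]
  exact ⟨n, by simp [α23, sr]; ring⟩

end Loop

lemma two_inv_mul : Loop.two⁻¹ * (qz 1 + qz (-1)) = 1 := by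
  refine PowerSeries.inv_mul_cancel _ ?_
  have h : constantCoeff (qz 1 + qz (-1)) = 2 := by
    rw [← coeff_zero_eq_constantCoeff_apply, map_add, coeff_zero_qz, coeff_zero_qz,
      one_add_one_eq_two]
  rw [Loop.two, h]
  exact two_ne_zero

lemma map_loop_br {A B : Type*} [Ring A] [Algebra ℂ⟦X⟧ A] [Ring B] [Algebra ℂ⟦X⟧ B]
    (φ : A →ₐ[ℂ⟦X⟧] B) (α β : Fin 3 → ℤ) (x y : A) :
    φ (Loop.br α β x y) = Loop.br α β (φ x) (φ y) := map_qcomm φ x y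

/-! ### Images of the root vectors under a Jimbo homomorphism. -/

namespace IsJimbo

open Gl

variable {ε : ULoop →ₐ[ℂ⟦X⟧] UGl}

lemma map_eδ12 (h : IsJimbo ε) : ε Loop.eδ12 = -(F12 * qK 1 1 0) := by
  rw [Loop.eδ12, map_loop_br, h.e2, h.e0, Loop.br, qcomm_of_odd (by decide) (-1) (by decide)]
  exact glOrdering.loop_d12

lemma map_eδ23 (h : IsJimbo ε) : ε Loop.eδ23 =
    qz 1 • (F23 * qK 0 1 (-1) + (qz 1 - qz (-1)) • (E12 * F13 * qK 1 0 (-1))) := by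
  rw [Loop.eδ23, map_loop_br, h.e1, h.e0, Loop.br, qcomm_of_even (by decide) 1 (by decide)]
  exact glOrdering.loop_d23

lemma map_eδ1 (h : IsJimbo ε) : ε Loop.eδ1 =
    qz 2 • (F12 * E12 * qK 1 1 0) - E12 * F12 * qK 1 1 0 := by
  rw [Loop.eδ1, map_loop_br, h.e1, h.map_eδ12, Loop.br, qcomm_of_even (by decide) 2 (by decide)]
  exact glOrdering.loop_im1

lemma map_eδ2 (h : IsJimbo ε) : ε Loop.eδ2 = -(E23 * ε Loop.eδ23 + ε Loop.eδ23 * E23) := by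
  rw [Loop.eδ2, map_neg, map_loop_br, h.e2, Loop.br, qcomm_of_odd_zero (by decide) (by decide)]

lemma commute_eδ1 (h : IsJimbo ε) : Commute (qz 2 • qK 2 0 0) (ε Loop.eδ1) :=
  Commute.smul_left (glOrdering.commute_K_im1 _ h.map_eδ1) _

lemma commute_eδ2 (h : IsJimbo ε) : Commute (qz 2 • qK 2 0 0) (ε Loop.eδ2) := by
  rw [h.map_eδ2]
  exact (Commute.smul_left (glOrdering.commute_K_im2 _ h.map_eδ23) _).neg_right

lemma map_e12 (h : IsJimbo ε) (n : ℕ) : ε (Loop.e12 n) = E12 * (qz 2 • qK 2 0 0) ^ n := by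
  induction n with
  | zero => rw [pow_zero, mul_one]; exact h.e1
  | succ n ih =>
    have h1 := glOrdering.E1_comm_im1 _ h.map_eδ1
    rw [Loop.e12, map_smul, map_loop_br, Loop.br_add_nsmul_δ (by decide), ih, mul_assoc,
      (h.commute_eδ1.pow_left n).eq, ← mul_assoc, ← mul_assoc, ← sub_mul, h1, smul_mul_assoc,
      smul_smul, two_inv_mul, one_smul, pow_succ', ← mul_assoc]

lemma map_d12 (h : IsJimbo ε) (n : ℕ) :
    ε (Loop.d12 n) = (qz 2 • qK 2 0 0) ^ n * -(F12 * qK 1 1 0) := by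
  induction n with
  | zero => rw [pow_zero, one_mul]; exact h.map_eδ12
  | succ n ih =>
    have h1 := glOrdering.im1_comm_d12 _ h.map_eδ1
    rw [Loop.d12, map_smul, map_loop_br, Loop.br_δ_add_nsmul (by decide), ih, ← mul_assoc,
      ← (h.commute_eδ1.pow_left n).eq, mul_assoc, mul_assoc, ← mul_sub, h1, mul_smul_comm,
      smul_smul, two_inv_mul, one_smul, pow_succ, ← mul_assoc]

lemma map_e13 (h : IsJimbo ε) (n : ℕ) : ε (Loop.e13 n) = E13 * (-(qz 2 • qK 2 0 0)) ^ n := by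
  induction n with
  | zero =>
    rw [pow_zero, mul_one, Loop.e13, map_loop_br, h.e1, h.e2, Loop.br,
      qcomm_of_even (by decide) 1 (by decide)]
    rfl
  | succ n ih =>
    have h1 := glOrdering.E3_comm_im2 _ h.map_eδ23
    have h2 : E13 * ε Loop.eδ2 - ε Loop.eδ2 * E13 = E13 * -(qz 2 • qK 2 0 0) := by
      rw [h.map_eδ2, mul_neg, mul_neg, neg_mul, ← h1]
      abel
    rw [Loop.e13, map_loop_br, Loop.br_add_nsmul_δ (by decide), ih, mul_assoc,
      (h.commute_eδ2.neg_left.pow_left n).eq, ← mul_assoc, ← mul_assoc, ← sub_mul, h2, pow_succ',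
      ← mul_assoc]

lemma map_d13 (h : IsJimbo ε) (n : ℕ) :
    ε (Loop.d13 n) = (-(qz 2 • qK 2 0 0)) ^ n * -(F13 * qK 1 0 (-1)) := by
  induction n with
  | zero => rw [pow_zero, one_mul]; exact h.e0
  | succ n ih =>
    have h1 := glOrdering.im2_comm_d13 _ h.map_eδ23
    have h2 : ε Loop.eδ2 * -(F13 * qK 1 0 (-1)) - -(F13 * qK 1 0 (-1)) * ε Loop.eδ2 =
        -(qz 2 • qK 2 0 0) * -(F13 * qK 1 0 (-1)) := by
      rw [h.map_eδ2, neg_mul_neg, neg_mul_neg, neg_mul_neg, ← h1]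
    rw [Loop.d13, map_loop_br, Loop.br_δ_add_nsmul (by decide), ih, ← mul_assoc,
      ← (h.commute_eδ2.neg_left.pow_left n).eq, mul_assoc, mul_assoc, ← mul_sub, h2, pow_succ,
      ← mul_assoc]

lemma map_e23_zero (h : IsJimbo ε) : ε (Loop.e23 0) = E23 := h.e2

/-- The minus sign in the definition reverses the commutator, giving exactly the recursion required
by `CommutatorPair`. -/
lemma map_e23_succ (n : ℕ) : ε (Loop.e23 (n + 1)) =
    ε Loop.eδ1 * ε (Loop.e23 n) - ε (Loop.e23 n) * ε Loop.eδ1 := by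
  rw [Loop.e23, map_neg, map_loop_br, Loop.br_add_nsmul_δ (by decide), neg_sub]

lemma map_d23_succ (n : ℕ) : ε (Loop.d23 (n + 1)) =
    ε (Loop.d23 n) * ε Loop.eδ1 - ε Loop.eδ1 * ε (Loop.d23 n) := by
  rw [Loop.d23, map_neg, map_loop_br, Loop.br_δ_add_nsmul (by decide), neg_sub]

lemma map_im1 (h : IsJimbo ε) (n : ℕ) :
    ε (Loop.im1 (n + 1)) = E12 * (qz 2 • qK 2 0 0) ^ n * -(F12 * qK 1 1 0) -
    qz 2 • (-(F12 * qK 1 1 0) * (E12 * (qz 2 • qK 2 0 0) ^ n)) := by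
  rw [Loop.im1, map_loop_br, Loop.br_α12_δ_sub, h.map_e12, h.map_eδ12]

lemma map_im2 (n : ℕ) : ε (Loop.im2 (n + 1)) =
    -(ε (Loop.e23 n) * ε Loop.eδ23 + ε Loop.eδ23 * ε (Loop.e23 n)) := by
  rw [Loop.im2, map_neg, map_loop_br, Loop.br_α23_δ_sub]

end IsJimbo


/-! ### Sequences generated by a commutator -/

/-- Two sequences `e`, `d` generated from their first members by commutation with `a`, which satisfy
linear recursions with coefficients `D`, `D'`. Here `p` stands for `q ^ 2`. -/
structure CommutatorPair {S A : Type*} [CommRing S] [Ring A] [Algebra S A] (p p' : S)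
    (a D D' N M y : A) (e d : ℕ → A) : Prop where
  p_mul : p * p' = 1
  e_succ (n : ℕ) : e (n + 1) = a * e n - e n * a
  d_succ (n : ℕ) : d (n + 1) = d n * a - a * d n
  e_one : e 1 = e 0 * D + N
  d_one : d 1 = D * d 0 + M
  N_comm : a * N - N * a = -(e 0 * D')
  M_comm : M * a - a * M = -(D' * d 0)
  D_a : Commute D a
  D'_a : Commute D' a
  D_e (n : ℕ) : D * e n = e n * D + (p - 1) • e (n + 1)
  D_d (n : ℕ) : D * d n = d n * D - (p - 1) • d (n + 1)
  D'_e : D' * e 0 = p • (e 0 * D')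
  D'_d : D' * d 0 = p' • (d 0 * D')
  D'_D : Commute D' D
  D_pairing : Commute D (e 0 * d 0 + d 0 * e 0)
  y_eq : d 0 * N + p • (N * d 0) = y
  D_y : Commute D y

namespace CommutatorPair

variable {S A : Type*} [CommRing S] [Ring A] [Algebra S A] {p p' : S}
  {a D D' N M y : A} {e d : ℕ → A}

/-- For the first case, commute `a` with `e 1 = e 0 * D + N`. Later cases follow by applying the
commutator with `a` to the recursion, since `D` and `D'` commute with `a`. -/
lemma e_add_two (h : CommutatorPair p p' a D D' N M y e d) (n : ℕ) :
    e (n + 2) = e (n + 1) * D - e n * D' := by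
  induction n with
  | zero =>
    have h1 : a * (e 0 * D) - e 0 * D * a = e 1 * D := by
      rw [mul_assoc, h.D_a.eq, ← mul_assoc, ← mul_assoc, ← sub_mul, ← h.e_succ]
    rw [h.e_succ 1, zero_add, h.e_one, sub_eq_add_neg _ (e 0 * D'), ← h.N_comm, ← h.e_one, ← h1]
    conv_lhs => rw [h.e_one]
    noncomm_ring
  | succ n ih =>
    have h1 : a * (e (n + 1) * D - e n * D') - (e (n + 1) * D - e n * D') * a =
        (a * e (n + 1) - e (n + 1) * a) * D - (a * e n - e n * a) * D' := by
      simp only [mul_sub, sub_mul, mul_assoc, h.D_a.eq, h.D'_a.eq]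
      abel
    rw [← h.e_succ, ← h.e_succ, ← ih, ← h.e_succ] at h1
    exact h1

lemma d_add_two (h : CommutatorPair p p' a D D' N M y e d) (n : ℕ) :
    d (n + 2) = D * d (n + 1) - D' * d n := by
  induction n with
  | zero =>
    have h1 : D * d 0 * a - a * (D * d 0) = D * d 1 := by
      rw [← mul_assoc a, ← h.D_a.eq, mul_assoc, mul_assoc, ← mul_sub, ← h.d_succ]
    rw [h.d_succ 1, zero_add, h.d_one, sub_eq_add_neg _ (D' * d 0), ← h.M_comm, ← h.d_one, ← h1]
    conv_lhs => rw [h.d_one]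
    noncomm_ring
  | succ n ih =>
    have h1 : (D * d (n + 1) - D' * d n) * a - a * (D * d (n + 1) - D' * d n) =
        D * (d (n + 1) * a - a * d (n + 1)) - D' * (d n * a - a * d n) := by
      simp only [mul_sub, sub_mul, ← mul_assoc, h.D_a.eq, h.D'_a.eq]
      abel
    rw [← h.d_succ, ← h.d_succ, ← ih, ← h.d_succ] at h1
    exact h1

lemma D'_e_mul (h : CommutatorPair p p' a D D' N M y e d) (n : ℕ) :
    D' * e n = p • (e n * D') := by
  induction n with
  | zero => exact h.D'_e
  | succ n ih =>
    rw [h.e_succ, mul_sub, ← mul_assoc, h.D'_a.eq, mul_assoc, ih, ← mul_assoc, ih, sub_mul,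
      smul_sub, smul_mul_assoc, mul_smul_comm, mul_assoc (e n) D' a, h.D'_a.eq]
    simp only [mul_assoc]

/-- `D'` passes `e n` at the cost of `p` and `d 0` at the cost of `p'`, and these scalars are
inverse to each other. -/
lemma D'_pairing (h : CommutatorPair p p' a D D' N M y e d) (n : ℕ) :
    Commute D' (e n * d 0 + d 0 * e n) := by
  have h1 : p' * p = 1 := by rw [mul_comm, h.p_mul]
  change _ * _ = _ * _
  rw [mul_add, add_mul, ← mul_assoc, ← mul_assoc, h.D'_e_mul, h.D'_d, smul_mul_assoc,
    smul_mul_assoc, mul_assoc, mul_assoc, h.D'_d, h.D'_e_mul, mul_smul_comm, mul_smul_comm,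
    smul_smul, smul_smul, h.p_mul, h1, one_smul, one_smul, mul_assoc, mul_assoc]

/-- The elements `e (n + 1) * d 0 + e n * M` commute with `D`. -/
lemma D_source (h : CommutatorPair p p' a D D' N M y e d) (n : ℕ) :
    Commute D (e (n + 1) * d 0 + e n * M) := by
  have hM : M = d 1 - D * d 0 := by rw [h.d_one]; abel
  have h1 : D * M = M * D + (p - 1) • (D' * d 0) := by
    have h2 := h.d_add_two 0
    have h3 := h.D_d 1
    have h4 := h.D_d 0
    have h5 : D * (D * d 0) = D * d 0 * D - (p - 1) • (D * d 1) := by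
      conv_lhs => rw [h4]
      rw [mul_sub, mul_smul_comm, mul_assoc]
    rw [zero_add] at h2
    rw [hM, mul_sub, h3, h5, sub_mul, h2, smul_sub]
    abel
  change _ * _ = _ * _
  have h6 := h.e_add_two n
  calc D * (e (n + 1) * d 0 + e n * M) = (D * e (n + 1)) * d 0 + (D * e n) * M := by
        noncomm_ring
    _ = e (n + 1) * (D * d 0) + (p - 1) • (e (n + 2) * d 0) + e n * (D * M) +
        (p - 1) • (e (n + 1) * M) := by
      rw [h.D_e, h.D_e, add_mul, add_mul, smul_mul_assoc, smul_mul_assoc, mul_assoc, mul_assoc,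
        ← add_assoc]
    _ = _ := by
      -- The terms with factor `p - 1` cancel: `e (n + 2)` is expanded by the recursion, the
      -- contributions of `D'` annihilate each other, and the rest vanishes by `d 1 = D * d 0 + M`.
      rw [h1, h.D_d 0, hM, h6]
      simp only [mul_add, add_mul, mul_sub, sub_mul, smul_sub, smul_add, mul_smul_comm,
        smul_mul_assoc, mul_assoc]
      rw [zero_add]
      abel

lemma pairing_one (h : CommutatorPair p p' a D D' N M y e d) :
    e 1 * d 0 + d 0 * e 1 =
      (e 0 * d 0 + d 0 * e 0) * D - (p - 1) • (e 1 * d 0 + e 0 * M) + y := by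
  have h4 := h.D_d 0
  rw [zero_add, h.d_one] at h4
  have h5 : d 0 * D = D * d 0 + (p - 1) • (D * d 0 + M) := eq_add_of_sub_eq h4.symm
  rw [← h.y_eq, h.e_one]
  simp only [add_mul, mul_add, mul_assoc, h5]
  simp only [mul_add, mul_smul_comm, smul_add]
  module

/-- The recursion for `e` has its coefficients on the right, next to `d 0`. Moving `D` past `d 0` is
what creates the inhomogeneous term; moving `D'` merely supplies the scalar `p`. -/
lemma pairing_add_two (h : CommutatorPair p p' a D D' N M y e d) (n : ℕ) :
    e (n + 2) * d 0 + d 0 * e (n + 2) =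
      (e (n + 1) * d 0 + d 0 * e (n + 1)) * D - (e n * d 0 + d 0 * e n) * D' -
        (p - 1) • (e (n + 2) * d 0 + e (n + 1) * M) := by
  have h4 := h.D_d 0
  rw [zero_add, h.d_one] at h4
  have h5 : d 0 * D = D * d 0 + (p - 1) • (D * d 0 + M) := eq_add_of_sub_eq h4.symm
  have h6 : d 0 * D' = p • (D' * d 0) := by rw [h.D'_d, smul_smul, h.p_mul, one_smul]
  rw [h.e_add_two]
  simp only [add_mul, sub_mul, mul_add, mul_sub, mul_assoc, h5, h6]
  simp only [mul_add, mul_smul_comm, smul_add]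
  module

/-- Induction along the inhomogeneous recursion, whose source terms commute with `D` by `D_source`.
This lets the characteristic polynomial move across the generating function of the pairings. -/
lemma D_pairing_all (h : CommutatorPair p p' a D D' N M y e d) (n : ℕ) :
    Commute D (e n * d 0 + d 0 * e n) := by
  induction n using Nat.twoStepInduction with
  | zero => exact h.D_pairing
  | one =>
    rw [h.pairing_one]
    exact ((h.D_pairing.mul_right (Commute.refl D)).sub_right
      ((h.D_source 0).smul_right _)).add_right h.D_y
  | more n h0 h1 =>
    rw [h.pairing_add_two]
    exact ((h1.mul_right (Commute.refl D)).sub_right (h0.mul_right h.D'_D.symm)).sub_right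
      ((h.D_source (n + 1)).smul_right _)

end CommutatorPair


/-! ### The root vectors attached to `α₂₃` as a commutator pair. -/

namespace GlOrdering

variable {S A : Type*} [CommRing S] [Ring A] [Algebra S A] {Q : ℤ → S}
  {E1 E2 E3 F1 F2 F3 b1 b2 : A} {K : ℤ → ℤ → ℤ → A}

lemma commute_K_e (R : GlOrdering Q E1 E2 E3 F1 F2 F3 b1 b2 K) {a : A} {e : ℕ → A}
    (ha : a = Q 2 • (F1 * E1 * K 1 1 0) - E1 * F1 * K 1 1 0)
    (he0 : e 0 = E2) (he : ∀ n, e (n + 1) = a * e n - e n * a) (n : ℕ) :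
    Commute (K 2 0 0) (e n) := by
  have hKa : Commute (K 2 0 0) a := R.commute_K_im1 a ha
  induction n with
  | zero =>
    rw [he0]
    exact (R.K_E2 2 0 0).trans (by rw [sub_zero, R.Q_zero, one_smul])
  | succ n ih =>
    rw [he]
    exact (hKa.mul_right ih).sub_right (ih.mul_right hKa)

/-- The images of the root vectors `e_{α₂₃ + n δ}` and `e_{(δ - α₂₃) + n δ}`. -/
theorem commutatorPair (R : GlOrdering Q E1 E2 E3 F1 F2 F3 b1 b2 K) {a D N M : A} {e d : ℕ → A}
    (ha : a = Q 2 • (F1 * E1 * K 1 1 0) - E1 * F1 * K 1 1 0)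
    (hD : D = Q 3 • K 0 2 0 + Q 1 • K 2 0 0 +
      ((Q 1 - Q (-1)) ^ 2 * Q 2) • (E1 * F1 * K 1 1 0))
    (hN : N = ((Q 1 - Q (-1)) * Q 2) • (E3 * F1 * K 1 1 0) - Q 1 • (E2 * K 2 0 0))
    (hM : M = -(Q 2 • (K 2 0 0 * F2 * K 0 1 (-1))))
    (he0 : e 0 = E2) (he : ∀ n, e (n + 1) = a * e n - e n * a)
    (hd0 : d 0 = Q 1 • (F2 * K 0 1 (-1) + (Q 1 - Q (-1)) • (E1 * F3 * K 1 0 (-1))))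
    (hd : ∀ n, d (n + 1) = d n * a - a * d n) :
    CommutatorPair (Q 2) (Q (-2)) a D (Q 4 • K 2 2 0) N M (-(Q 4 • (b2 * K 2 1 (-1)))) e d := by
  have hp : (Q 1 - Q (-1)) * Q 1 = Q 2 - 1 := by
    rw [sub_mul, ← R.Q_add, ← R.Q_add, ← R.Q_zero]
    rfl
  -- Because `q ^ (2 K₁)` commutes with all `e n` and `d n`, commuting `D` with them amounts to
  -- commuting `(q² - 1) a`, which is the source of the shifts in `D_e` and `D_d`.
  have hDa : D = (Q 2 - 1) • a + (Q 3 + Q 1) • K 2 0 0 := by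
    rw [← hp, R.im1_eq a D ha hD]
    abel
  have hKa : Commute (K 2 0 0) a := R.commute_K_im1 a ha
  have hK'a : Commute (K 2 2 0) a := R.commute_K_im1' a ha
  have hKe := R.commute_K_e ha he0 he
  have hKd : ∀ n, Commute (K 2 0 0) (d n) := fun n => by
    induction n with
    | zero =>
      have h1 : Commute (K 2 0 0) (K 0 1 (-1)) := by
        change _ * _ = _ * _
        rw [R.K_mul, R.K_mul]
        rfl
      have h2 : Commute (K 2 0 0) (K 1 0 (-1)) := by
        change _ * _ = _ * _
        rw [R.K_mul, R.K_mul]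
        rfl
      have h3 : Commute (K 2 0 0) F2 := (R.K_F2 2 0 0).trans (by rw [sub_zero, R.Q_zero, one_smul])
      have h4 : Commute (K 2 0 0) (E1 * F3) := by
        change _ * _ = _ * _
        rw [← mul_assoc, R.K_E1, smul_mul_assoc, mul_assoc, R.K_F3, mul_smul_comm, smul_smul,
          ← R.Q_add, sub_zero, zero_sub, add_neg_cancel, R.Q_zero, one_smul, mul_assoc]
      rw [hd0]
      exact ((h3.mul_right h1).add_right ((h4.mul_right h2).smul_right _)).smul_right _
    | succ n ih =>
      rw [hd]
      exact (ih.mul_right hKa).sub_right (hKa.mul_right ih)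
  have hDaC : Commute D a := by
    rw [hDa]
    exact ((Commute.refl a).smul_left _).add_left (hKa.smul_left _)
  have hKw : Commute (K 2 0 0) (e 0 * d 0 + d 0 * e 0) :=
    ((hKe 0).mul_right (hKd 0)).add_right ((hKd 0).mul_right (hKe 0))
  refine
    { p_mul := by rw [← R.Q_add, ← R.Q_zero]; rfl
      e_succ := he
      d_succ := hd
      e_one := ?_
      d_one := ?_
      N_comm := ?_
      M_comm := ?_
      D_a := hDaC
      D'_a := hK'a.smul_left _
      D_e := fun n => ?_
      D_d := fun n => ?_
      D'_e := ?_
      D'_d := ?_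
      D'_D := ?_
      D_pairing := ?_
      y_eq := ?_
      D_y := ?_ }
  · rw [he, he0]
    exact R.im1_comm_E2 a D N ha hD hN
  · rw [hd]
    exact R.d23_comm_im1 a (d 0) D M ha hd0 hD hM
  · rw [he0]
    exact R.im1_comm_N a N ha hN
  · exact R.M_comm_im1 a (d 0) M ha hd0 hM
  · rw [hDa, he, add_mul, mul_add, smul_mul_assoc, smul_mul_assoc, mul_smul_comm, mul_smul_comm,
      (hKe n).eq]
    module
  · rw [hDa, hd, add_mul, mul_add, smul_mul_assoc, smul_mul_assoc, mul_smul_comm, mul_smul_comm,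
      (hKd n).eq]
    module
  · rw [he0, smul_mul_assoc, R.K_E2, mul_smul_comm, smul_smul, smul_smul, mul_comm]
    rfl
  · have h1 : K 2 2 0 * d 0 = Q (-2) • (d 0 * K 2 2 0) := by
      have h2 : K 2 2 0 * F2 = Q (-2) • (F2 * K 2 2 0) := R.K_F2 2 2 0
      have h3 : K 2 2 0 * (E1 * F3) = Q (-2) • (E1 * F3 * K 2 2 0) := by
        rw [← mul_assoc, R.K_E1, smul_mul_assoc, mul_assoc, R.K_F3, mul_smul_comm, smul_smul,
          ← R.Q_add, mul_assoc]
        rfl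
      have h4 : ∀ b c, K 2 2 0 * K b c (-1) = K b c (-1) * K 2 2 0 := fun b c => by
        rw [R.K_mul, R.K_mul, add_comm b, add_comm c, add_comm (-1)]
      rw [hd0, mul_smul_comm, mul_add, mul_smul_comm, ← mul_assoc, ← mul_assoc, h2, h3,
        smul_mul_assoc, smul_mul_assoc, mul_assoc, mul_assoc, h4, h4]
      simp only [smul_mul_assoc, add_mul, smul_add, mul_assoc]
      module
    rw [smul_mul_assoc, h1, mul_smul_comm, smul_comm]
  · rw [hDa]
    refine (((hK'a.smul_right _).add_right (Commute.smul_right ?_ _)).smul_left _)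
    change _ * _ = _ * _
    rw [R.K_mul, R.K_mul]
    rfl
  · rw [hDa]
    refine Commute.add_left (Commute.smul_left ?_ _) (hKw.smul_left _)
    rw [he0]
    exact R.im1_comm_im2 a (d 0) ha hd0
  · exact R.d23_comm_N (d 0) N hd0 hN
  · rw [hDa]
    refine ((Commute.add_left (Commute.smul_left ?_ _)
      (Commute.smul_left ?_ _)).smul_right _).neg_right
    · exact R.im1_comm_b2 a ha
    · change _ * _ = _ * _
      rw [← mul_assoc, R.K_b2, mul_assoc, mul_assoc, R.K_mul, R.K_mul]
      rfl

end GlOrdering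


/-! ### Generating functions -/

section Series

variable {A : Type*} [Ring A]

/-- The geometric series `(1 - s X)⁻¹`. -/
def geom (s : A) : A⟦X⟧ := PowerSeries.mk fun n => s ^ n

lemma geom_mul (s : A) : geom s * (1 - PowerSeries.C s * PowerSeries.X) = 1 := by
  rw [mul_sub, mul_one, ← mul_assoc]
  ext n
  cases n with
  | zero => simp [geom]
  | succ n =>
    rw [map_sub, coeff_succ_mul_X, coeff_mul_C, geom, coeff_mk, coeff_mk, pow_succ, sub_self,
      coeff_one, if_neg n.succ_ne_zero]

lemma mul_geom (s : A) : (1 - PowerSeries.C s * PowerSeries.X) * geom s = 1 := by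
  rw [sub_mul, one_mul, mul_assoc, PowerSeries.X_mul, ← mul_assoc]
  ext n
  cases n with
  | zero => simp [geom]
  | succ n =>
    rw [map_sub, coeff_succ_mul_X, coeff_C_mul, geom, coeff_mk, coeff_mk, pow_succ', sub_self,
      coeff_one, if_neg n.succ_ne_zero]

lemma isUnit_linear (s : A) : IsUnit (1 - PowerSeries.C s * PowerSeries.X) :=
  ⟨⟨_, _, mul_geom s, geom_mul s⟩, rfl⟩

lemma C_mul_geom {x s t : A} (h : x * s = t * x) :
    PowerSeries.C x * geom s = geom t * PowerSeries.C x := by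
  ext n
  rw [coeff_C_mul, coeff_mul_C, geom, geom, coeff_mk, coeff_mk]
  exact (show SemiconjBy x s t from h).pow_right n

lemma sub_mul_cancel_right {m g J u x : A} (hx : x * u = u * x) (hJ : J * u = 1) :
    (m + g * J * x) * u = m * u + g * x := by
  rw [add_mul, mul_assoc _ x u, hx, ← mul_assoc, mul_assoc g, hJ, mul_one]

lemma sub_mul_cancel_left {m g J u x : A} (hJ : u * J = 1) :
    u * (m - J * g * x) = u * m - g * x := by
  rw [mul_sub, ← mul_assoc, ← mul_assoc, hJ, one_mul]

lemma C_mul_C_mul_X (a b : A) : PowerSeries.C a * PowerSeries.X *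
    (PowerSeries.C b * PowerSeries.X) = PowerSeries.C (a * b) * PowerSeries.X * PowerSeries.X := by
  rw [← mul_assoc, mul_assoc _ PowerSeries.X, PowerSeries.X_mul, ← mul_assoc, ← map_mul]

lemma linear_mul_C (a b : A) : (1 - PowerSeries.C a * PowerSeries.X) * PowerSeries.C b =
    PowerSeries.C b - PowerSeries.C (a * b) * PowerSeries.X := by
  rw [sub_mul, one_mul, mul_assoc, PowerSeries.X_mul, ← mul_assoc, ← map_mul]

lemma linear_mul_linear (a b : A) :
    (1 - PowerSeries.C a * PowerSeries.X) * (1 - PowerSeries.C b * PowerSeries.X) =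
      1 - PowerSeries.C (a + b) * PowerSeries.X +
        PowerSeries.C (a * b) * PowerSeries.X * PowerSeries.X := by
  rw [sub_mul, mul_sub, mul_sub, C_mul_C_mul_X, map_add]
  noncomm_ring

end Series

/-! ### Generating functions of a commutator pair. -/

namespace CommutatorPair

variable {S A : Type*} [CommRing S] [Ring A] [Algebra S A] {p p' : S}
  {a D D' N M y : A} {e d : ℕ → A}

/-- The characteristic polynomial of the recursions. -/
def charPoly (D D' : A) : A⟦X⟧ := 1 - PowerSeries.C D * PowerSeries.X +
  PowerSeries.C D' * PowerSeries.X * PowerSeries.X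

/-- The recursion annihilates every coefficient from degree two on; the first two are the initial
data. The polynomial stands on the right for `e` and on the left for `d`. -/
lemma mk_e_mul (h : CommutatorPair p p' a D D' N M y e d) :
    PowerSeries.mk e * charPoly D D' = PowerSeries.C (e 0) + PowerSeries.C N * PowerSeries.X := by
  rw [charPoly, mul_add, mul_sub, mul_one, ← mul_assoc, ← mul_assoc, ← mul_assoc]
  ext n
  rcases n with _ | _ | n
  · simp
  · simp [coeff_succ_mul_X, h.e_one, coeff_C]
  · simp [coeff_succ_mul_X, h.e_add_two, coeff_C]

lemma mul_mk_d (h : CommutatorPair p p' a D D' N M y e d) :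
    charPoly D D' * PowerSeries.mk d = PowerSeries.C (d 0) + PowerSeries.C M * PowerSeries.X := by
  rw [charPoly, add_mul, sub_mul, one_mul, mul_assoc _ PowerSeries.X, mul_assoc _ PowerSeries.X,
    mul_assoc _ PowerSeries.X, PowerSeries.X_mul, ← mul_assoc PowerSeries.X, PowerSeries.X_mul,
    ← mul_assoc, ← mul_assoc, ← mul_assoc]
  ext n
  rcases n with _ | _ | n
  · simp
  · simp [coeff_succ_mul_X, h.d_one, coeff_C]
  · simp [coeff_succ_mul_X, h.d_add_two, coeff_C]

lemma commute_charPoly (h : CommutatorPair p p' a D D' N M y e d) {w : ℕ → A}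
    (hw : ∀ n, w n = e n * d 0 + d 0 * e n) :
    Commute (charPoly D D') (PowerSeries.mk w) := by
  have hC : ∀ x, (∀ n, Commute x (w n)) → Commute (PowerSeries.C x) (PowerSeries.mk w) := by
    intro x hx
    ext n
    rw [coeff_C_mul, coeff_mul_C, coeff_mk]
    exact hx n
  have h1 := hC D fun n => hw n ▸ h.D_pairing_all n
  have h2 := hC D' fun n => hw n ▸ h.D'_pairing n
  have hX := (PowerSeries.commute_X (PowerSeries.mk w)).symm
  exact ((Commute.one_left _).sub_left (h1.mul_left hX)).add_left ((h2.mul_left hX).mul_left hX)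

/-- The generating function of the anticommutators of `e n` and `d 0`. -/
lemma pairing_mul (h : CommutatorPair p p' a D D' N M y e d) {w : ℕ → A}
    (hw : ∀ n, w n = e n * d 0 + d 0 * e n) {k q : S} (hk : k * q = p - 1) {s g x : A}
    (h0 : k • (e 0 * d 0 + d 0 * e 0) = D - s - g - x - (k ^ 2 * q) • (e 0 * d 0))
    (hy : k • y = s * g - D') :
    (1 + k • (PowerSeries.mk w * PowerSeries.X)) * charPoly D D' =
      (1 - PowerSeries.C s * PowerSeries.X) * (1 - PowerSeries.C g * PowerSeries.X) -
        PowerSeries.C x * PowerSeries.X - (k ^ 2 * q) • (PowerSeries.mk e *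
          (PowerSeries.C (d 0) + PowerSeries.C M * PowerSeries.X) * PowerSeries.X) := by
  have h1 := h.pairing_one
  have hq : k ^ 2 * q = k * (p - 1) := by rw [sq, mul_assoc, hk]
  have e1 : w 1 = w 0 * D - (p - 1) • (e 1 * d 0 + e 0 * M) + y := by rw [hw, hw, h1]
  have e2 : ∀ n, w (n + 2) = w (n + 1) * D - w n * D' -
      (p - 1) • (e (n + 2) * d 0 + e (n + 1) * M) := fun n => by
    rw [hw, hw, hw, h.pairing_add_two]
  have hL : (1 + k • (PowerSeries.mk w * PowerSeries.X)) * charPoly D D' =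
      charPoly D D' + k • ((PowerSeries.mk w - PowerSeries.mk w * PowerSeries.C D *
        PowerSeries.X + PowerSeries.mk w * PowerSeries.C D' * PowerSeries.X * PowerSeries.X) *
        PowerSeries.X) := by
    rw [add_mul, one_mul, smul_mul_assoc, mul_assoc _ PowerSeries.X, PowerSeries.X_mul,
      ← mul_assoc, charPoly]
    simp only [mul_add, mul_sub, mul_one, ← mul_assoc]
  -- In degree one the identity is `h0`, in degree two it is `pairing_one` with `hy`, and from
  -- degree three on it is `pairing_add_two`.
  rw [hL, linear_mul_linear, charPoly, mul_add, ← mul_assoc]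
  ext n
  rcases n with _ | _ | _ | n
  · simp
  · simp [coeff_succ_mul_X, coeff_C, coeff_one, hw, h0]
    abel
  · simp [coeff_succ_mul_X, coeff_C, coeff_one, e1, hq, smul_sub, smul_add, hy, smul_smul]
    abel
  · simp [coeff_succ_mul_X, coeff_C, coeff_one, e2, hq, smul_sub, smul_add, smul_smul]
    abel

end CommutatorPair


/-! ### Quasi-determinants as power series in a rescaled variable. -/

section QuasiDetSeries

variable {S A : Type*} [CommRing S] [Ring A] [Algebra S A] (Q : ℤ → S)
  (E1 E2 E3 F1 F2 F3 : A) (K : ℤ → ℤ → ℤ → A) (t : S)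

/-- The quasi-determinant `O'₂₂`, as a series in the variable `X`, where `t X = ζ ^ s`. -/
def series22 : A⟦X⟧ := 1 - PowerSeries.C (t • K 0 2 0) * PowerSeries.X -
  PowerSeries.C ((Q 1 - Q (-1)) • E1) * geom (t • K 2 0 0) *
    PowerSeries.C (t • ((Q 1 - Q (-1)) * Q (-1)) • (F1 * K 1 1 0)) * PowerSeries.X

/-- The quasi-determinant `O'₂₃`, up to a power of `ζ`. -/
def series23 : A⟦X⟧ := -PowerSeries.C (((Q 1 - Q (-1)) * Q (-1)) • (F2 * K 0 1 (-1))) -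
  PowerSeries.C ((Q 1 - Q (-1)) • E1) * geom (t • K 2 0 0) *
    PowerSeries.C (((Q 1 - Q (-1)) * Q (-1)) • (F3 * K 1 0 (-1)))

/-- The quasi-determinant `O'₃₂`, up to a power of `ζ`. -/
def series32 : A⟦X⟧ := PowerSeries.C ((Q 1 - Q (-1)) • E2) +
  PowerSeries.C ((Q 1 - Q (-1)) • E3) * geom (t • K 2 0 0) *
    PowerSeries.C (t • ((Q 1 - Q (-1)) * Q (-1)) • (F1 * K 1 1 0)) * PowerSeries.X

/-- The quasi-determinant `O'₃₃`. -/
def series33 : A⟦X⟧ := 1 - PowerSeries.C (t • K 0 0 (-2)) * PowerSeries.X -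
  PowerSeries.C ((Q 1 - Q (-1)) • E3) * geom (t • K 2 0 0) *
    PowerSeries.C (t • ((Q 1 - Q (-1)) * Q (-1)) • (F3 * K 1 0 (-1))) * PowerSeries.X

lemma isUnit_series22 : IsUnit (series22 Q E1 F1 K t) := by
  rw [isUnit_iff_constantCoeff, series22]
  simp

end QuasiDetSeries

namespace GlOrdering

variable {S A : Type*} [CommRing S] [Ring A] [Algebra S A] {Q : ℤ → S}
  {E1 E2 E3 F1 F2 F3 b1 b2 : A} {K : ℤ → ℤ → ℤ → A}

/-- An `x` raising the `K₁`-weight by one turns the ratio `q³ q ^ (2 K₁)` on its right into `q q ^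
(2 K₁)` on its left. This moves the geometric series in the quasi-determinants to an outer position.
-/
lemma commute_smul_K (R : GlOrdering Q E1 E2 E3 F1 F2 F3 b1 b2 K) {x : A} (r : S)
    (h : Q 2 • (x * K 2 0 0) = K 2 0 0 * x) : r • x * Q 3 • K 2 0 0 = Q 1 • K 2 0 0 * r • x := by
  rw [smul_mul_smul_comm, smul_mul_smul_comm, ← h, smul_smul, mul_comm r, mul_assoc, mul_comm r,
    ← mul_assoc, ← R.Q_add]
  rfl

lemma commute_smul_K' (R : GlOrdering Q E1 E2 E3 F1 F2 F3 b1 b2 K) {x : A} (r : S)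
    (h : K 2 0 0 * x = Q (-2) • (x * K 2 0 0)) :
    r • x * Q 1 • K 2 0 0 = Q 3 • K 2 0 0 * r • x := by
  rw [smul_mul_smul_comm, smul_mul_smul_comm, h, smul_smul, mul_comm (Q 3), mul_assoc r,
    ← R.Q_add]
  rfl

section

variable (R : GlOrdering Q E1 E2 E3 F1 F2 F3 b1 b2 K)

lemma K_mul_F1_K (R : GlOrdering Q E1 E2 E3 F1 F2 F3 b1 b2 K) :
    K 2 0 0 * (F1 * K 1 1 0) = Q (-2) • (F1 * K 1 1 0 * K 2 0 0) := by
  rw [← mul_assoc, R.K_F1, smul_mul_assoc, mul_assoc, mul_assoc, R.K_mul, R.K_mul]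
  rfl

/-- At `t = q³` the inner inverse of `O₁₁`, moved left past `E₁` or right past `F₁`, becomes the
inverse of `1 - q q ^ (2 K₁) X` in either case. Clearing this denominator on either side leaves the
same quadratic. -/
lemma series22_mul (R : GlOrdering Q E1 E2 E3 F1 F2 F3 b1 b2 K) {D : A}
    (hD : D = Q 3 • K 0 2 0 + Q 1 • K 2 0 0 +
      ((Q 1 - Q (-1)) ^ 2 * Q 2) • (E1 * F1 * K 1 1 0)) :
    series22 Q E1 F1 K (Q 3) * (1 - PowerSeries.C (Q 1 • K 2 0 0) * PowerSeries.X) =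
      CommutatorPair.charPoly D (Q 4 • K 2 2 0) ∧
    (1 - PowerSeries.C (Q 1 • K 2 0 0) * PowerSeries.X) * series22 Q E1 F1 K (Q 3) =
      CommutatorPair.charPoly D (Q 4 • K 2 2 0) := by
  have hE := C_mul_geom (R.commute_smul_K (x := E1) (Q 1 - Q (-1)) (R.K_E1 2 0 0).symm)
  have hF : PowerSeries.C (Q 3 • ((Q 1 - Q (-1)) * Q (-1)) • (F1 * K 1 1 0)) *
      geom (Q 1 • K 2 0 0) = geom (Q 3 • K 2 0 0) *
      PowerSeries.C (Q 3 • ((Q 1 - Q (-1)) * Q (-1)) • (F1 * K 1 1 0)) := by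
    rw [smul_smul]
    exact C_mul_geom (R.commute_smul_K' _ R.K_mul_F1_K)
  have h3 : Q 3 * Q (-1) = Q 2 := by rw [← R.Q_add]; rfl
  have hg : (Q 1 - Q (-1)) • E1 * (Q 3 • ((Q 1 - Q (-1)) * Q (-1)) • (F1 * K 1 1 0)) =
      ((Q 1 - Q (-1)) ^ 2 * Q 2) • (E1 * F1 * K 1 1 0) := by
    rw [smul_smul, smul_mul_smul_comm, ← h3, mul_assoc E1]
    congr 1
    ring
  have hK : Q 3 • K 0 2 0 * Q 1 • K 2 0 0 = Q 4 • K 2 2 0 := by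
    rw [smul_mul_smul_comm, ← R.Q_add, R.K_mul]
    rfl
  have hK' : Q 1 • K 2 0 0 * Q 3 • K 0 2 0 = Q 4 • K 2 2 0 := by
    rw [smul_mul_smul_comm, ← R.Q_add, R.K_mul]
    rfl
  constructor
  · rw [series22, mul_assoc (PowerSeries.C _), ← hF, ← mul_assoc, ← map_mul, hg, sub_eq_add_neg,
      ← neg_mul, ← neg_mul, sub_mul_cancel_right _ (geom_mul _), linear_mul_linear, hK, hD,
      CommutatorPair.charPoly, map_add, map_add, map_add]
    · noncomm_ring
    · rw [PowerSeries.X_mul]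
  · rw [series22, hE, mul_assoc (geom _), ← map_mul, hg,
      sub_mul_cancel_left (mul_geom _), linear_mul_linear, hK', hD, CommutatorPair.charPoly,
      map_add, map_add, map_add]
    noncomm_ring

lemma series32_mul (R : GlOrdering Q E1 E2 E3 F1 F2 F3 b1 b2 K) {N : A}
    (hN : N = ((Q 1 - Q (-1)) * Q 2) • (E3 * F1 * K 1 1 0) - Q 1 • (E2 * K 2 0 0)) :
    series32 Q E2 E3 F1 K (Q 3) * (1 - PowerSeries.C (Q 1 • K 2 0 0) * PowerSeries.X) =
      (Q 1 - Q (-1)) • (PowerSeries.C E2 + PowerSeries.C N * PowerSeries.X) := by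
  have hF : PowerSeries.C (Q 3 • ((Q 1 - Q (-1)) * Q (-1)) • (F1 * K 1 1 0)) *
      geom (Q 1 • K 2 0 0) = geom (Q 3 • K 2 0 0) *
      PowerSeries.C (Q 3 • ((Q 1 - Q (-1)) * Q (-1)) • (F1 * K 1 1 0)) := by
    rw [smul_smul]
    exact C_mul_geom (R.commute_smul_K' _ R.K_mul_F1_K)
  have h3 : Q 3 * Q (-1) = Q 2 := by rw [← R.Q_add]; rfl
  have hg : (Q 1 - Q (-1)) • E3 * (Q 3 • ((Q 1 - Q (-1)) * Q (-1)) • (F1 * K 1 1 0)) =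
      ((Q 1 - Q (-1)) ^ 2 * Q 2) • (E3 * F1 * K 1 1 0) := by
    rw [smul_smul, smul_mul_smul_comm, ← h3, mul_assoc E3]
    congr 1
    ring
  have hX : PowerSeries.X * (1 - PowerSeries.C (Q 1 • K 2 0 0) * PowerSeries.X) =
      (1 - PowerSeries.C (Q 1 • K 2 0 0) * PowerSeries.X) * PowerSeries.X := PowerSeries.X_mul
  rw [series32, mul_assoc (PowerSeries.C _) (geom _), ← hF, ← mul_assoc, ← map_mul, hg,
    sub_mul_cancel_right hX (geom_mul _), hN]
  ext n
  rcases n with _ | n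
  · simp
  · simp [mul_sub, ← mul_assoc, coeff_succ_mul_X, coeff_C]
    split_ifs <;> simp [smul_sub, smul_smul, sq, mul_assoc]
    module

lemma mul_series23 (R : GlOrdering Q E1 E2 E3 F1 F2 F3 b1 b2 K) {M d : A}
    (hM : M = -(Q 2 • (K 2 0 0 * F2 * K 0 1 (-1))))
    (hd : d = Q 1 • (F2 * K 0 1 (-1) + (Q 1 - Q (-1)) • (E1 * F3 * K 1 0 (-1)))) :
    (1 - PowerSeries.C (Q 1 • K 2 0 0) * PowerSeries.X) * -(Q 2 • series23 Q E1 F2 F3 K (Q 3)) =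
      (Q 1 - Q (-1)) • (PowerSeries.C d + PowerSeries.C M * PowerSeries.X) := by
  have hE := C_mul_geom (R.commute_smul_K (x := E1) (Q 1 - Q (-1)) (R.K_E1 2 0 0).symm)
  have h1 : Q 2 * Q (-1) = Q 1 := by rw [← R.Q_add]; rfl
  have h2 : Q 1 * Q 1 = Q 2 := by rw [← R.Q_add]; rfl
  have h3 := sub_mul_cancel_left
    (m := -PowerSeries.C (((Q 1 - Q (-1)) * Q (-1)) • (F2 * K 0 1 (-1))))
    (g := PowerSeries.C ((Q 1 - Q (-1)) • E1 *
      (((Q 1 - Q (-1)) * Q (-1)) • (F3 * K 1 0 (-1))))) (x := 1) (mul_geom (Q 1 • K 2 0 0))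
  rw [series23, hE, mul_assoc (geom _), ← map_mul, mul_neg, mul_smul_comm]
  rw [mul_one, mul_one] at h3
  rw [h3, hM, hd, mul_neg, linear_mul_C]
  ext n
  rcases n with _ | n
  · simp [← h1, mul_assoc]
    module
  · simp [coeff_succ_mul_X, coeff_C]
    split_ifs with hn
    · simp only [smul_smul, mul_assoc, add_zero, neg_zero, smul_neg, neg_neg, smul_sub]
      match_scalars
      grind
    · simp

lemma mul_series33 (R : GlOrdering Q E1 E2 E3 F1 F2 F3 b1 b2 K) :
    (1 - PowerSeries.C (Q 1 • K 2 0 0) * PowerSeries.X) * series33 Q E3 F3 K (Q 3) =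
      (1 - PowerSeries.C (Q 1 • K 2 0 0) * PowerSeries.X) *
        (1 - PowerSeries.C (Q 3 • K 0 0 (-2)) * PowerSeries.X) -
      PowerSeries.C (((Q 1 - Q (-1)) ^ 2 * Q 2) • (E3 * F3 * K 1 0 (-1))) * PowerSeries.X := by
  have hE := C_mul_geom (R.commute_smul_K (x := E3) (Q 1 - Q (-1)) (R.K_E3 2 0 0).symm)
  have h3 : Q 3 * Q (-1) = Q 2 := by rw [← R.Q_add]; rfl
  have hg : (Q 1 - Q (-1)) • E3 * (Q 3 • ((Q 1 - Q (-1)) * Q (-1)) • (F3 * K 1 0 (-1))) =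
      ((Q 1 - Q (-1)) ^ 2 * Q 2) • (E3 * F3 * K 1 0 (-1)) := by
    rw [smul_smul, smul_mul_smul_comm, ← h3, mul_assoc E3]
    congr 1
    ring
  rw [series33, hE, mul_assoc (geom _), ← map_mul, hg,
    sub_mul_cancel_left (mul_geom _)]

end

end GlOrdering


/-! ### The generating functions for `α₂₃` and for the imaginary roots at `α₂`. -/

namespace GlOrdering

variable {S A : Type*} [CommRing S] [Ring A] [Algebra S A] {Q : ℤ → S}
  {E1 E2 E3 F1 F2 F3 b1 b2 : A} {K : ℤ → ℤ → ℤ → A}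

/-- The generating functions of the root vectors `e_{α₂₃ + n δ}`, `e_{(δ - α₂₃) + n δ}` and
`e'_{n δ, α₂}` in terms of quasi-determinants. -/
theorem series_eq_quasiDet (R : GlOrdering Q E1 E2 E3 F1 F2 F3 b1 b2 K) {a : A} {e d w : ℕ → A}
    (ha : a = Q 2 • (F1 * E1 * K 1 1 0) - E1 * F1 * K 1 1 0)
    (he0 : e 0 = E2) (he : ∀ n, e (n + 1) = a * e n - e n * a)
    (hd0 : d 0 = Q 1 • (F2 * K 0 1 (-1) + (Q 1 - Q (-1)) • (E1 * F3 * K 1 0 (-1))))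
    (hd : ∀ n, d (n + 1) = d n * a - a * d n)
    (hw : ∀ n, w n = e n * d 0 + d 0 * e n) :
    ((Q 1 - Q (-1)) • PowerSeries.mk e) * series22 Q E1 F1 K (Q 3) =
      series32 Q E2 E3 F1 K (Q 3) ∧
    series22 Q E1 F1 K (Q 3) * ((Q 1 - Q (-1)) • PowerSeries.mk d) =
      -(Q 2 • series23 Q E1 F2 F3 K (Q 3)) ∧
    series22 Q E1 F1 K (Q 3) * (1 + (Q 1 - Q (-1)) • (PowerSeries.mk w * PowerSeries.X)) =
      series33 Q E3 F3 K (Q 3) + Q 3 • (((Q 1 - Q (-1)) • PowerSeries.mk e) *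
        series23 Q E1 F2 F3 K (Q 3) * PowerSeries.X) := by
  obtain ⟨D, hD⟩ : ∃ D, D = Q 3 • K 0 2 0 + Q 1 • K 2 0 0 +
      ((Q 1 - Q (-1)) ^ 2 * Q 2) • (E1 * F1 * K 1 1 0) := ⟨_, rfl⟩
  obtain ⟨N, hN⟩ : ∃ N, N = ((Q 1 - Q (-1)) * Q 2) • (E3 * F1 * K 1 1 0) -
      Q 1 • (E2 * K 2 0 0) := ⟨_, rfl⟩
  obtain ⟨M, hM⟩ : ∃ M, M = -(Q 2 • (K 2 0 0 * F2 * K 0 1 (-1))) := ⟨_, rfl⟩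
  have h := R.commutatorPair ha hD hN hM he0 he hd0 hd
  obtain ⟨h22r, h22l⟩ := R.series22_mul hD
  have h32 := R.series32_mul hN
  have h23 := R.mul_series23 hM hd0
  have h33 := R.mul_series33
  have hp : (Q 1 - Q (-1)) * Q 1 = Q 2 - 1 := by
    rw [sub_mul, ← R.Q_add, ← R.Q_add, ← R.Q_zero]
    rfl
  have h0 := R.im2_eq (d 0) D hd0 hD
  rw [← he0] at h0
  have hy : (Q 1 - Q (-1)) • -(Q 4 • (b2 * K 2 1 (-1))) =
      Q 1 • K 2 0 0 * Q 3 • K 0 0 (-2) - Q 4 • K 2 2 0 := by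
    rw [smul_neg, smul_comm, ← smul_mul_assoc, R.kappa_b2, sub_mul, R.K_mul, R.K_mul,
      smul_mul_smul_comm, ← R.Q_add, R.K_mul, smul_sub, neg_sub]
    rfl
  have hsum := h.pairing_mul hw hp h0 hy
  -- Here the characteristic polynomial is moved from the right of the pairing series to its left,
  -- where `O'₂₂` stands in the claim.
  rw [← (Commute.add_right (Commute.one_right _) (Commute.smul_right
    ((h.commute_charPoly hw).mul_right (PowerSeries.commute_X _)) _)).eq] at hsum
  -- `E₂` and `a` commute with `q ^ (2 K₁)`, hence so do all `e n`. The linear factor thus passes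
  -- `e` and clears the denominator of `series23`.
  have hue : (1 - PowerSeries.C (Q 1 • K 2 0 0) * PowerSeries.X) * PowerSeries.mk e =
      PowerSeries.mk e * (1 - PowerSeries.C (Q 1 • K 2 0 0) * PowerSeries.X) := by
    refine Commute.sub_left (Commute.one_left _) (Commute.mul_left ?_
      (PowerSeries.commute_X _).symm)
    ext n
    rw [coeff_C_mul, coeff_mul_C, coeff_mk, smul_mul_assoc, mul_smul_comm,
      (R.commute_K_e ha he0 he n).eq]
  refine ⟨?_, ?_, ?_⟩
  · refine (isUnit_linear (Q 1 • K 2 0 0)).mul_right_cancel ?_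
    rw [h32, mul_assoc, h22r, smul_mul_assoc, h.mk_e_mul, he0]
  · refine (isUnit_linear (Q 1 • K 2 0 0)).mul_left_cancel ?_
    rw [h23, ← mul_assoc, h22l, mul_smul_comm, h.mul_mk_d]
  · refine (isUnit_linear (Q 1 • K 2 0 0)).mul_left_cancel ?_
    have h3 : Q 3 = Q 1 * Q 2 := by rw [← R.Q_add]; rfl
    have h4 : Q 3 • ((1 - PowerSeries.C (Q 1 • K 2 0 0) * PowerSeries.X) *
        (((Q 1 - Q (-1)) • PowerSeries.mk e) * series23 Q E1 F2 F3 K (Q 3) * PowerSeries.X)) =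
        -(((Q 1 - Q (-1)) ^ 2 * Q 1) • (PowerSeries.mk e *
          (PowerSeries.C (d 0) + PowerSeries.C M * PowerSeries.X) * PowerSeries.X)) := by
      have h5 : ∀ y : A⟦X⟧, ((Q 1 - Q (-1)) ^ 2 * Q 1) • (PowerSeries.mk e * y * PowerSeries.X) =
          ((Q 1 - Q (-1)) * Q 1) • (PowerSeries.mk e * ((Q 1 - Q (-1)) • y) * PowerSeries.X) := by
        intro y
        rw [mul_smul_comm, smul_mul_assoc, smul_smul]
        congr 1
        ring
      rw [h5, ← h23, smul_mul_assoc, smul_mul_assoc, mul_smul_comm, ← mul_assoc, ← mul_assoc, hue,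
        mul_assoc (PowerSeries.mk e), mul_neg, mul_smul_comm, mul_neg, neg_mul, smul_neg, neg_neg,
        mul_smul_comm, smul_mul_assoc, smul_smul, smul_smul, h3]
      congr 1
      ring
    rw [← mul_assoc, h22l, hsum, mul_add (1 - _), h33, mul_smul_comm, h4, ← sub_eq_add_neg]

end GlOrdering


/-! ### The generating function for the imaginary roots at `α₁`. -/

namespace GlOrdering

variable {S A : Type*} [CommRing S] [Ring A] [Algebra S A] {Q : ℤ → S}
  {E1 E2 E3 F1 F2 F3 b1 b2 : A} {K : ℤ → ℤ → ℤ → A}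

/-- The generating function of the root vectors `e'_{n δ, α₁}`. -/
theorem series11_mul (R : GlOrdering Q E1 E2 E3 F1 F2 F3 b1 b2 K) {v : ℕ → A}
    (hv : ∀ n, v n = E1 * (Q 2 • K 2 0 0) ^ n * -(F1 * K 1 1 0) -
      Q 2 • (-(F1 * K 1 1 0) * (E1 * (Q 2 • K 2 0 0) ^ n))) :
    (1 - PowerSeries.C (Q 2 • K 2 0 0) * PowerSeries.X) *
      (1 - (Q 1 - Q (-1)) • (PowerSeries.mk v * PowerSeries.X)) =
      series22 Q E1 F1 K (Q 2) := by
  have h1 : Q 2 * Q (-1) = Q 1 := by rw [← R.Q_add]; rfl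
  have h2 : Q 1 * Q 1 = Q 2 := by rw [← R.Q_add]; rfl
  have h3 : Q (-1) * Q 3 = Q 2 := by rw [← R.Q_add]; rfl
  have hq := R.Q_mul_neg
  have hv0 : (Q 1 - Q (-1)) • v 0 = Q 2 • K 0 2 0 - Q 2 • K 2 0 0 +
      ((Q 1 - Q (-1)) ^ 2 * Q 1) • (E1 * F1 * K 1 1 0) := by
    have h4 := congrArg (Q (-1) • ·) (R.im1_eq _ _ rfl rfl)
    rw [hv, pow_zero, mul_one, R.loop_im1]
    simp only [smul_smul] at h4
    rw [show Q (-1) * ((Q 1 - Q (-1)) * Q 1) = Q 1 - Q (-1) by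
      rw [mul_comm, mul_assoc, hq, mul_one]] at h4
    rw [h4]
    match_scalars <;> grind
  -- Multiplication by the ratio on the left carries the `F E` part of `v n` exactly to the next
  -- one, the weights of `F` and `E` cancelling. Only the `E F` part leaves a remainder, which
  -- supplies the geometric series in `O'₂₂`.
  have hvn : ∀ n, Q 2 • K 2 0 0 * v n = v (n + 1) -
      ((Q 1 - Q (-1)) * Q 1) • (E1 * (Q 2 • K 2 0 0) ^ (n + 1) * (F1 * K 1 1 0)) := by
    intro n
    have h5 : Q 2 • K 2 0 0 * E1 = Q 2 • (E1 * Q 2 • K 2 0 0) := by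
      rw [smul_mul_assoc, R.K_E1, mul_smul_comm]
      rfl
    have h6 : Q 2 • K 2 0 0 * (F1 * K 1 1 0) = Q (-2) • (F1 * K 1 1 0 * Q 2 • K 2 0 0) := by
      rw [smul_mul_assoc, R.K_mul_F1_K, mul_smul_comm, smul_comm]
    have h7 : Q 2 * Q (-2) = 1 := by rw [← R.Q_add, ← R.Q_zero]; rfl
    rw [hv, hv]
    obtain ⟨T, hT⟩ : ∃ T, T = Q 2 • K 2 0 0 := ⟨_, rfl⟩
    obtain ⟨f, hf⟩ : ∃ f, f = F1 * K 1 1 0 := ⟨_, rfl⟩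
    rw [← hT] at h5 h6 ⊢
    rw [← hf] at h6 ⊢
    have h8 : T * (E1 * T ^ n * f) = Q 2 • (E1 * T ^ (n + 1) * f) := by
      rw [← mul_assoc, ← mul_assoc, h5, smul_mul_assoc, smul_mul_assoc, pow_succ', mul_assoc E1,
        mul_assoc E1]
    have h9 : T * (f * (E1 * T ^ n)) = f * (E1 * T ^ (n + 1)) := by
      rw [← mul_assoc, h6, smul_mul_assoc, mul_assoc, ← mul_assoc T, h5, smul_mul_assoc,
        mul_smul_comm, smul_smul, mul_comm, h7, one_smul, pow_succ', mul_assoc E1]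
    simp only [mul_sub, mul_neg, neg_mul, mul_smul_comm, h8, h9]
    match_scalars <;> grind
  rw [series22, mul_sub, mul_one, sub_mul, one_mul, mul_smul_comm, ← mul_assoc,
    mul_assoc _ PowerSeries.X, PowerSeries.X_mul, ← mul_assoc]
  ext n
  rcases n with _ | _ | n
  · simp
  · simp [coeff_succ_mul_X, coeff_C, coeff_one, hv0, geom]
    simp only [smul_smul, mul_assoc]
    match_scalars <;> grind
  · have h4 := hvn n
    simp [coeff_succ_mul_X, coeff_C, coeff_one, geom] at h4 ⊢
    rw [h4]
    simp only [smul_smul, mul_assoc, smul_sub, smul_mul_assoc, mul_smul_comm]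
    match_scalars <;> grind

end GlOrdering


/-! ### The substitution in Laurent polynomials -/

section Substitution

variable (S : ℤ) (c : ℂ⟦X⟧ˣ)

lemma zetaSubst_add (p p' : LaurentPolynomial UGl) :
    zetaSubst S c (p + p') = zetaSubst S c p + zetaSubst S c p' := by
  rw [zetaSubst, AddMonoidAlgebra.coeff_add, Finsupp.sum_add_index']
  · rfl
  · intro n
    rw [smul_zero, map_zero]
  · intro n a a'
    rw [smul_add]
    exact (HahnSeries.single.addMonoidHom _).map_add _ _

lemma zetaSubst_neg (p : LaurentPolynomial UGl) : zetaSubst S c (-p) = -zetaSubst S c p := by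
  have h : zetaSubst S c 0 = 0 := by
    rw [zetaSubst, AddMonoidAlgebra.coeff_zero, Finsupp.sum_zero_index]
  rw [eq_neg_iff_add_eq_zero, ← zetaSubst_add, neg_add_cancel, h]

lemma zetaSubst_monoU (a : UGl) (m : ℤ) : zetaSubst S c (monoU a m) =
    HahnSeries.single ((m : ℚ) / (S : ℚ)) (((c ^ m : ℂ⟦X⟧ˣ) : ℂ⟦X⟧) • a) := by
  rw [monoU, ← LaurentPolynomial.single_eq_C_mul_T, zetaSubst, AddMonoidAlgebra.coeff_single,
    Finsupp.sum_single_index]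
  rw [smul_zero, map_zero]

lemma zetaSubst_one : zetaSubst S c 1 = 1 := by
  have h : (1 : LaurentPolynomial UGl) = monoU 1 0 := by
    rw [monoU, map_one, LaurentPolynomial.T_zero, mul_one]
  rw [h, zetaSubst_monoU, zpow_zero, Units.val_one, one_smul, Int.cast_zero, zero_div]
  rfl

/-- The image of `ζ ^ m`. -/
def zetaPow (m : ℤ) : HahnSeries ℚ UGl :=
  HahnSeries.single ((m : ℚ) / (S : ℚ)) (algebraMap ℂ⟦X⟧ UGl (c ^ m : ℂ⟦X⟧ˣ))

lemma zetaPow_mul (m n : ℤ) : zetaPow S c m * zetaPow S c n = zetaPow S c (m + n) := by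
  rw [zetaPow, zetaPow, zetaPow, HahnSeries.single_mul_single, ← map_mul, zpow_add, Units.val_mul,
    Int.cast_add, add_div]

lemma zetaPow_zero : zetaPow S c 0 = 1 := by
  rw [zetaPow, zpow_zero, Units.val_one, map_one, Int.cast_zero, zero_div]
  rfl

/-- The powers of `ζ` are central, so they can be collected. Products are formed after the
substitution, so `zetaSubst` is only needed on sums and monomials. -/
lemma zetaPow_comm (m : ℤ) (x : HahnSeries ℚ UGl) : x * zetaPow S c m = zetaPow S c m * x := by
  ext i
  have h : i = (i - (m : ℚ) / S) + (m : ℚ) / S := by rw [sub_add_cancel]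
  rw [h, zetaPow, HahnSeries.coeff_mul_single_add, HahnSeries.coeff_single_mul_add]
  exact (Algebra.commutes _ _).symm

lemma zetaPow_mul_mul (m n : ℤ) (a g b : HahnSeries ℚ UGl) :
    zetaPow S c m * a * g * (zetaPow S c n * b) = zetaPow S c (m + n) * (a * g * b) := by
  rw [← mul_assoc, zetaPow_comm, add_comm, ← zetaPow_mul]
  simp only [mul_assoc]

lemma toHahn_C (a : UGl) : toHahn (PowerSeries.C a) = HahnSeries.single 0 a :=
  HahnSeries.ofPowerSeries_C a

lemma toHahn_mul (x y : PowerSeries UGl) : toHahn (x * y) = toHahn x * toHahn y := map_mul _ _ _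
lemma toHahn_add (x y : PowerSeries UGl) : toHahn (x + y) = toHahn x + toHahn y := map_add _ _ _
lemma toHahn_sub (x y : PowerSeries UGl) : toHahn (x - y) = toHahn x - toHahn y := map_sub _ _ _
lemma toHahn_neg (x : PowerSeries UGl) : toHahn (-x) = -toHahn x := map_neg _ _
lemma toHahn_one : toHahn 1 = 1 := map_one _

lemma zetaSubst_monoU_eq (a : UGl) (m : ℤ) :
    zetaSubst S c (monoU a m) = zetaPow S c m * toHahn (PowerSeries.C a) := by
  rw [zetaSubst_monoU, toHahn_C, zetaPow, HahnSeries.single_mul_single, add_zero,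
    Algebra.smul_def]

lemma zetaSubst_mono (r : ℂ⟦X⟧) (m : ℤ) : zetaSubst S c (mono r m) =
    zetaPow S c m * toHahn (PowerSeries.C (algebraMap ℂ⟦X⟧ UGl r)) :=
  zetaSubst_monoU_eq S c _ m

/-- The fractional exponent becomes one here, whatever the sign of `S`; this carries the
quasi-determinants whose powers of `ζ` add up to `S` back into ordinary power series. -/
lemma zetaPow_self {t : ℂ⟦X⟧} (hS : S ≠ 0) (hc : ((c ^ S : ℂ⟦X⟧ˣ) : ℂ⟦X⟧) = t) :
    zetaPow S c S = toHahn (PowerSeries.C (algebraMap ℂ⟦X⟧ UGl t) * PowerSeries.X) := by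
  rw [toHahn_mul, toHahn_C, toHahn, HahnSeries.ofPowerSeries_X, HahnSeries.single_mul_single,
    zero_add, mul_one, zetaPow, hc, div_self (Int.cast_ne_zero.2 hS)]

lemma toHahn_C_smul_mul_X {t : ℂ⟦X⟧} (hS : S ≠ 0) (hc : ((c ^ S : ℂ⟦X⟧ˣ) : ℂ⟦X⟧) = t) (a : UGl) :
    toHahn (PowerSeries.C (t • a) * PowerSeries.X) =
      zetaPow S c S * toHahn (PowerSeries.C a) := by
  rw [← zetaPow_comm, zetaPow_self S c hS hc, ← toHahn_mul, ← mul_assoc, ← map_mul,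
    ← Algebra.commutes, ← Algebra.smul_def]

end Substitution

lemma inverse_eq {R : Type*} [Ring R] {a b : R} (h : a * b = 1) (h' : b * a = 1) :
    Ring.inverse a = b :=
  Ring.inverse_unit (⟨a, b, h, h'⟩ : Rˣ)

/-! ### The operator `O(ζ)` after the substitution -/

section QuasiDet

variable {R : Type*} [Ring R] {A : Matrix (Fin 3) (Fin 3) R} {i a b x y z : R}

lemma qd22_eq (hi : Ring.inverse (A 0 0) = i) (hx : A 1 1 = x) (ha : A 1 0 = -a)
    (hb : A 0 1 = -b) : qd22 A = x - a * i * b := by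
  rw [qd22, hi, hx, ha, hb, neg_mul, neg_mul_neg]

lemma qd23_eq (hi : Ring.inverse (A 0 0) = i) (hx : A 1 2 = -x) (ha : A 1 0 = -a)
    (hb : A 0 2 = -b) : qd23 A = -x - a * i * b := by
  rw [qd23, hi, hx, ha, hb, neg_mul, neg_mul_neg]

lemma qd32_eq (hi : Ring.inverse (A 0 0) = i) (hx : A 2 1 = x) (ha : A 2 0 = a)
    (hb : A 0 1 = -b) : qd32 A = x + a * i * b := by
  rw [qd32, hi, hx, ha, hb, mul_neg, sub_neg_eq_add]

lemma qd33_eq (hi : Ring.inverse (A 0 0) = i) (hx : A 2 2 = x) (ha : A 2 0 = a)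
    (hb : A 0 2 = -b) : qd33 A = x - a * i * b := by
  rw [qd33, hi, hx, ha, hb, mul_neg, ← sub_eq_add_neg]

lemma neg_mul_sub_mul (x y z : R) : -(z * x) - z * y = z * (-x - y) := by
  rw [mul_sub, mul_neg]

end QuasiDet

section Operator

open Gl

variable {s : Fin 3 → ℤ} {S : ℤ} (c : ℂ⟦X⟧ˣ)

lemma Osub_01 (hs : S = s 0 + s 1 + s 2) :
    Osub s c 0 1 = -(zetaPow S c (S - s 1) *
    toHahn (PowerSeries.C ((kappa * qz (-1)) • (F12 * qK 1 1 0)))) := by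
  subst hs
  rw [← zetaSubst_monoU_eq, ← zetaSubst_neg]
  rfl

lemma Osub_02 (hs : S = s 0 + s 1 + s 2) :
    Osub s c 0 2 = -(zetaPow S c (S - (s 1 + s 2)) *
    toHahn (PowerSeries.C ((kappa * qz (-1)) • (F13 * qK 1 0 (-1))))) := by
  subst hs
  rw [← zetaSubst_monoU_eq, ← zetaSubst_neg]
  rfl

lemma Osub_12 (hs : S = s 0 + s 1 + s 2) :
    Osub s c 1 2 = -(zetaPow S c (S - s 2) *
    toHahn (PowerSeries.C ((kappa * qz (-1)) • (F23 * qK 0 1 (-1))))) := by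
  subst hs
  rw [← zetaSubst_monoU_eq, ← zetaSubst_neg]
  rfl

lemma Osub_10 (hs : S = s 0 + s 1 + s 2) :
    Osub s c 1 0 =
    -(zetaPow S c (s 1) * toHahn (PowerSeries.C (kappa • E12))) := by
  subst hs
  rw [← zetaSubst_monoU_eq, ← zetaSubst_neg]
  rfl

lemma Osub_20 (hs : S = s 0 + s 1 + s 2) :
    Osub s c 2 0 =
    zetaPow S c (s 1 + s 2) * toHahn (PowerSeries.C (kappa • E13)) := by
  subst hs
  rw [← zetaSubst_monoU_eq]
  rfl

lemma Osub_21 (hs : S = s 0 + s 1 + s 2) :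
    Osub s c 2 1 =
    zetaPow S c (s 2) * toHahn (PowerSeries.C (kappa • E23)) := by
  subst hs
  rw [← zetaSubst_monoU_eq]
  rfl

lemma zetaSubst_one_sub (a : UGl) {t : ℂ⟦X⟧} (hS : S ≠ 0)
    (hc : ((c ^ S : ℂ⟦X⟧ˣ) : ℂ⟦X⟧) = t) : zetaSubst S c (1 - monoU a S) =
      toHahn (1 - PowerSeries.C (t • a) * PowerSeries.X) := by
  rw [sub_eq_add_neg, zetaSubst_add, zetaSubst_neg, zetaSubst_one, zetaSubst_monoU_eq, toHahn_sub,
    toHahn_one, toHahn_C_smul_mul_X S c hS hc, ← sub_eq_add_neg]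

variable {t : ℂ⟦X⟧}

lemma Osub_00 (hs : S = s 0 + s 1 + s 2) (hS : S ≠ 0)
    (hc : ((c ^ S : ℂ⟦X⟧ˣ) : ℂ⟦X⟧) = t) :
    Osub s c 0 0 =
    toHahn (1 - PowerSeries.C (t • qK 2 0 0) * PowerSeries.X) := by
  rw [← zetaSubst_one_sub c _ hS hc]
  subst hs
  rfl

lemma Osub_11 (hs : S = s 0 + s 1 + s 2) (hS : S ≠ 0)
    (hc : ((c ^ S : ℂ⟦X⟧ˣ) : ℂ⟦X⟧) = t) :
    Osub s c 1 1 =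
    toHahn (1 - PowerSeries.C (t • qK 0 2 0) * PowerSeries.X) := by
  rw [← zetaSubst_one_sub c _ hS hc]
  subst hs
  rfl

lemma Osub_22 (hs : S = s 0 + s 1 + s 2) (hS : S ≠ 0)
    (hc : ((c ^ S : ℂ⟦X⟧ˣ) : ℂ⟦X⟧) = t) :
    Osub s c 2 2 =
    toHahn (1 - PowerSeries.C (t • qK 0 0 (-2)) * PowerSeries.X) := by
  rw [← zetaSubst_one_sub c _ hS hc]
  subst hs
  rfl

lemma isUnit_Osub_00 (hs : S = s 0 + s 1 + s 2) (hS : S ≠ 0)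
    (hc : ((c ^ S : ℂ⟦X⟧ˣ) : ℂ⟦X⟧) = t) :
    IsUnit (Osub s c 0 0) := by
  rw [Osub_00 c hs hS hc]
  exact (isUnit_linear _).map (HahnSeries.ofPowerSeries ℚ UGl)

lemma inverse_Osub_00 (hs : S = s 0 + s 1 + s 2) (hS : S ≠ 0)
    (hc : ((c ^ S : ℂ⟦X⟧ˣ) : ℂ⟦X⟧) = t) :
    Ring.inverse (Osub s c 0 0) = toHahn (geom (t • qK 2 0 0)) := by
  rw [Osub_00 c hs hS hc]
  apply inverse_eq
  · rw [← toHahn_mul, mul_geom, toHahn_one]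
  · rw [← toHahn_mul, geom_mul, toHahn_one]

lemma qd22_Osub (hs : S = s 0 + s 1 + s 2) (hS : S ≠ 0)
    (hc : ((c ^ S : ℂ⟦X⟧ˣ) : ℂ⟦X⟧) = t) :
    qd22 (Osub s c) = toHahn (series22 qz E12 F12 qK t) := by
  refine (qd22_eq (inverse_Osub_00 c hs hS hc) (Osub_11 c hs hS hc) (Osub_10 c hs)
    (Osub_01 c hs)).trans ?_
  refine Eq.trans (congrArg₂ (· - ·) rfl ?_) (toHahn_sub _ _).symm
  rw [zetaPow_mul_mul, add_sub_cancel, mul_assoc _ (PowerSeries.C _) PowerSeries.X,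
    toHahn_mul (_ * geom _),
    toHahn_C_smul_mul_X S c hS hc, ← mul_assoc _ (zetaPow S c S), zetaPow_comm, toHahn_mul,
    mul_assoc (zetaPow _ _ _)]
  rfl

lemma qd23_Osub (hs : S = s 0 + s 1 + s 2) (hS : S ≠ 0)
    (hc : ((c ^ S : ℂ⟦X⟧ˣ) : ℂ⟦X⟧) = t) :
    qd23 (Osub s c) = zetaPow S c (S - s 2) * toHahn (series23 qz E12 F23 F13 qK t) := by
  refine (qd23_eq (inverse_Osub_00 c hs hS hc) (Osub_12 c hs) (Osub_10 c hs)
    (Osub_02 c hs)).trans ?_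
  have h : s 1 + (S - (s 1 + s 2)) = S - s 2 := by ring
  rw [zetaPow_mul_mul, h]
  refine (neg_mul_sub_mul _ _ _).trans (congrArg _ ?_)
  refine Eq.trans (congrArg₂ (· - ·) (toHahn_neg _).symm ?_) (toHahn_sub _ _).symm
  rw [toHahn_mul, toHahn_mul]
  rfl

lemma qd32_Osub (hs : S = s 0 + s 1 + s 2) (hS : S ≠ 0)
    (hc : ((c ^ S : ℂ⟦X⟧ˣ) : ℂ⟦X⟧) = t) :
    qd32 (Osub s c) = zetaPow S c (s 2) * toHahn (series32 qz E23 E13 F12 qK t) := by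
  refine (qd32_eq (inverse_Osub_00 c hs hS hc) (Osub_21 c hs) (Osub_20 c hs)
    (Osub_01 c hs)).trans ?_
  have h : s 1 + s 2 + (S - s 1) = s 2 + S := by ring
  rw [series32, zetaPow_mul_mul, h, ← zetaPow_mul, mul_assoc (zetaPow S c (s 2)), ← mul_add,
    toHahn_add, mul_assoc _ (PowerSeries.C _) PowerSeries.X, toHahn_mul (_ * geom _),
    toHahn_C_smul_mul_X S c hS hc, ← mul_assoc _ (zetaPow S c S), zetaPow_comm, toHahn_mul,
    mul_assoc (zetaPow _ _ _)]
  rfl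

lemma qd33_Osub (hs : S = s 0 + s 1 + s 2) (hS : S ≠ 0)
    (hc : ((c ^ S : ℂ⟦X⟧ˣ) : ℂ⟦X⟧) = t) :
    qd33 (Osub s c) = toHahn (series33 qz E13 F13 qK t) := by
  refine (qd33_eq (inverse_Osub_00 c hs hS hc) (Osub_22 c hs hS hc) (Osub_20 c hs)
    (Osub_02 c hs)).trans ?_
  refine Eq.trans (congrArg₂ (· - ·) rfl ?_) (toHahn_sub _ _).symm
  rw [zetaPow_mul_mul, add_sub_cancel, mul_assoc _ (PowerSeries.C _) PowerSeries.X,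
    toHahn_mul (_ * geom _),
    toHahn_C_smul_mul_X S c hS hc, ← mul_assoc _ (zetaPow S c S), zetaPow_comm, toHahn_mul,
    mul_assoc (zetaPow _ _ _)]
  rfl

end Operator


/-! ### Cancellation identities for central factors and inverses. -/

section RingIdentities

variable {R : Type*} [Ring R]

lemma neg_mul_neg_mul {z z' a i : R} (h : z * z' = 1) : -(z * -(z' * a) * i) = a * i := by
  rw [mul_neg, neg_mul, neg_neg, ← mul_assoc, h, one_mul]

lemma mul_mul_mul_neg {z z' r i f : R} (h : z * z' = 1) (hz : ∀ x, x * z' = z' * x) :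
    z * r * i * -(z' * f) = -(r * i * f) := by
  rw [mul_neg, ← mul_assoc, hz, ← mul_assoc, ← mul_assoc, ← hz z, h, one_mul]

lemma eq_one_sub_inverse_mul {a b y : R} (ha : IsUnit a) (h : a * (1 - y) = b) :
    y = 1 - Ring.inverse a * b := by
  rw [← h, Ring.inverse_mul_cancel_left _ _ ha, sub_sub_cancel]

lemma eq_neg_mul_inverse_mul {z z' r p x y : R} (h : z * z' = 1) (hz : ∀ x, x * z' = z' * x)
    (hp : IsUnit p) (hy : p * y = -(r * x)) (hr : r * p = p * r) :
    y = -(z * r * Ring.inverse p * (z' * x)) := by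
  rw [← mul_assoc, hz, ← mul_assoc, ← mul_assoc, ← hz z, h, one_mul]
  refine hp.mul_left_cancel ?_
  rw [hy, mul_neg, ← mul_assoc, ← mul_assoc, ← hr, mul_assoc r, Ring.mul_inverse_cancel _ hp,
    mul_one]

/-- If `O'₃₂` is already a right multiple of `O'₂₂`, the inverse in `O''₃₃` disappears. The formula
for `α₂₃` provides such a factorization, with the generating function as `y`. -/
lemma qdd33_eq {A : Matrix (Fin 3) (Fin 3) R} {z z' p y x : R} (hp : IsUnit p)
    (hz : ∀ x, x * z' = z' * x) (h22 : qd22 A = p) (h32 : qd32 A = z * (y * p))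
    (h23 : qd23 A = z' * x) : qdd33 A = qd33 A + z * z' * (y * x) := by
  rw [qdd33, h22, h32, h23, ← mul_assoc z y p, Ring.mul_inverse_cancel_right _ _ hp,
    ← mul_assoc (z * y), hz, ← mul_assoc, ← hz z]
  simp only [mul_assoc]

end RingIdentities

/-! ### Generating functions and the powers of `ζ`. -/

section Generating

open Gl

variable {S : ℤ} {c : ℂ⟦X⟧ˣ} {t : ℂ⟦X⟧}

lemma toHahn_smul_mul_X (hS : S ≠ 0) (hc : ((c ^ S : ℂ⟦X⟧ˣ) : ℂ⟦X⟧) = t) (y : PowerSeries UGl) :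
    toHahn (t • (y * PowerSeries.X)) = zetaPow S c S * toHahn y := by
  have h : t • (y * PowerSeries.X) =
      PowerSeries.C (algebraMap ℂ⟦X⟧ UGl t) * PowerSeries.X * y := by
    rw [mul_assoc, PowerSeries.X_mul]
    ext n
    rw [coeff_C_mul, coeff_smul, Algebra.smul_def]
  rw [h, toHahn_mul, zetaPow_self S c hS hc]

lemma zetaSubst_mono_one (m : ℤ) : zetaSubst S c (mono 1 m) = zetaPow S c m := by
  rw [zetaSubst_mono, map_one, map_one, toHahn_one, mul_one]

lemma zetaPow_neg_mul (m : ℤ) : zetaPow S c (-m) * zetaPow S c m = 1 := by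
  rw [zetaPow_mul, neg_add_cancel, zetaPow_zero]

lemma C_algebraMap_comm (r : ℂ⟦X⟧) (x : PowerSeries UGl) :
    PowerSeries.C (algebraMap ℂ⟦X⟧ UGl r) * x = x * PowerSeries.C (algebraMap ℂ⟦X⟧ UGl r) := by
  ext n
  rw [coeff_C_mul, coeff_mul_C, Algebra.commutes]

lemma C_algebraMap_mul (r : ℂ⟦X⟧) (x : PowerSeries UGl) :
    PowerSeries.C (algebraMap ℂ⟦X⟧ UGl r) * x = r • x := by
  ext n
  rw [coeff_C_mul, coeff_smul, Algebra.smul_def]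

lemma smul_mk_mul_pow (x s : UGl) :
    kappa • PowerSeries.mk (fun n => x * s ^ n) = PowerSeries.C (kappa • x) * geom s := by
  ext n
  rw [coeff_C_mul, coeff_smul, coeff_mk, geom, coeff_mk, smul_mul_assoc]

/-- The factor `q` in front of the dual formulas compensates the `q⁻¹` in the upper triangular
entries of `O`. -/
lemma smul_mk_pow_mul (x s : UGl) : kappa • PowerSeries.mk (fun n => s ^ n * -x) =
    -(PowerSeries.C (algebraMap ℂ⟦X⟧ UGl (qz 1)) * geom s *
      PowerSeries.C ((kappa * qz (-1)) • x)) := by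
  have h : qz 1 * (kappa * qz (-1)) = kappa := by
    rw [mul_comm kappa, ← mul_assoc, ← qz_add, add_neg_cancel, qz_zero, one_mul]
  ext n
  rw [map_neg, coeff_mul_C, coeff_C_mul, coeff_smul, coeff_mk, geom, coeff_mk, ← Algebra.smul_def,
    smul_mul_smul_comm, h, mul_neg, smul_neg]

lemma gen_eq_mk_mul_X (ε : ULoop →ₐ[ℂ⟦X⟧] UGl) {u : ℕ → ULoop} (h0 : u 0 = 0) :
    gen ε u = PowerSeries.mk (fun n => ε (u (n + 1))) * PowerSeries.X := by
  ext n
  cases n with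
  | zero => simp [gen, h0]
  | succ n => rw [coeff_succ_mul_X, gen, coeff_mk, coeff_mk]

end Generating

/-! ### The quasi-determinant formulas for the generating functions. -/

namespace IsJimbo

open Gl

variable {ε : ULoop →ₐ[ℂ⟦X⟧] UGl} {s : Fin 3 → ℤ} {S : ℤ} {c : ℂ⟦X⟧ˣ}

theorem gen_e12 (h : IsJimbo ε) (hs : S = s 0 + s 1 + s 2) (hS : S ≠ 0)
    (hc : ((c ^ S : ℂ⟦X⟧ˣ) : ℂ⟦X⟧) = qz 2) : toHahn (kappa • gen ε Loop.e12) =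
      -(zetaSubst S c (mono 1 (-s 1)) * Osub s c 1 0 * Ring.inverse (Osub s c 0 0)) := by
  rw [Osub_10 c hs, inverse_Osub_00 c hs hS hc, zetaSubst_mono_one]
  refine Eq.trans ?_ (neg_mul_neg_mul (zetaPow_neg_mul _)).symm
  rw [← toHahn_mul, ← smul_mk_mul_pow, gen]
  simp only [h.map_e12]

theorem gen_e13 (h : IsJimbo ε) (hs : S = s 0 + s 1 + s 2) (hS : S ≠ 0)
    (hc : ((c ^ S : ℂ⟦X⟧ˣ) : ℂ⟦X⟧) = -qz 2) : toHahn (kappa • gen ε Loop.e13) =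
      zetaSubst S c (mono 1 (-(s 1 + s 2))) * Osub s c 2 0 * Ring.inverse (Osub s c 0 0) := by
  rw [Osub_20 c hs, inverse_Osub_00 c hs hS hc, zetaSubst_mono_one, ← mul_assoc (zetaPow _ _ _),
    zetaPow_neg_mul, one_mul, ← toHahn_mul, ← smul_mk_mul_pow, gen]
  simp only [h.map_e13, neg_smul]

theorem gen_d12 (h : IsJimbo ε) (hs : S = s 0 + s 1 + s 2) (hS : S ≠ 0)
    (hc : ((c ^ S : ℂ⟦X⟧ˣ) : ℂ⟦X⟧) = qz 2) : toHahn (kappa • gen ε Loop.d12) =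
      zetaSubst S c (mono (qz 1) (-(S - s 1))) * Ring.inverse (Osub s c 0 0) * Osub s c 0 1 := by
  rw [Osub_01 c hs, inverse_Osub_00 c hs hS hc, zetaSubst_mono]
  refine Eq.trans ?_ (mul_mul_mul_neg (zetaPow_neg_mul _) (zetaPow_comm S c _)).symm
  rw [← toHahn_mul, ← toHahn_mul]
  refine Eq.trans ?_ (toHahn_neg _)
  rw [← smul_mk_pow_mul, gen]
  simp only [h.map_d12]

theorem gen_d13 (h : IsJimbo ε) (hs : S = s 0 + s 1 + s 2) (hS : S ≠ 0)
    (hc : ((c ^ S : ℂ⟦X⟧ˣ) : ℂ⟦X⟧) = -qz 2) : toHahn (kappa • gen ε Loop.d13) =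
      zetaSubst S c (mono (qz 1) (-(S - (s 1 + s 2)))) *
        Ring.inverse (Osub s c 0 0) * Osub s c 0 2 := by
  rw [Osub_02 c hs, inverse_Osub_00 c hs hS hc, zetaSubst_mono]
  refine Eq.trans ?_ (mul_mul_mul_neg (zetaPow_neg_mul _) (zetaPow_comm S c _)).symm
  rw [← toHahn_mul, ← toHahn_mul]
  refine Eq.trans ?_ (toHahn_neg _)
  rw [← smul_mk_pow_mul, gen]
  simp only [h.map_d13, neg_smul]

theorem gen_im1 (h : IsJimbo ε) (hs : S = s 0 + s 1 + s 2) (hS : S ≠ 0)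
    (hc : ((c ^ S : ℂ⟦X⟧ˣ) : ℂ⟦X⟧) = qz 2) : toHahn (kappa • gen ε Loop.im1) =
      1 - Ring.inverse (Osub s c 0 0) * qd22 (Osub s c) := by
  refine eq_one_sub_inverse_mul (isUnit_Osub_00 c hs hS hc) ?_
  rw [Osub_00 c hs hS hc, qd22_Osub c hs hS hc, ← glOrdering.series11_mul h.map_im1, toHahn_mul,
    gen_eq_mk_mul_X ε rfl]
  refine congrArg _ (Eq.trans ?_ (toHahn_sub _ _).symm)
  rw [toHahn_one]
  rfl

theorem isUnit_qd22 (hs : S = s 0 + s 1 + s 2) (hS : S ≠ 0)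
    (hc : ((c ^ S : ℂ⟦X⟧ˣ) : ℂ⟦X⟧) = qz 3) : IsUnit (qd22 (Osub s c)) := by
  rw [qd22_Osub c hs hS hc]
  exact (isUnit_series22 _ _ _ _ _).map (HahnSeries.ofPowerSeries ℚ UGl)

lemma gen_quasiDet (h : IsJimbo ε) :
    (kappa • gen ε Loop.e23) * series22 qz E12 F12 qK (qz 3) =
      series32 qz E23 E13 F12 qK (qz 3) ∧
    series22 qz E12 F12 qK (qz 3) * (kappa • gen ε Loop.d23) =
      -(qz 2 • series23 qz E12 F23 F13 qK (qz 3)) ∧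
    series22 qz E12 F12 qK (qz 3) * (1 - kappa • gen ε Loop.im2) =
      series33 qz E13 F13 qK (qz 3) + qz 3 • ((kappa • gen ε Loop.e23) *
        series23 qz E12 F23 F13 qK (qz 3) * PowerSeries.X) := by
  obtain ⟨h1, h2, h3⟩ := glOrdering.series_eq_quasiDet h.map_eδ1
    (e := fun n => ε (Loop.e23 n)) (d := fun n => ε (Loop.d23 n)) h.map_e23_zero map_e23_succ
    h.map_eδ23 map_d23_succ (fun n => rfl)
  refine ⟨h1, h2, ?_⟩
  -- The imaginary series starts in degree one and `im2 (n + 1)` maps to minus the `n`-th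
  -- anticommutator; this turns `1 - κ_q` times the series into `1 + κ_q w X`.
  rw [gen_eq_mk_mul_X ε rfl]
  refine Eq.trans ?_ h3
  congr 1
  ext n
  cases n with
  | zero => simp
  | succ n =>
    rw [map_sub, map_add, coeff_smul, coeff_smul, coeff_succ_mul_X, coeff_succ_mul_X, coeff_mk,
      coeff_mk, map_im2, smul_neg, sub_neg_eq_add]
    rfl

theorem gen_e23 (h : IsJimbo ε) (hs : S = s 0 + s 1 + s 2) (hS : S ≠ 0)
    (hc : ((c ^ S : ℂ⟦X⟧ˣ) : ℂ⟦X⟧) = qz 3) : toHahn (kappa • gen ε Loop.e23) =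
      zetaSubst S c (mono 1 (-s 2)) * qd32 (Osub s c) * Ring.inverse (qd22 (Osub s c)) := by
  rw [Ring.eq_mul_inverse_iff_mul_eq _ _ _ (isUnit_qd22 hs hS hc), qd22_Osub c hs hS hc,
    qd32_Osub c hs hS hc, zetaSubst_mono_one, ← mul_assoc, zetaPow_neg_mul, one_mul, ← toHahn_mul,
    h.gen_quasiDet.1]

theorem gen_d23 (h : IsJimbo ε) (hs : S = s 0 + s 1 + s 2) (hS : S ≠ 0)
    (hc : ((c ^ S : ℂ⟦X⟧ˣ) : ℂ⟦X⟧) = qz 3) : toHahn (kappa • gen ε Loop.d23) =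
      -(zetaSubst S c (mono (qz 2) (-(S - s 2))) *
        Ring.inverse (qd22 (Osub s c)) * qd23 (Osub s c)) := by
  rw [zetaSubst_mono, qd23_Osub c hs hS hc]
  refine eq_neg_mul_inverse_mul (zetaPow_neg_mul _) (zetaPow_comm S c _)
    (isUnit_qd22 hs hS hc) ?_ ?_
  · rw [qd22_Osub c hs hS hc, ← toHahn_mul, h.gen_quasiDet.2.1, ← toHahn_mul, C_algebraMap_mul]
    exact toHahn_neg _
  · rw [qd22_Osub c hs hS hc, ← toHahn_mul, ← toHahn_mul, C_algebraMap_comm]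

theorem gen_im2 (h : IsJimbo ε) (hs : S = s 0 + s 1 + s 2) (hS : S ≠ 0)
    (hc : ((c ^ S : ℂ⟦X⟧ˣ) : ℂ⟦X⟧) = qz 3) : toHahn (kappa • gen ε Loop.im2) =
      1 - Ring.inverse (qd22 (Osub s c)) * qdd33 (Osub s c) := by
  refine eq_one_sub_inverse_mul (isUnit_qd22 hs hS hc) ?_
  have hu := isUnit_qd22 hs hS hc
  have h22 := qd22_Osub c hs hS hc
  have h32 := qd32_Osub c hs hS hc
  -- Writing `O'₃₂` as the `α₂₃` series times `O'₂₂` removes the inverse from `O''₃₃`; the two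
  -- remaining powers of `ζ` then multiply to `ζ ^ S`, that is, to `q³ ζ` after the substitution.
  rw [← h.gen_quasiDet.1, toHahn_mul] at h32
  rw [qdd33_eq (h22 ▸ hu) (zetaPow_comm S c _) h22 h32 (qd23_Osub c hs hS hc), zetaPow_mul,
    add_sub_cancel, qd33_Osub c hs hS hc, h22, ← toHahn_mul, ← toHahn_smul_mul_X hS hc,
    ← toHahn_add, ← h.gen_quasiDet.2.2, toHahn_mul]
  refine congrArg _ (Eq.trans ?_ (toHahn_sub _ _).symm)
  rw [toHahn_one]

end IsJimbo

end QLoop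

end

open QLoop in
theorem mainTheorem2 :
    (∃! ε : ULoop →ₐ[PowerSeries ℂ] UGl, IsJimbo ε) ∧
    ∀ ε : ULoop →ₐ[PowerSeries ℂ] UGl, IsJimbo ε →
    ∀ (s : Fin 3 → ℤ) (S : ℤ), S = s 0 + s 1 + s 2 → S ≠ 0 →
    ∀ c : (PowerSeries ℂ)ˣ,
      (((c ^ S : (PowerSeries ℂ)ˣ) : PowerSeries ℂ) = qz 2 →
        IsUnit (Osub s c 0 0) ∧
        toHahn (kappa • gen ε Loop.e12) =
          -(zetaSubst S c (mono 1 (-s 1)) * Osub s c 1 0 * Ring.inverse (Osub s c 0 0)) ∧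
        toHahn (kappa • gen ε Loop.d12) =
          zetaSubst S c (mono (qz 1) (-(S - s 1))) *
            Ring.inverse (Osub s c 0 0) * Osub s c 0 1 ∧
        toHahn (kappa • gen ε Loop.im1) =
          1 - Ring.inverse (Osub s c 0 0) * qd22 (Osub s c)) ∧
      (((c ^ S : (PowerSeries ℂ)ˣ) : PowerSeries ℂ) = -qz 2 →
        IsUnit (Osub s c 0 0) ∧
        toHahn (kappa • gen ε Loop.e13) =
          zetaSubst S c (mono 1 (-(s 1 + s 2))) * Osub s c 2 0 * Ring.inverse (Osub s c 0 0) ∧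
        toHahn (kappa • gen ε Loop.d13) =
          zetaSubst S c (mono (qz 1) (-(S - (s 1 + s 2)))) *
            Ring.inverse (Osub s c 0 0) * Osub s c 0 2) ∧
      (((c ^ S : (PowerSeries ℂ)ˣ) : PowerSeries ℂ) = qz 3 →
        IsUnit (Osub s c 0 0) ∧ IsUnit (qd22 (Osub s c)) ∧
        toHahn (kappa • gen ε Loop.e23) =
          zetaSubst S c (mono 1 (-s 2)) * qd32 (Osub s c) * Ring.inverse (qd22 (Osub s c)) ∧
        toHahn (kappa • gen ε Loop.d23) =
          -(zetaSubst S c (mono (qz 2) (-(S - s 2))) *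
            Ring.inverse (qd22 (Osub s c)) * qd23 (Osub s c)) ∧
        toHahn (kappa • gen ε Loop.im2) =
          1 - Ring.inverse (qd22 (Osub s c)) * qdd33 (Osub s c)) := by
  refine ⟨Gl.existsUnique_jimbo, fun ε h s S hs hS c => ⟨fun hc => ?_, fun hc => ?_, fun hc => ?_⟩⟩
  · exact ⟨isUnit_Osub_00 c hs hS hc, h.gen_e12 hs hS hc, h.gen_d12 hs hS hc, h.gen_im1 hs hS hc⟩
  · exact ⟨isUnit_Osub_00 c hs hS hc, h.gen_e13 hs hS hc, h.gen_d13 hs hS hc⟩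
  · exact ⟨isUnit_Osub_00 c hs hS hc, IsJimbo.isUnit_qd22 hs hS hc, h.gen_e23 hs hS hc,
      h.gen_d23 hs hS hc, h.gen_im2 hs hS hc⟩
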